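/- **Theorem (generalized Hall construction).** Let $\Delta$ be the category of finite nonempty linearly ordered sets and monotone maps, and let $\Delta_S\subseteq\Delta$ be an *admissible* subcategory: for every $N\in\Delta_S$ and $x\le y$ in $N$ such that $x<y$, or such that $\{x\}=[x,y]$ is the image of a morphism of $\Delta_S$, the interval $[x,y]\subseteq N$ lies in $\Delta_S$ together with its inclusion into $N$, and every morphism of $\Delta_S$ into $N$ with image in $[x,y]$ factors in $\Delta_S$ through $[x,y]$. A functor $\mathcal X\colon\Delta_S^{\mathrm{op}}\to\mathrm{Grpd}$ to small groupoids is *2-Segal* if for every morphism $f\colon M\to N$ of $\Delta_S$ preserving the smallest and the largest element, with $M=\{0<\dots<m\}$, the square $$\mathcal X_N\to\mathcal X_M,\qquad \mathcal X_N\to\prod_{i=1}^{m}\mathcal X_{[f(i-1),f(i)]}\qquad\text{over}\qquad \prod_{i=1}^{m}\mathcal X_{\{i-1,i\}}$$ is 2-Cartesian. An op-fibration of categories $E\to\Delta_S^{\mathrm{op}}$ is *pointed 1-Segal* if for every $N=\{0<\dots<n\}$ in $\Delta_S$ the push-forwards to the edges of $N$ induce an equivalence of fibres $E_N\simeq\prod_{i=1}^{n}E_{\{i-1,i\}}$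 (so $E_N$ is trivial if $N$ is a point). A *lax morphism* of such op-fibrations is a functor over $\Delta_S^{\mathrm{op}}$ which preserves co-Cartesian morphisms over inclusions of intervals. A *left monoidal derivator of groupoids* $\mathcal V$ is a (pseudo-)functor $A\mapsto\mathcal V(A)$, $F\mapsto F^*$, contravariant on functors and covariant on natural transformations, from the 2-category of small groupoids to the 2-category of monoidal categories, strong monoidal functors and monoidal transformations, such that every $F^*$ has a left adjoint $F_!$ and the Beck–Chevalley morphisms of all 2-Cartesian squares of groupoids are isomorphisms. It is *componentwise cocontinuous* if the canonical maps $(F\times\mathrm{id})_!(Z\boxtimes Z')\to F_!Z\boxtimes Z'$ and $(\mathrm{id}\times F)_!(Z'\boxtimes Z)\to Z'\boxtimes F_!Z$ are isomorphisms, where $Z\boxtimes Z'=\mathrm{pr}_1^*Z\otimes\mathrm{pr}_2^*Z'$. Then every componentwise cocontinuous left monoidal derivator of groupoids $\mathcal V$ induces a functor $$\mathrm{Hall}_{\mathcal V}\colon\{\text{2-Segal functors }\Delta_S^{\mathrm{op}}\to\mathrm{Grpd}\}^{\mathrm{op}}\longrightarrow\{\text{pointed 1-Segal op-fibrations over }\Delta_S^{\mathrm{op}}\}^{\mathrm{lax}}$$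 (contravariant in natural transformations, like $\mathcal V$ itself), of the following form. * An object of $\mathrm{Hall}_{\mathcal V}\mathcal X$ over $N$ is, up to isomorphism, a family of objects $A_{\{i-1,i\}}\in\mathcal V(\mathcal X_{\{i-1,i\}})$, one for each edge of $N$. It is extended to all intervals $[x,y]$ of $N$ lying in $\Delta_S$ by the tensor products $A_{[x,y]}=A_{\{x,x+1\}}\otimes\dots\otimes A_{\{y-1,y\}}\in\mathcal V(\mathcal X_{[x,y]})$ of the pull-backs to $\mathcal X_{[x,y]}$ (with $A_{[x,x]}$ the unit). * For $f\colon M\to N$ in $\Delta_S$, the morphisms over $f$ from $A$ (over $N$) to $B$ (over $M$) are the families of morphisms $A_{[f(i-1),f(i)]}\to f^*B_{\{i-1,i\}}$ in $\mathcal V(\mathcal X_{[f(i-1),f(i)]})$, for the edges of $M$. Such a family extends, by tensoring, to morphisms $A_{[f(x),f(y)]}\to f^*B_{[x,y]}$ for all intervals of $M$ lying in $\Delta_S$, and morphisms are composed by pulling back and composing these extensions. (Thus the push-forward along $f$ sends $A$ to the family of left Kan extensions of $A_{[f(i-1),f(i)]}$ along $\mathcal X_{[f(i-1),f(i)]}\to\mathcal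 X_{\{i-1,i\}}$.) * For $\Phi\colon\mathcal Y\to\mathcal X$, the functor $\mathrm{Hall}_{\mathcal V}(\Phi)\colon\mathrm{Hall}_{\mathcal V}\mathcal X\to\mathrm{Hall}_{\mathcal V}\mathcal Y$ is given, up to natural isomorphism compatible with the tensor products, by pulling back families and their morphisms along $\Phi$. -/

import Mathlib

open CategoryTheory MonoidalCategory Opposite
open CategoryTheory.Limits (CategoricalPullback)

universe s u v w v' u'

namespace Hall

/-! ### Subcategories of the simplex category -/

/-- A (not necessarily full) subcategory of the category `Δ` of all finite nonempty linearly
ordered sets and monotone maps.  The elements of the object `N` are numbered `0, …, len N`.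
Different objects may have the same number of elements: for instance `{0 < 1}` and `{0 < +∞}`
are isomorphic in `Δ`, but a subcategory may contain both and no isomorphism between them. -/
structure SimplexSubcategory where
  Obj : Type s
  len : Obj → ℕ
  homs : ∀ M N : Obj, Set (Fin (len M + 1) →o Fin (len N + 1))
  id_mem : ∀ N, OrderHom.id ∈ homs N N
  comp_mem : ∀ {L M N : Obj} {g : Fin (len L + 1) →o Fin (len M + 1)}
    {f : Fin (len M + 1) →o Fin (len N + 1)},
    g ∈ homs L M → f ∈ homs M N → f.comp g ∈ homs L N

namespace SimplexSubcategory

variable (S : SimplexSubcategory.{s})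

/-- The set of elements of `N`. -/
abbrev El (N : S.Obj) : Type := Fin (S.len N + 1)

instance : Category.{0} S.Obj where
  Hom M N := {f : S.El M →o S.El N // f ∈ S.homs M N}
  id N := ⟨OrderHom.id, S.id_mem N⟩
  comp g f := ⟨f.1.comp g.1, S.comp_mem g.2 f.2⟩

variable {S}

/-- `j : J ⟶ N` is the inclusion of the interval `[x, y]` of `N`: it identifies the ordered set `J`
with `[x, y]`, and every morphism of the subcategory into `N` whose image lies in `[x, y]`
corestricts to a morphism of the subcategory into `J`. -/
def IsIntervalInclusion {J N : S.Obj} (j : J ⟶ N) (x y : S.El N) : Prop :=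
  StrictMono j.1 ∧ Set.range j.1 = Set.Icc x y ∧
    ∀ {M : S.Obj} (g : M ⟶ N), Set.range g.1 ⊆ Set.Icc x y → ∃ g' : M ⟶ J, g' ≫ j = g

/-- The interval `[x, y]` of `N` belongs to the subcategory. -/
def HasInterval (N : S.Obj) (x y : S.El N) : Prop :=
  ∃ (J : S.Obj) (j : J ⟶ N), IsIntervalInclusion j x y

variable (S) in
/-- A subcategory of `Δ` is admissible if it is closed under passing to intervals `[x, y]` (in its
objects) which have at least two elements or are the image of a morphism of the subcategory. -/
def IsAdmissible : Prop :=
  ∀ (N : S.Obj) (x y : S.El N), x ≤ y →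
    (x < y ∨ ∃ (M : S.Obj) (g : M ⟶ N), Set.range g.1 = Set.Icc x y) → HasInterval N x y

/-- The interval `[x, y]` of `N`, as an object. -/
noncomputable def ivl {N : S.Obj} {x y : S.El N} (h : HasInterval N x y) : S.Obj := h.choose

/-- The inclusion of the interval `[x, y]` into `N`. -/
noncomputable def ivlι {N : S.Obj} {x y : S.El N} (h : HasInterval N x y) : ivl h ⟶ N :=
  h.choose_spec.choose

theorem ivlι_spec {N : S.Obj} {x y : S.El N} (h : HasInterval N x y) :
    IsIntervalInclusion (ivlι h) x y := h.choose_spec.choose_spec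

theorem ivlι_mem {N : S.Obj} {x y : S.El N} (h : HasInterval N x y) (k : S.El (ivl h)) :
    (ivlι h).1 k ∈ Set.Icc x y := (ivlι_spec h).2.1 ▸ Set.mem_range_self k

theorem HasInterval.le {N : S.Obj} {x y : S.El N} (h : HasInterval N x y) : x ≤ y :=
  (ivlι_mem h 0).1.trans (ivlι_mem h 0).2

theorem ivlι_cancel {M N : S.Obj} {x y : S.El N} (h : HasInterval N x y) {g g' : M ⟶ ivl h}
    (e : g ≫ ivlι h = g' ≫ ivlι h) : g = g' := by
  apply Subtype.ext
  ext k : 2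
  exact (ivlι_spec h).1.injective
    (congrArg (fun q : M ⟶ N => q.1 k) e)

theorem exists_ivlMap {M N : S.Obj} (f : M ⟶ N) {x y : S.El M} {x' y' : S.El N}
    (h : HasInterval M x y) (h' : HasInterval N x' y') (hx : x' ≤ f.1 x) (hy : f.1 y ≤ y') :
    ∃ g : ivl h ⟶ ivl h', g ≫ ivlι h' = ivlι h ≫ f :=
  (ivlι_spec h').2.2 (ivlι h ≫ f) (by
    rintro _ ⟨k, rfl⟩
    exact ⟨hx.trans (f.1.monotone (ivlι_mem h k).1),
      (f.1.monotone (ivlι_mem h k).2).trans hy⟩)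

/-- The restriction `[x, y] ⟶ [x', y']` of `f : M ⟶ N`, for intervals `[x, y]` of `M` and
`[x', y']` of `N` such that `f` maps `[x, y]` into `[x', y']`. -/
noncomputable def ivlMap {M N : S.Obj} (f : M ⟶ N) {x y : S.El M} {x' y' : S.El N}
    (h : HasInterval M x y) (h' : HasInterval N x' y') (hx : x' ≤ f.1 x) (hy : f.1 y ≤ y') :
    ivl h ⟶ ivl h' :=
  (exists_ivlMap f h h' hx hy).choose

theorem ivlMap_ι {M N : S.Obj} (f : M ⟶ N) {x y : S.El M} {x' y' : S.El N}
    (h : HasInterval M x y) (h' : HasInterval N x' y') (hx : x' ≤ f.1 x) (hy : f.1 y ≤ y') :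
    ivlMap f h h' hx hy ≫ ivlι h' = ivlι h ≫ f :=
  (exists_ivlMap f h h' hx hy).choose_spec

/-- The inclusion of `[x, y]` into a larger interval `[x', y']` of `N`. -/
noncomputable def ivlInc {N : S.Obj} {x y x' y' : S.El N} (h : HasInterval N x y)
    (h' : HasInterval N x' y') (hx : x' ≤ x) (hy : y ≤ y') : ivl h ⟶ ivl h' :=
  ivlMap (𝟙 N) h h' hx hy

theorem ivlInc_ι {N : S.Obj} {x y x' y' : S.El N} (h : HasInterval N x y)
    (h' : HasInterval N x' y') (hx : x' ≤ x) (hy : y ≤ y') :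
    ivlInc h h' hx hy ≫ ivlι h' = ivlι h :=
  (ivlMap_ι (𝟙 N) h h' hx hy).trans (Category.comp_id _)

theorem ivlInc_self {N : S.Obj} {x y : S.El N} (h : HasInterval N x y) :
    ivlInc h h le_rfl le_rfl = 𝟙 _ :=
  ivlι_cancel h ((ivlInc_ι h h le_rfl le_rfl).trans (Category.id_comp _).symm)

theorem ivlInc_ivlInc {N : S.Obj} {x y x' y' x'' y'' : S.El N} (h : HasInterval N x y)
    (h' : HasInterval N x' y') (h'' : HasInterval N x'' y'') (hx : x' ≤ x) (hy : y ≤ y')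
    (hx' : x'' ≤ x') (hy' : y' ≤ y'') :
    ivlInc h h' hx hy ≫ ivlInc h' h'' hx' hy' =
      ivlInc h h'' (hx'.trans hx) (hy.trans hy') := by
  apply ivlι_cancel
  rw [Category.assoc, ivlInc_ι, ivlInc_ι, ivlInc_ι]

theorem ivlMap_ivlInc {M N : S.Obj} (f : M ⟶ N) {x y x₁ y₁ : S.El M} {x' y' x₁' y₁' : S.El N}
    (h : HasInterval M x y) (h₁ : HasInterval M x₁ y₁) (h' : HasInterval N x' y')
    (h₁' : HasInterval N x₁' y₁') (hx : x' ≤ f.1 x) (hy : f.1 y ≤ y') (hx' : x₁' ≤ x')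
    (hy' : y' ≤ y₁') (hx₁ : x₁ ≤ x) (hy₁ : y ≤ y₁) (hx₁' : x₁' ≤ f.1 x₁) (hy₁' : f.1 y₁ ≤ y₁') :
    ivlMap f h h' hx hy ≫ ivlInc h' h₁' hx' hy' =
      ivlInc h h₁ hx₁ hy₁ ≫ ivlMap f h₁ h₁' hx₁' hy₁' := by
  apply ivlι_cancel
  rw [Category.assoc, ivlInc_ι, ivlMap_ι, Category.assoc, ivlMap_ι, ← Category.assoc, ivlInc_ι]

theorem ivlMap_comp {L M N : S.Obj} (g : L ⟶ M) (f : M ⟶ N) {x y : S.El L} {x' y' : S.El M}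
    {x'' y'' : S.El N} (h : HasInterval L x y) (h' : HasInterval M x' y')
    (h'' : HasInterval N x'' y'') (hx : x' ≤ g.1 x) (hy : g.1 y ≤ y') (hx' : x'' ≤ f.1 x')
    (hy' : f.1 y' ≤ y'') (hx'' : x'' ≤ (g ≫ f).1 x) (hy'' : (g ≫ f).1 y ≤ y'') :
    ivlMap g h h' hx hy ≫ ivlMap f h' h'' hx' hy' = ivlMap (g ≫ f) h h'' hx'' hy'' := by
  apply ivlι_cancel
  rw [ivlMap_ι, Category.assoc, ivlMap_ι, ← Category.assoc, ivlMap_ι, Category.assoc]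

namespace IsAdmissible

/-- If `[x, y]` is an interval of `M` in the subcategory and `f : M ⟶ N`, then `[f x, f y]` is an
interval of `N` in the subcategory. -/
theorem map (hS : S.IsAdmissible) {M N : S.Obj} (f : M ⟶ N) {x y : S.El M}
    (h : HasInterval M x y) :
    HasInterval N (f.1 x) (f.1 y) := by
  have hle : f.1 x ≤ f.1 y := f.1.monotone h.le
  refine hS N _ _ hle ?_
  rcases hle.lt_or_eq with hlt | heq
  · exact Or.inl hlt
  · refine Or.inr ⟨ivl h, ivlι h ≫ f, ?_⟩
    have key : ∀ k, (ivlι h ≫ f).1 k = f.1 x := fun k =>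
      le_antisymm (heq ▸ f.1.monotone (ivlι_mem h k).2) (f.1.monotone (ivlι_mem h k).1)
    rw [← heq, Set.Icc_self]
    ext z
    constructor
    · rintro ⟨k, rfl⟩
      exact key k
    · rintro rfl
      exact ⟨0, key 0⟩

/-- The edge `{i, i + 1}` of `N`. -/
theorem edge (hS : S.IsAdmissible) (N : S.Obj) (i : Fin (S.len N)) : HasInterval N i.castSucc i.succ :=
  hS N _ _ i.castSucc_lt_succ.le (Or.inl i.castSucc_lt_succ)

end IsAdmissible

end SimplexSubcategory

open SimplexSubcategory

variable {S : SimplexSubcategory.{s}}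

/-! ### The 2-Segal condition -/

/-- The restriction functor `X_N ⥤ X_M` along `f : M ⟶ N`. -/
def res (X : S.Objᵒᵖ ⥤ Grpd.{u, u}) {M N : S.Obj} (f : M ⟶ N) : X.obj (op N) ⥤ X.obj (op M) :=
  X.map f.op

theorem res_comp (X : S.Objᵒᵖ ⥤ Grpd.{u, u}) {L M N : S.Obj} (g : L ⟶ M) (f : M ⟶ N) :
    res X (g ≫ f) = res X f ⋙ res X g :=
  X.map_comp f.op g.op

theorem res_id (X : S.Objᵒᵖ ⥤ Grpd.{u, u}) (N : S.Obj) : res X (𝟙 N) = 𝟭 _ :=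
  X.map_id (op N)

section TwoSegal

variable (hS : S.IsAdmissible) (X : S.Objᵒᵖ ⥤ Grpd.{u, u})

/-- `X_N ⥤ ∏ᵢ X_{i, i + 1}`, the product being over the edges of `N`. -/
noncomputable def toEdges (N : S.Obj) :
    X.obj (op N) ⥤ ∀ i : Fin (S.len N), X.obj (op (ivl (hS.edge N i))) :=
  Functor.pi' fun i => res X (ivlι (hS.edge N i))

/-- `X_N ⥤ ∏ᵢ X_[f i, f (i + 1)]`, the product being over the edges of `M`, for `f : M ⟶ N`. -/
noncomputable def toHulls {M N : S.Obj} (f : M ⟶ N) :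
    X.obj (op N) ⥤ ∀ i : Fin (S.len M), X.obj (op (ivl (hS.map f (hS.edge M i)))) :=
  Functor.pi' fun i => res X (ivlι (hS.map f (hS.edge M i)))

/-- `∏ᵢ X_[f i, f (i + 1)] ⥤ ∏ᵢ X_{i, i + 1}`, the products being over the edges of `M`. -/
noncomputable def hullsToEdges {M N : S.Obj} (f : M ⟶ N) :
    (∀ i : Fin (S.len M), X.obj (op (ivl (hS.map f (hS.edge M i))))) ⥤
      ∀ i : Fin (S.len M), X.obj (op (ivl (hS.edge M i))) :=
  Functor.pi fun i => res X (ivlMap f (hS.edge M i) (hS.map f (hS.edge M i)) le_rfl le_rfl)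

theorem res_toEdges {M N : S.Obj} (f : M ⟶ N) :
    res X f ⋙ toEdges hS X M = toHulls hS X f ⋙ hullsToEdges hS X f := by
  apply Functor.pi_ext
  intro i
  change res X f ⋙ res X (ivlι (hS.edge M i)) =
    res X (ivlι (hS.map f (hS.edge M i))) ⋙
      res X (ivlMap f (hS.edge M i) (hS.map f (hS.edge M i)) le_rfl le_rfl)
  rw [← res_comp, ← res_comp, ivlMap_ι]

/-- The comparison functor from `X_N` to the 2-fibre product
`X_M ×_{∏ᵢ X_{i, i + 1}} ∏ᵢ X_[f i, f (i + 1)]`. -/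
noncomputable def segalComparison {M N : S.Obj} (f : M ⟶ N) :
    X.obj (op N) ⥤ CategoricalPullback (toEdges hS X M) (hullsToEdges hS X f) :=
  (CategoricalPullback.CatCommSqOver.toFunctorToCategoricalPullback _ _ _).obj
    { fst := res X f
      snd := toHulls hS X f
      iso := eqToIso (res_toEdges hS X f) }

/-- `X` is 2-Segal if for every endpoint preserving `f : M ⟶ N` the square
`X_N ⥤ X_M`, `X_N ⥤ ∏ᵢ X_[f i, f (i + 1)]` over `∏ᵢ X_{i, i + 1}` is 2-Cartesian.  For injective `f`
this is the decomposition of an `N`-gon into an `M`-gon and the polygons `[f i, f (i + 1)]`; for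
degenerate `f` it is the unitality condition. -/
def IsTwoSegal : Prop :=
  ∀ {M N : S.Obj} (f : M ⟶ N), f.1 0 = 0 → f.1 (Fin.last _) = Fin.last _ →
    (segalComparison hS X f).IsEquivalence

/-- The category of 2-Segal functors `Δ_Sᵒᵖ ⥤ Grpd` and natural transformations. -/
abbrev TwoSegal : Type (max s (u + 1)) :=
  ObjectProperty.FullSubcategory fun X : S.Objᵒᵖ ⥤ Grpd.{u, u} => IsTwoSegal hS X

end TwoSegal

/-! ### Pointed 1-Segal op-fibrations -/

/-- `p` is an op-fibration: every morphism out of `p a` has a co-Cartesian lift with source `a`. -/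
def IsOpfibration {E : Type u'} [Category.{v'} E] {B : Type*} [Category* B] (p : E ⥤ B) : Prop :=
  ∀ {R T : B} (f : R ⟶ T) (a : p.Fiber R),
    ∃ (b : E) (φ : a.1 ⟶ b), p.IsStronglyCocartesian f φ

namespace IsOpfibration

variable {E : Type u'} [Category.{v'} E] {B : Type*} [Category* B] {p : E ⥤ B}
  (hp : IsOpfibration p) {R T : B} (f : R ⟶ T)

/-- The target of the chosen co-Cartesian lift of `f` with source `a`. -/
noncomputable def pushObj (a : p.Fiber R) : E := (hp f a).choose

/-- The chosen co-Cartesian lift of `f` with source `a`. -/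
noncomputable def lift (a : p.Fiber R) : a.1 ⟶ hp.pushObj f a := (hp f a).choose_spec.choose

instance lift_cocartesian (a : p.Fiber R) : p.IsStronglyCocartesian f (hp.lift f a) :=
  (hp f a).choose_spec.choose_spec

theorem isHomLift_comp_lift {a b : p.Fiber R} (φ : a ⟶ b) :
    p.IsHomLift f (φ.1 ≫ hp.lift f b) := by
  have := φ.2
  simpa using (inferInstance : p.IsHomLift (𝟙 R ≫ f) (φ.1 ≫ hp.lift f b))

/-- The functor `E_R ⥤ E_T` between fibres given by co-Cartesian push-forward along `f`. -/
noncomputable def push : p.Fiber R ⥤ p.Fiber T where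
  obj a := ⟨hp.pushObj f a, IsHomLift.codomain_eq p f (hp.lift f a)⟩
  map {a b} φ :=
    have := hp.isHomLift_comp_lift f φ
    ⟨Functor.IsCocartesian.map p f (hp.lift f a) (φ.1 ≫ hp.lift f b), inferInstance⟩
  map_id a := by
    apply Subtype.ext
    have := hp.isHomLift_comp_lift f (𝟙 a)
    symm
    have : p.IsHomLift (𝟙 T) (𝟙 (hp.pushObj f a)) :=
      IsHomLift.id (IsHomLift.codomain_eq p f (hp.lift f a))
    apply Functor.IsCocartesian.map_uniq p f (hp.lift f a)
    exact (Category.comp_id _).trans (Category.id_comp _).symm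
  map_comp {a b c} φ ψ := by
    apply Subtype.ext
    have := hp.isHomLift_comp_lift f φ
    have := hp.isHomLift_comp_lift f ψ
    have := hp.isHomLift_comp_lift f (φ ≫ ψ)
    symm
    have : p.IsHomLift (𝟙 T)
        (Functor.IsCocartesian.map p f (hp.lift f a) (φ.1 ≫ hp.lift f b) ≫
          Functor.IsCocartesian.map p f (hp.lift f b) (ψ.1 ≫ hp.lift f c)) := inferInstance
    refine Functor.IsCocartesian.map_uniq p f (hp.lift f a) _ _ ?_
    have e : hp.lift f a ≫ (Functor.IsCocartesian.map p f (hp.lift f a) (φ.1 ≫ hp.lift f b) ≫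
        Functor.IsCocartesian.map p f (hp.lift f b) (ψ.1 ≫ hp.lift f c)) =
        (φ.1 ≫ ψ.1) ≫ hp.lift f c := by
      rw [Functor.IsCocartesian.fac_assoc, Category.assoc, Functor.IsCocartesian.fac,
        Category.assoc]
    exact e

end IsOpfibration

/-- A pointed 1-Segal op-fibration over `Δ_Sᵒᵖ`: an op-fibration `E ⥤ Δ_Sᵒᵖ` such that for every
`N` the push-forwards to the edges of `N` induce an equivalence `E_N ≌ ∏ᵢ E_{i, i + 1}`.  For a
one-point `N` the product is empty, that is, `E_N` is equivalent to the terminal category. -/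
structure SegalOpfibration (hS : S.IsAdmissible) where
  total : BasedCategory.{v', u'} S.Objᵒᵖ
  opfibration : IsOpfibration total.p
  segal : ∀ N : S.Obj, (Functor.pi' fun i : Fin (S.len N) =>
    opfibration.push (ivlι (hS.edge N i)).op).IsEquivalence

namespace SegalOpfibration

variable {hS : S.IsAdmissible}

/-- A functor over `Δ_Sᵒᵖ` is a lax morphism if it preserves the co-Cartesian morphisms which lie
over interval inclusions. -/
def IsLaxMorphism {E E' : SegalOpfibration.{s, v', u'} hS} (F : BasedFunctor E.total E'.total) :
    Prop :=
  ∀ {J N : S.Obj} (j : J ⟶ N) (x y : S.El N), IsIntervalInclusion j x y →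
    ∀ {a b : E.total.obj} (φ : a ⟶ b), E.total.p.IsStronglyCocartesian j.op φ →
      E'.total.p.IsStronglyCocartesian j.op (F.map φ)

instance : Category (SegalOpfibration.{s, v', u'} hS) where
  Hom E E' := {F : BasedFunctor E.total E'.total // IsLaxMorphism F}
  id E := ⟨BasedFunctor.id E.total, fun _ _ _ _ _ _ _ h => h⟩
  comp F G := ⟨BasedFunctor.comp F.1 G.1,
    fun j x y hj _ _ φ h => G.2 j x y hj (F.1.map φ) (F.2 j x y hj φ h)⟩

end SegalOpfibration

/-! ### Monoidal left derivators of groupoids -/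

/-- A monoidal prederivator of groupoids: a (pseudo-)functor `V` from the 2-category of small
groupoids, contravariant on functors and covariant on natural transformations, to the 2-category of
monoidal categories, strong monoidal functors and monoidal natural transformations. -/
structure MonoidalPrederivator where
  obj : Grpd.{u, u} → Type w
  [cat : ∀ A, Category.{v} (obj A)]
  [mon : ∀ A, MonoidalCategory (obj A)]
  pull : ∀ {A B : Grpd.{u, u}}, (A ⥤ B) → (obj B ⥤ obj A)
  [pullMonoidal : ∀ {A B : Grpd.{u, u}} (F : A ⥤ B), (pull F).Monoidal]
  pull₂ : ∀ {A B : Grpd.{u, u}} {F G : A ⥤ B}, (F ⟶ G) → (pull F ⟶ pull G)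
  pullId : ∀ A : Grpd.{u, u}, pull (𝟭 A) ≅ 𝟭 (obj A)
  pullComp : ∀ {A B C : Grpd.{u, u}} (F : A ⥤ B) (G : B ⥤ C), pull (F ⋙ G) ≅ pull G ⋙ pull F
  pull₂_monoidal : ∀ {A B : Grpd.{u, u}} {F G : A ⥤ B} (α : F ⟶ G),
    NatTrans.IsMonoidal (pull₂ α)
  pullId_monoidal : ∀ A : Grpd.{u, u}, NatTrans.IsMonoidal (pullId A).hom
  pullComp_monoidal : ∀ {A B C : Grpd.{u, u}} (F : A ⥤ B) (G : B ⥤ C),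
    NatTrans.IsMonoidal (pullComp F G).hom
  pull₂_id : ∀ {A B : Grpd.{u, u}} (F : A ⥤ B), pull₂ (𝟙 F) = 𝟙 (pull F)
  pull₂_comp : ∀ {A B : Grpd.{u, u}} {F G H : A ⥤ B} (α : F ⟶ G) (β : G ⟶ H),
    pull₂ (α ≫ β) = pull₂ α ≫ pull₂ β
  pullComp_naturality : ∀ {A B C : Grpd.{u, u}} {F F' : A ⥤ B} {G G' : B ⥤ C} (α : F ⟶ F')
    (β : G ⟶ G'),
    pull₂ (NatTrans.hcomp α β) ≫ (pullComp F' G').hom =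
      (pullComp F G).hom ≫ NatTrans.hcomp (pull₂ β) (pull₂ α)
  pullComp_assoc : ∀ {A B C D : Grpd.{u, u}} (F : A ⥤ B) (G : B ⥤ C) (H : C ⥤ D) (Z : obj D),
    (pullComp (F ⋙ G) H).hom.app Z ≫ (pullComp F G).hom.app ((pull H).obj Z) =
      (pullComp F (G ⋙ H)).hom.app Z ≫ (pull F).map ((pullComp G H).hom.app Z)
  pullComp_id_left : ∀ {A B : Grpd.{u, u}} (F : A ⥤ B) (Z : obj B),
    (pullComp (𝟭 A) F).hom.app Z ≫ (pullId A).hom.app ((pull F).obj Z) = 𝟙 _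
  pullComp_id_right : ∀ {A B : Grpd.{u, u}} (F : A ⥤ B) (Z : obj B),
    (pullComp F (𝟭 B)).hom.app Z ≫ (pull F).map ((pullId B).hom.app Z) = 𝟙 _

namespace MonoidalPrederivator

attribute [instance] cat mon pullMonoidal

variable (V : MonoidalPrederivator.{u, v, w})

/-- `η : Z ⟶ F^* W` exhibits `W` as the left Kan extension `F_! Z`, that is, `η` is a universal
arrow from `Z` to the functor `F^*` (a unit of the adjunction `F_! ⊣ F^*` at `Z`). -/
def IsLeftKan {A B : Grpd.{u, u}} (F : A ⥤ B) {Z : V.obj A} {W : V.obj B}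
    (η : Z ⟶ (V.pull F).obj W) : Prop :=
  ∀ W' : V.obj B, Function.Bijective fun g : W ⟶ W' => η ≫ (V.pull F).map g

/-- For a square of groupoids commuting up to `e : H ⋙ F ≅ K ⋙ G` (with `F : B ⥤ D`, `H : A ⥤ B`,
`G : C ⥤ D`, `K : A ⥤ C`), the base change `H^* Z ⟶ H^* F^* W ≅ K^* (G^* W)` of a morphism
`η : Z ⟶ F^* W`.  If `W = F_! Z` with unit `η`, this corresponds under `K_! ⊣ K^*` to the
Beck-Chevalley morphism `K_! H^* Z ⟶ G^* F_! Z`. -/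
def baseChange {A B C D : Grpd.{u, u}} {F : B ⥤ D} {G : C ⥤ D} {H : A ⥤ B} {K : A ⥤ C}
    (e : H ⋙ F ≅ K ⋙ G) {Z : V.obj B} {W : V.obj D} (η : Z ⟶ (V.pull F).obj W) :
    (V.pull H).obj Z ⟶ (V.pull K).obj ((V.pull G).obj W) :=
  (V.pull H).map η ≫ (V.pullComp H F).inv.app W ≫ (V.pull₂ e.hom).app W ≫
    (V.pullComp K G).hom.app W

/-- `V` is a left derivator of groupoids: every `F^*` has a left adjoint `F_!`, and these left Kan
extensions satisfy base change for all 2-Cartesian squares of groupoids (in terms of units: the base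
change of a left Kan extension is a left Kan extension).  The axioms that `V` turns coproducts into
products and that isomorphisms are detected pointwise are not imposed, so that all left derivators
which satisfy them are included. -/
structure IsLeftDerivator : Prop where
  leftKan : ∀ {A B : Grpd.{u, u}} (F : A ⥤ B), (V.pull F).IsRightAdjoint
  baseChange : ∀ {A B C D : Grpd.{u, u}} {F : B ⥤ D} {G : C ⥤ D} {H : A ⥤ B} {K : A ⥤ C}
    (e : H ⋙ F ≅ K ⋙ G),
    ((CategoricalPullback.CatCommSqOver.toFunctorToCategoricalPullback F G A).obj
      { fst := H, snd := K, iso := e }).IsEquivalence →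
    ∀ {Z : V.obj B} {W : V.obj D} (η : Z ⟶ (V.pull F).obj W), V.IsLeftKan F η →
      V.IsLeftKan K (V.baseChange e η)

/-- The product of two small groupoids. -/
abbrev prodGrpd (A B : Grpd.{u, u}) : Grpd.{u, u} := Grpd.of (A × B)

/-- The first projection. -/
abbrev pr₁ (A B : Grpd.{u, u}) : prodGrpd A B ⥤ A := CategoryTheory.Prod.fst A B

/-- The second projection. -/
abbrev pr₂ (A B : Grpd.{u, u}) : prodGrpd A B ⥤ B := CategoryTheory.Prod.snd A B

/-- The product of two functors between groupoids. -/
abbrev prodMap {A B A' B' : Grpd.{u, u}} (F : A ⥤ A') (G : B ⥤ B') :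
    prodGrpd A B ⥤ prodGrpd A' B' := Functor.prod F G

/-- The external product `Z ⊠ Z' = pr₁^* Z ⊗ pr₂^* Z'` in `V (A × B)`. -/
def ext {A B : Grpd.{u, u}} (Z : V.obj A) (Z' : V.obj B) : V.obj (prodGrpd A B) :=
  (V.pull (pr₁ A B)).obj Z ⊗ (V.pull (pr₂ A B)).obj Z'

/-- The external product of two morphisms. -/
def extMap {A B : Grpd.{u, u}} {Z W : V.obj A} {Z' W' : V.obj B} (f : Z ⟶ W) (g : Z' ⟶ W') :
    V.ext Z Z' ⟶ V.ext W W' :=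
  (V.pull (pr₁ A B)).map f ⊗ₘ (V.pull (pr₂ A B)).map g

/-- The canonical isomorphism `F^* Z ⊠ G^* Z' ≅ (F × G)^* (Z ⊠ Z')`. -/
def extPull {A B A' B' : Grpd.{u, u}} (F : A ⥤ A') (G : B ⥤ B') (Z : V.obj A') (Z' : V.obj B') :
    V.ext ((V.pull F).obj Z) ((V.pull G).obj Z') ≅ (V.pull (prodMap F G)).obj (V.ext Z Z') :=
  (((V.pullComp (pr₁ A B) F).symm.app Z ≪≫ (V.pullComp (prodMap F G) (pr₁ A' B')).app Z) ⊗ᵢ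
    ((V.pullComp (pr₂ A B) G).symm.app Z' ≪≫ (V.pullComp (prodMap F G) (pr₂ A' B')).app Z')) ≪≫
  Functor.Monoidal.μIso (V.pull (prodMap F G)) _ _

/-- The monoidal product preserves left Kan extensions in each variable separately:
`(F × 𝟭)_! (Z ⊠ Z') ≅ F_! Z ⊠ Z'` and `(𝟭 × F)_! (Z' ⊠ Z) ≅ Z' ⊠ F_! Z` via the canonical maps. -/
structure IsComponentwiseCocontinuous : Prop where
  left : ∀ {A A' : Grpd.{u, u}} (F : A ⥤ A') (B : Grpd.{u, u}) {Z : V.obj A} {W : V.obj A'}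
    (η : Z ⟶ (V.pull F).obj W), V.IsLeftKan F η → ∀ Z' : V.obj B,
      V.IsLeftKan (prodMap F (𝟭 B))
        (V.extMap η ((V.pullId B).inv.app Z') ≫ (V.extPull F (𝟭 B) W Z').hom)
  right : ∀ {A A' : Grpd.{u, u}} (F : A ⥤ A') (B : Grpd.{u, u}) {Z : V.obj A} {W : V.obj A'}
    (η : Z ⟶ (V.pull F).obj W), V.IsLeftKan F η → ∀ Z' : V.obj B,
      V.IsLeftKan (prodMap (𝟭 B) F)
        (V.extMap ((V.pullId B).inv.app Z') η ≫ (V.extPull (𝟭 B) F Z' W).hom)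

/-! ### The Hall construction -/

section Along

variable (X Y : S.Objᵒᵖ ⥤ Grpd.{u, u})

/-- For `f : M ⟶ N`, the functor `V (X_M) ⥤ V (X_N)` given by pull-back along `X_N ⥤ X_M`. -/
def along {M N : S.Obj} (f : M ⟶ N) : V.obj (X.obj (op M)) ⥤ V.obj (X.obj (op N)) :=
  V.pull (res X f)

instance {M N : S.Obj} (f : M ⟶ N) : (V.along X f).Monoidal := V.pullMonoidal _

/-- `along` is pseudo-functorial. -/
def alongComp {L M N : S.Obj} (g : L ⟶ M) (f : M ⟶ N) (h : L ⟶ N) (e : g ≫ f = h) :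
    V.along X h ≅ V.along X g ⋙ V.along X f :=
  eqToIso (by rw [← e, along, res_comp]) ≪≫ V.pullComp (res X f) (res X g)

/-- `along` is pseudo-functorial. -/
def alongId {N : S.Obj} (f : N ⟶ N) (e : f = 𝟙 N) : V.along X f ≅ 𝟭 _ :=
  eqToIso (by rw [e, along, res_id]) ≪≫ V.pullId _

/-- The isomorphism induced by a commutative square in `Δ_S`. -/
def alongSq {L M M' N : S.Obj} (g : L ⟶ M) (f : M ⟶ N) (g' : L ⟶ M') (f' : M' ⟶ N)
    (e : g ≫ f = g' ≫ f') : V.along X g ⋙ V.along X f ≅ V.along X g' ⋙ V.along X f' :=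
  (V.alongComp X g f _ rfl).symm ≪≫ V.alongComp X g' f' _ e.symm

variable {X Y}

/-- For `Φ : Y ⟶ X`, the functor `V (X_N) ⥤ V (Y_N)` given by pull-back along `Φ_N : Y_N ⥤ X_N`. -/
def pullAt (Φ : Y ⟶ X) (N : S.Obj) : V.obj (X.obj (op N)) ⥤ V.obj (Y.obj (op N)) :=
  V.pull (A := Y.obj (op N)) (B := X.obj (op N)) (Φ.app (op N))

instance (Φ : Y ⟶ X) (N : S.Obj) : (V.pullAt Φ N).Monoidal := V.pullMonoidal _

/-- The functors `pullAt Φ` are pseudo-natural with respect to `along`. -/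
def pullAtSq (Φ : Y ⟶ X) {M N : S.Obj} (f : M ⟶ N) :
    V.pullAt Φ M ⋙ V.along Y f ≅ V.along X f ⋙ V.pullAt Φ N :=
  (V.pullComp (A := Y.obj (op N)) (B := Y.obj (op M)) (C := X.obj (op M))
    (res Y f) (Φ.app (op M))).symm ≪≫
  eqToIso (congrArg (fun F : Y.obj (op N) ⥤ X.obj (op M) => V.pull F) (Φ.naturality f.op)) ≪≫
  V.pullComp (A := Y.obj (op N)) (B := X.obj (op N)) (C := X.obj (op M))
    (Φ.app (op N)) (res X f)

end Along

variable (X Y : S.Objᵒᵖ ⥤ Grpd.{u, u})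

/-- A multiplicative family on the intervals of `N`: objects `A_[x, y]` of `V (X_[x, y])` with
isomorphisms `A_[x, y] ⊗ A_[y, z] ≅ A_[x, z]` (both factors being pulled back to `X_[x, z]`) and
`𝟙 ≅ A_[x, x]`, associative and unital.  Up to unique isomorphism such a family is the same as the
family of its values `A_{i, i + 1}` on the edges of `N`: one has
`A_[x, y] ≅ A_{x, x + 1} ⊗ ⋯ ⊗ A_{y - 1, y}`. -/
structure MulFamily (N : S.Obj) where
  val : ∀ {x y : S.El N} (h : HasInterval N x y), V.obj (X.obj (op (ivl h)))
  mul : ∀ {x y z : S.El N} (hxy : HasInterval N x y) (hyz : HasInterval N y z)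
    (hxz : HasInterval N x z),
    (V.along X (ivlInc hxy hxz le_rfl hyz.le)).obj (val hxy) ⊗
      (V.along X (ivlInc hyz hxz hxy.le le_rfl)).obj (val hyz) ≅ val hxz
  one : ∀ {x : S.El N} (h : HasInterval N x x), 𝟙_ (V.obj (X.obj (op (ivl h)))) ≅ val h
  assoc : ∀ {x y z t : S.El N} (hxy : HasInterval N x y) (hyz : HasInterval N y z)
    (hzt : HasInterval N z t) (hxz : HasInterval N x z) (hyt : HasInterval N y t)
    (hxt : HasInterval N x t),
    ((((V.alongComp X (ivlInc hxy hxz le_rfl hyz.le) (ivlInc hxz hxt le_rfl hzt.le)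
            (ivlInc hxy hxt le_rfl hyt.le) (ivlInc_ivlInc _ _ _ _ _ _ _)).hom.app (val hxy) ⊗ₘ
          (V.alongComp X (ivlInc hyz hxz hxy.le le_rfl) (ivlInc hxz hxt le_rfl hzt.le)
            (ivlInc hyz hxt hxy.le hzt.le) (ivlInc_ivlInc _ _ _ _ _ _ _)).hom.app (val hyz)) ≫
        Functor.LaxMonoidal.μ (V.along X (ivlInc hxz hxt le_rfl hzt.le)) _ _ ≫
        (V.along X (ivlInc hxz hxt le_rfl hzt.le)).map (mul hxy hyz hxz).hom) ▷
          (V.along X (ivlInc hzt hxt hxz.le le_rfl)).obj (val hzt)) ≫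
        (mul hxz hzt hxt).hom =
      (α_ _ _ _).hom ≫
      ((V.along X (ivlInc hxy hxt le_rfl hyt.le)).obj (val hxy) ◁
        (((V.alongComp X (ivlInc hyz hyt le_rfl hzt.le) (ivlInc hyt hxt hxy.le le_rfl)
            (ivlInc hyz hxt hxy.le hzt.le) (ivlInc_ivlInc _ _ _ _ _ _ _)).hom.app (val hyz) ⊗ₘ
          (V.alongComp X (ivlInc hzt hyt hyz.le le_rfl) (ivlInc hyt hxt hxy.le le_rfl)
            (ivlInc hzt hxt hxz.le le_rfl) (ivlInc_ivlInc _ _ _ _ _ _ _)).hom.app (val hzt)) ≫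
        Functor.LaxMonoidal.μ (V.along X (ivlInc hyt hxt hxy.le le_rfl)) _ _ ≫
        (V.along X (ivlInc hyt hxt hxy.le le_rfl)).map (mul hyz hzt hyt).hom)) ≫
        (mul hxy hyt hxt).hom
  one_mul : ∀ {x y : S.El N} (hx : HasInterval N x x) (hxy : HasInterval N x y),
    ((Functor.LaxMonoidal.ε (V.along X (ivlInc hx hxy le_rfl hxy.le)) ≫
        (V.along X (ivlInc hx hxy le_rfl hxy.le)).map (one hx).hom) ▷
          (V.along X (ivlInc hxy hxy le_rfl le_rfl)).obj (val hxy)) ≫ (mul hx hxy hxy).hom =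
      (λ_ _).hom ≫ (V.alongId X _ (ivlInc_self hxy)).hom.app (val hxy)
  mul_one : ∀ {x y : S.El N} (hxy : HasInterval N x y) (hy : HasInterval N y y),
    ((V.along X (ivlInc hxy hxy le_rfl le_rfl)).obj (val hxy) ◁
        (Functor.LaxMonoidal.ε (V.along X (ivlInc hy hxy hxy.le le_rfl)) ≫
          (V.along X (ivlInc hy hxy hxy.le le_rfl)).map (one hy).hom)) ≫ (mul hxy hy hxy).hom =
      (ρ_ _).hom ≫ (V.alongId X _ (ivlInc_self hxy)).hom.app (val hxy)

variable {V X Y}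

/-- For `f : M ⟶ N`, a morphism over `f` from a multiplicative family `A` on `N` to a multiplicative
family `B` on `M`: morphisms `A_[f x, f y] ⟶ f^* B_[x, y]` in `V (X_[f x, f y])`, where `f^*` is
pull-back along `X_[f x, f y] ⥤ X_[x, y]`, compatible with the multiplication and the unit. -/
structure MulFamily.Hom (hS : S.IsAdmissible) {M N : S.Obj} (f : M ⟶ N) (A : V.MulFamily X N)
    (B : V.MulFamily X M) where
  app : ∀ {x y : S.El M} (h : HasInterval M x y),
    A.val (hS.map f h) ⟶ (V.along X (ivlMap f h (hS.map f h) le_rfl le_rfl)).obj (B.val h)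
  mul : ∀ {x y z : S.El M} (hxy : HasInterval M x y) (hyz : HasInterval M y z)
    (hxz : HasInterval M x z),
    (A.mul (hS.map f hxy) (hS.map f hyz) (hS.map f hxz)).hom ≫ app hxz =
      (((V.along X (ivlInc (hS.map f hxy) (hS.map f hxz) le_rfl (hS.map f hyz).le)).map (app hxy) ≫
          (V.alongSq X (ivlMap f hxy (hS.map f hxy) le_rfl le_rfl)
            (ivlInc (hS.map f hxy) (hS.map f hxz) le_rfl (hS.map f hyz).le)
            (ivlInc hxy hxz le_rfl hyz.le) (ivlMap f hxz (hS.map f hxz) le_rfl le_rfl)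
            (ivlMap_ivlInc _ _ _ _ _ _ _ _ _ _ _ _ _)).hom.app (B.val hxy)) ⊗ₘ
        ((V.along X (ivlInc (hS.map f hyz) (hS.map f hxz) (hS.map f hxy).le le_rfl)).map
            (app hyz) ≫
          (V.alongSq X (ivlMap f hyz (hS.map f hyz) le_rfl le_rfl)
            (ivlInc (hS.map f hyz) (hS.map f hxz) (hS.map f hxy).le le_rfl)
            (ivlInc hyz hxz hxy.le le_rfl) (ivlMap f hxz (hS.map f hxz) le_rfl le_rfl)
            (ivlMap_ivlInc _ _ _ _ _ _ _ _ _ _ _ _ _)).hom.app (B.val hyz))) ≫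
      Functor.LaxMonoidal.μ (V.along X (ivlMap f hxz (hS.map f hxz) le_rfl le_rfl)) _ _ ≫
      (V.along X (ivlMap f hxz (hS.map f hxz) le_rfl le_rfl)).map (B.mul hxy hyz hxz).hom
  one : ∀ {x : S.El M} (h : HasInterval M x x),
    (A.one (hS.map f h)).hom ≫ app h =
      Functor.LaxMonoidal.ε (V.along X (ivlMap f h (hS.map f h) le_rfl le_rfl)) ≫
        (V.along X (ivlMap f h (hS.map f h) le_rfl le_rfl)).map (B.one h).hom

variable (V X) in
/-- The structure of a Hall category of `X` (with respect to `V`) on a category `E` over `Δ_Sᵒᵖ`.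
The objects of `E` over `N` are multiplicative families on `N`, or equivalently (`exists_val`)
families of objects of `V (X_{i, i + 1})` for the edges of `N`.  The morphisms over `f : M ⟶ N` are
the morphisms of multiplicative families over `f`, or equivalently (`bijective`) the families of
morphisms
`A_{f i, f i + 1} ⊗ ⋯ ⊗ A_{f (i + 1) - 1, f (i + 1)} ≅ A_[f i, f (i + 1)] ⟶ f^* B_{i, i + 1}`
in `V (X_[f i, f (i + 1)])` for the edges of `M`.  Hence the fibre of `E` over `N` is
`∏ᵢ V (X_{i, i + 1})`, and the push-forward along `f` takes the family `A` to the family of the left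
Kan extensions of the tensor products `A_[f i, f (i + 1)]` along `X_[f i, f (i + 1)] ⥤ X_{i, i + 1}`
("pull, tensor, push"). -/
structure HallCategory (hS : S.IsAdmissible) (E : BasedCategory.{v', u'} S.Objᵒᵖ) where
  fam : ∀ {N : S.Obj}, E.p.Fiber (op N) → V.MulFamily X N
  hom : ∀ {M N : S.Obj} (f : M ⟶ N) {a : E.p.Fiber (op N)} {b : E.p.Fiber (op M)} (φ : a.1 ⟶ b.1),
    E.p.IsHomLift f.op φ → MulFamily.Hom hS f (fam a) (fam b)
  hom_id : ∀ {N : S.Obj} (a : E.p.Fiber (op N)) (hφ : E.p.IsHomLift (𝟙 N : N ⟶ N).op (𝟙 a.1))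
    {x y : S.El N} (h : HasInterval N x y),
    (hom (𝟙 N) (𝟙 a.1) hφ).app h = (V.alongId X _ (ivlInc_self h)).inv.app ((fam a).val h)
  hom_comp : ∀ {L M N : S.Obj} (g : L ⟶ M) (f : M ⟶ N) {a : E.p.Fiber (op N)}
    {b : E.p.Fiber (op M)} {c : E.p.Fiber (op L)} (φ : a.1 ⟶ b.1) (ψ : b.1 ⟶ c.1)
    (hφ : E.p.IsHomLift f.op φ) (hψ : E.p.IsHomLift g.op ψ)
    (hφψ : E.p.IsHomLift (g ≫ f).op (φ ≫ ψ)) {x y : S.El L} (h : HasInterval L x y),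
    (hom (g ≫ f) (φ ≫ ψ) hφψ).app h =
      (hom f φ hφ).app (hS.map g h) ≫
      (V.along X (ivlMap f (hS.map g h) (hS.map f (hS.map g h)) le_rfl le_rfl)).map
        ((hom g ψ hψ).app h) ≫
      (V.alongComp X (ivlMap g h (hS.map g h) le_rfl le_rfl)
        (ivlMap f (hS.map g h) (hS.map f (hS.map g h)) le_rfl le_rfl)
        (ivlMap (g ≫ f) h (hS.map (g ≫ f) h) le_rfl le_rfl)
        (ivlMap_comp g f _ _ _ _ _ _ _ _ _)).inv.app ((fam c).val h)
  bijective : ∀ {M N : S.Obj} (f : M ⟶ N) (a : E.p.Fiber (op N)) (b : E.p.Fiber (op M)),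
    Function.Bijective
      (fun φ : {φ : a.1 ⟶ b.1 // E.p.IsHomLift f.op φ} =>
        fun i : Fin (S.len M) => (hom f φ.1 φ.2).app (hS.edge M i))
  exists_val : ∀ (N : S.Obj) (A : ∀ i : Fin (S.len N), V.obj (X.obj (op (ivl (hS.edge N i))))),
    ∃ a : E.p.Fiber (op N), ∀ i, Nonempty ((fam a).val (hS.edge N i) ≅ A i)

/-- The object of the fibre of `E'` over `B` obtained from an object of the fibre of `E` over `B`
by applying a functor over the base. -/
def onFiber {E E' : BasedCategory.{v', u'} S.Objᵒᵖ} (F : BasedFunctor E E') {B : S.Objᵒᵖ}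
    (a : E.p.Fiber B) : E'.p.Fiber B :=
  ⟨F.obj a.1, (F.w_obj a.1).trans a.2⟩

/-- For `Φ : Y ⟶ X`, the structure on a functor `F` over `Δ_Sᵒᵖ`, from a Hall category of `X` to a
Hall category of `Y`, of being the functor given on families and their morphisms by pull-back along
`Φ`. -/
structure HallFunctor {hS : S.IsAdmissible} {E E' : BasedCategory.{v', u'} S.Objᵒᵖ}
    (K : V.HallCategory X hS E) (K' : V.HallCategory Y hS E') (Φ : Y ⟶ X)
    (F : BasedFunctor E E') where
  iso : ∀ {N : S.Obj} (a : E.p.Fiber (op N)) {x y : S.El N} (h : HasInterval N x y),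
    (K'.fam (onFiber F a)).val h ≅ (V.pullAt Φ (ivl h)).obj ((K.fam a).val h)
  mul : ∀ {N : S.Obj} (a : E.p.Fiber (op N)) {x y z : S.El N} (hxy : HasInterval N x y)
    (hyz : HasInterval N y z) (hxz : HasInterval N x z),
    ((K'.fam (onFiber F a)).mul hxy hyz hxz).hom ≫ (iso a hxz).hom =
      (((V.along Y (ivlInc hxy hxz le_rfl hyz.le)).map (iso a hxy).hom ≫
          (V.pullAtSq Φ (ivlInc hxy hxz le_rfl hyz.le)).hom.app ((K.fam a).val hxy)) ⊗ₘ
        ((V.along Y (ivlInc hyz hxz hxy.le le_rfl)).map (iso a hyz).hom ≫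
          (V.pullAtSq Φ (ivlInc hyz hxz hxy.le le_rfl)).hom.app ((K.fam a).val hyz))) ≫
      Functor.LaxMonoidal.μ (V.pullAt Φ (ivl hxz)) _ _ ≫
      (V.pullAt Φ (ivl hxz)).map ((K.fam a).mul hxy hyz hxz).hom
  one : ∀ {N : S.Obj} (a : E.p.Fiber (op N)) {x : S.El N} (h : HasInterval N x x),
    ((K'.fam (onFiber F a)).one h).hom ≫ (iso a h).hom =
      Functor.LaxMonoidal.ε (V.pullAt Φ (ivl h)) ≫ (V.pullAt Φ (ivl h)).map ((K.fam a).one h).hom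
  hom : ∀ {M N : S.Obj} (f : M ⟶ N) {a : E.p.Fiber (op N)} {b : E.p.Fiber (op M)}
    (φ : a.1 ⟶ b.1) (hφ : E.p.IsHomLift f.op φ) (hφ' : E'.p.IsHomLift f.op (F.map φ))
    {x y : S.El M} (h : HasInterval M x y),
    (K'.hom f (a := onFiber F a) (b := onFiber F b) (F.map φ) hφ').app h ≫
        (V.along Y (ivlMap f h (hS.map f h) le_rfl le_rfl)).map (iso b h).hom ≫
        (V.pullAtSq Φ (ivlMap f h (hS.map f h) le_rfl le_rfl)).hom.app ((K.fam b).val h) =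
      (iso a (hS.map f h)).hom ≫ (V.pullAt Φ (ivl (hS.map f h))).map ((K.hom f φ hφ).app h)

end MonoidalPrederivator

end Hall

open Hall

/-!
The Hall category of a 2-Segal functor `X` is constructed from multiplicative families: objects
`A_[x, y]` of `V (X_[x, y])` for all intervals of `N`, with associative and unital isomorphisms
`A_[x, y] ⊗ A_[y, z] ≅ A_[x, z]`.  Splitting off the last edge of an interval again and again shows
that such families and their morphisms are governed by the edges: any objects on the edges extend to
a family (`Fam.ofEdges`, the iterated tensor products), and any morphisms on the edges extend
uniquely to a morphism of families (`Fam.Hom.exists_of_edges`, `Fam.Hom.ext_edges`).  This holds for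
every system of groupoids contravariant in intervals.  In particular, morphisms over `f : M ⟶ N`,
which are morphisms of families over the system `[x, y] ↦ X_[f x, f y]`, are given by their
components on the edges of `M`.

The op-fibration property rests on one statement: if the components on the edges of a morphism over
`f` are left Kan extensions, then so are the components on all intervals.  For
`[x, z] = [x, y] ∪ [y, z]`, the external product of the components on `[x, y]` and on `[y, z]` is a
left Kan extension along `X_[f x, f y] × X_[f y, f z] ⥤ X_[x, y] × X_[y, z]` because `V` is
componentwise cocontinuous (`ext_isLeftKan`).  The component on `[x, z]` is its base change along

    X_[f x, f z] ⥤ X_[f x, f y] × X_[f y, f z]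
         |                     |
      X_[x, z]   ⥤    X_[x, y] × X_[y, z]

(`Fam.Hom.isLeftKan_mul`), and this square is 2-Cartesian because `X` is 2-Segal: all corners of
the squares of the 2-Segal condition for `[x, z]`, for `[x, y]` and for `[y, z]` are indexed by the
same edges, so that the first square is the pasting of the other two with the square in question
(`IsCartFam.of_sigma`, `isCartSq_sysHom`).  A morphism all of whose components are left Kan extensions
is co-Cartesian, since morphisms out of its target may be determined on edges, and the components of
the given morphism on the images of edges are left Kan extensions
(`isStronglyCocartesian_of_isLeftKan`).  Hence co-Cartesian lifts are obtained by choosing left Kan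
extensions on the edges (`isOpfibration_hall`).

Over an inclusion of an interval the restriction functors `X_[j x, j y] ⥤ X_[x, y]` are
equivalences, and the co-Cartesian morphisms are those with invertible components on the edges
(`isStronglyCocartesian_of_isIso`, `isIso_of_isStronglyCocartesian`).  As families are given on
edges, this implies the 1-Segal condition (`hallSegal`); and as this description is stable under
pull-back along `Φ : Y ⟶ X`, pulling back families is a lax morphism
(`isStronglyCocartesian_hallMap`).

Pull-back of families is only pseudo-functorial in `Φ`, whereas the statement asks for a functor.
Therefore an object of the Hall category of `X` is a formal pull-back: a family for some functor `Z`
together with a transformation `X ⟶ Z` (`HallObj`).  Pulling back along `Φ` is then composition with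
`Φ`, which is strictly functorial (`hallMap_id`, `hallMap_comp`), and the formal pull-backs are
isomorphic to the actual ones, so that the category obtained is the Hall category up to equivalence.
-/

namespace Hall

/-! ### Coherence of pull-backs -/

namespace MonoidalPrederivator

variable (V : MonoidalPrederivator.{u, v, w})

section Coherence

variable {A B C D : Grpd.{u, u}}

/-- The structure isomorphism `H^* Z ≅ F^* G^* Z` of the pseudofunctor `V`, for a strictly
commutative triangle `F ⋙ G = H`.  Leaving `H` free avoids transport along equalities of
functors. -/
def cmp {F : A ⥤ B} {G : B ⥤ C} {H : A ⥤ C} (e : F ⋙ G = H) (Z : V.obj C) :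
    (V.pull H).obj Z ≅ (V.pull F).obj ((V.pull G).obj Z) :=
  (eqToIso (by rw [← e]) ≪≫ V.pullComp F G).app Z

/-- The structure isomorphism `F^* Z ≅ Z` for a functor `F` equal to the identity. -/
def cid {F : A ⥤ A} (e : F = 𝟭 A) (Z : V.obj A) : (V.pull F).obj Z ≅ Z :=
  (eqToIso (by rw [e]) ≪≫ V.pullId A).app Z

/-- The structure isomorphism `F^* G^* Z ≅ F'^* G'^* Z` for a strictly commutative square. -/
def csq {B' : Grpd.{u, u}} {F : A ⥤ B} {G : B ⥤ C} {F' : A ⥤ B'} {G' : B' ⥤ C}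
    (e : F ⋙ G = F' ⋙ G') (Z : V.obj C) :
    (V.pull F).obj ((V.pull G).obj Z) ≅ (V.pull F').obj ((V.pull G').obj Z) :=
  (V.cmp rfl Z).symm ≪≫ V.cmp e.symm Z

theorem cmp_rfl_hom (F : A ⥤ B) (G : B ⥤ C) (Z : V.obj C) :
    (V.cmp (rfl : F ⋙ G = F ⋙ G) Z).hom = (V.pullComp F G).hom.app Z := by
  simp [cmp]

theorem cmp_rfl_inv (F : A ⥤ B) (G : B ⥤ C) (Z : V.obj C) :
    (V.cmp (rfl : F ⋙ G = F ⋙ G) Z).inv = (V.pullComp F G).inv.app Z := by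
  simp [cmp]

theorem cid_rfl_hom (Z : V.obj A) : (V.cid (rfl : 𝟭 A = 𝟭 A) Z).hom = (V.pullId A).hom.app Z := by
  simp [cid]

theorem cmp_nat {F : A ⥤ B} {G : B ⥤ C} {H : A ⥤ C} (e : F ⋙ G = H) {Z W : V.obj C}
    (φ : Z ⟶ W) : (V.pull H).map φ ≫ (V.cmp e W).hom =
      (V.cmp e Z).hom ≫ (V.pull F).map ((V.pull G).map φ) :=
  (eqToIso (by rw [← e]) ≪≫ V.pullComp F G : V.pull H ≅ _).hom.naturality φ

theorem cmp_inv_nat {F : A ⥤ B} {G : B ⥤ C} {H : A ⥤ C} (e : F ⋙ G = H) {Z W : V.obj C}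
    (φ : Z ⟶ W) : (V.pull F).map ((V.pull G).map φ) ≫ (V.cmp e W).inv =
      (V.cmp e Z).inv ≫ (V.pull H).map φ :=
  (eqToIso (by rw [← e]) ≪≫ V.pullComp F G : V.pull H ≅ _).inv.naturality φ

theorem cid_nat {F : A ⥤ A} (e : F = 𝟭 A) {Z W : V.obj A} (φ : Z ⟶ W) :
    (V.pull F).map φ ≫ (V.cid e W).hom = (V.cid e Z).hom ≫ φ :=
  (eqToIso (by rw [e]) ≪≫ V.pullId A : V.pull F ≅ _).hom.naturality φ

theorem cid_inv_nat {F : A ⥤ A} (e : F = 𝟭 A) {Z W : V.obj A} (φ : Z ⟶ W) :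
    φ ≫ (V.cid e W).inv = (V.cid e Z).inv ≫ (V.pull F).map φ :=
  (eqToIso (by rw [e]) ≪≫ V.pullId A : V.pull F ≅ _).inv.naturality φ

/-- Coherence for a composite of three functors. -/
theorem cmp_assoc {F : A ⥤ B} {G : B ⥤ C} {K : C ⥤ D} {FG : A ⥤ C} {GK : B ⥤ D} {L : A ⥤ D}
    (e₁ : F ⋙ G = FG) (e₂ : FG ⋙ K = L) (e₃ : G ⋙ K = GK) (e₄ : F ⋙ GK = L) (Z : V.obj D) :
    (V.cmp e₂ Z).hom ≫ (V.cmp e₁ ((V.pull K).obj Z)).hom =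
      (V.cmp e₄ Z).hom ≫ (V.pull F).map (V.cmp e₃ Z).hom := by
  subst e₁ e₂ e₃
  rw [cmp_rfl_hom, cmp_rfl_hom, cmp_rfl_hom, cmp_rfl_hom]
  exact V.pullComp_assoc F G K Z

theorem cmp_assoc_inv {F : A ⥤ B} {G : B ⥤ C} {K : C ⥤ D} {FG : A ⥤ C} {GK : B ⥤ D} {L : A ⥤ D}
    (e₁ : F ⋙ G = FG) (e₂ : FG ⋙ K = L) (e₃ : G ⋙ K = GK) (e₄ : F ⋙ GK = L) (Z : V.obj D) :
    (V.cmp e₁ ((V.pull K).obj Z)).inv ≫ (V.cmp e₂ Z).inv =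
      (V.pull F).map (V.cmp e₃ Z).inv ≫ (V.cmp e₄ Z).inv := by
  have := congrArg (fun i : (V.pull L).obj Z ≅ _ => i.inv)
    (Iso.ext (V.cmp_assoc e₁ e₂ e₃ e₄ Z) : V.cmp e₂ Z ≪≫ V.cmp e₁ ((V.pull K).obj Z) =
      V.cmp e₄ Z ≪≫ (V.pull F).mapIso (V.cmp e₃ Z))
  simpa using this

theorem cmp_cid_left {F : A ⥤ A} {G : A ⥤ B} (h : F = 𝟭 A) (e : F ⋙ G = G) (Z : V.obj B) :
    (V.cmp e Z).hom ≫ (V.cid h ((V.pull G).obj Z)).hom = 𝟙 _ := by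
  subst h
  rw [cid_rfl_hom]
  exact (congrArg (· ≫ _) (V.cmp_rfl_hom (𝟭 A) G Z)).trans (V.pullComp_id_left G Z)

theorem cmp_cid_right {F : A ⥤ B} {G : B ⥤ B} (h : G = 𝟭 B) (e : F ⋙ G = F) (Z : V.obj B) :
    (V.cmp e Z).hom ≫ (V.pull F).map (V.cid h Z).hom = 𝟙 _ := by
  subst h
  rw [cid_rfl_hom]
  exact (congrArg (· ≫ _) (V.cmp_rfl_hom F (𝟭 B) Z)).trans (V.pullComp_id_right F Z)

theorem cmp_inv_left {F : A ⥤ A} {G : A ⥤ B} (h : F = 𝟭 A) (e : F ⋙ G = G) (Z : V.obj B) :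
    (V.cmp e Z).inv = (V.cid h ((V.pull G).obj Z)).hom := by
  rw [← cancel_epi (V.cmp e Z).hom, cmp_cid_left V h e, Iso.hom_inv_id]

theorem cmp_inv_right {F : A ⥤ B} {G : B ⥤ B} (h : G = 𝟭 B) (e : F ⋙ G = F) (Z : V.obj B) :
    (V.cmp e Z).inv = (V.pull F).map (V.cid h Z).hom := by
  rw [← cancel_epi (V.cmp e Z).hom, cmp_cid_right V h e, Iso.hom_inv_id]

theorem cmp_tensor {F : A ⥤ B} {G : B ⥤ C} {H : A ⥤ C} (e : F ⋙ G = H) (Z W : V.obj C) :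
    Functor.LaxMonoidal.μ (V.pull H) Z W ≫ (V.cmp e (Z ⊗ W)).hom =
      ((V.cmp e Z).hom ⊗ₘ (V.cmp e W).hom) ≫ Functor.LaxMonoidal.μ (V.pull F) _ _ ≫
        (V.pull F).map (Functor.LaxMonoidal.μ (V.pull G) Z W) := by
  subst e
  have := V.pullComp_monoidal F G
  rw [cmp_rfl_hom, cmp_rfl_hom, cmp_rfl_hom]
  simp

theorem cmp_unit {F : A ⥤ B} {G : B ⥤ C} {H : A ⥤ C} (e : F ⋙ G = H) :
    Functor.LaxMonoidal.ε (V.pull H) ≫ (V.cmp e (𝟙_ _)).hom =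
      Functor.LaxMonoidal.ε (V.pull F) ≫ (V.pull F).map (Functor.LaxMonoidal.ε (V.pull G)) := by
  subst e
  have := V.pullComp_monoidal F G
  rw [cmp_rfl_hom]
  simp

theorem cid_tensor {F : A ⥤ A} (h : F = 𝟭 A) (Z W : V.obj A) :
    Functor.LaxMonoidal.μ (V.pull F) Z W ≫ (V.cid h (Z ⊗ W)).hom =
      ((V.cid h Z).hom ⊗ₘ (V.cid h W).hom) := by
  subst h
  have := V.pullId_monoidal A
  rw [cid_rfl_hom, cid_rfl_hom, cid_rfl_hom]
  simp

theorem cid_unit {F : A ⥤ A} (h : F = 𝟭 A) :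
    Functor.LaxMonoidal.ε (V.pull F) ≫ (V.cid h (𝟙_ _)).hom = 𝟙 _ := by
  subst h
  have := V.pullId_monoidal A
  rw [cid_rfl_hom]
  simp

theorem cmp_csq {B' : Grpd.{u, u}} {F : A ⥤ B} {G : B ⥤ C} {F' : A ⥤ B'} {G' : B' ⥤ C}
    (e : F ⋙ G = F' ⋙ G') {H : A ⥤ C} (e₁ : F ⋙ G = H) (e₂ : F' ⋙ G' = H) (Z : V.obj C) :
    (V.cmp e₁ Z).hom ≫ (V.csq e Z).hom = (V.cmp e₂ Z).hom := by
  subst e₁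
  simp [csq]

theorem csq_eq {B' : Grpd.{u, u}} {F : A ⥤ B} {G : B ⥤ C} {F' : A ⥤ B'} {G' : B' ⥤ C}
    (e : F ⋙ G = F' ⋙ G') {H : A ⥤ C} (e₁ : F ⋙ G = H) (e₂ : F' ⋙ G' = H) (Z : V.obj C) :
    (V.csq e Z).hom = (V.cmp e₁ Z).inv ≫ (V.cmp e₂ Z).hom := by
  rw [Iso.eq_inv_comp, cmp_csq]

theorem csq_nat {B' : Grpd.{u, u}} {F : A ⥤ B} {G : B ⥤ C} {F' : A ⥤ B'} {G' : B' ⥤ C}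
    (e : F ⋙ G = F' ⋙ G') {Z W : V.obj C} (φ : Z ⟶ W) :
    (V.pull F).map ((V.pull G).map φ) ≫ (V.csq e W).hom =
      (V.csq e Z).hom ≫ (V.pull F').map ((V.pull G').map φ) := by
  simp only [csq, Iso.trans_hom, Iso.symm_hom, Category.assoc]
  rw [← cmp_nat, reassoc_of% V.cmp_inv_nat]

end Coherence
end MonoidalPrederivator

/-! ### Multiplicative families over interval systems -/

/-- A system of groupoids indexed by intervals `[x, y]` (those satisfying `P`), contravariant with
respect to inclusions of intervals: `r` is the restriction functor from `[x', y']` to a subinterval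
`[x, y]`.  Functoriality is strict, as it is for the values of a functor on the intervals. -/
structure IvlSys {I : Type} [Preorder I] (P : I → I → Prop) where
  D : ∀ {x y : I}, P x y → Grpd.{u, u}
  le : ∀ {x y : I}, P x y → x ≤ y
  r : ∀ {x y x' y' : I} (h : P x y) (h' : P x' y'), x' ≤ x → y ≤ y' → (D h' ⥤ D h)
  r_self : ∀ {x y : I} (h : P x y), r h h le_rfl le_rfl = 𝟭 _
  r_comp : ∀ {x y x' y' x'' y'' : I} (h : P x y) (h' : P x' y') (h'' : P x'' y'') (hx : x' ≤ x)
    (hy : y ≤ y') (hx' : x'' ≤ x') (hy' : y' ≤ y''),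
    r h' h'' hx' hy' ⋙ r h h' hx hy = r h h'' (hx'.trans hx) (hy.trans hy')

variable {I : Type} [Preorder I] {P : I → I → Prop}

/-- A strict transformation between interval systems. -/
structure IvlSys.Hom (D' D : IvlSys.{u} P) where
  F : ∀ {x y : I} (h : P x y), D'.D h ⥤ D.D h
  nat : ∀ {x y x' y' : I} (h : P x y) (h' : P x' y') (hx : x' ≤ x) (hy : y ≤ y'),
    D'.r h h' hx hy ⋙ F h = F h' ⋙ D.r h h' hx hy

namespace MonoidalPrederivator

open Functor.LaxMonoidal (μ ε)

variable (V : MonoidalPrederivator.{u, v, w})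

/-- A multiplicative family over an interval system: the notion of `MulFamily` for an arbitrary
system of groupoids in place of the system `[x, y] ↦ X_[x, y]`.  The generality is needed because a
morphism of families over `f : M ⟶ N` is a morphism of families over the system
`[x, y] ↦ X_[f x, f y]`, and composition involves pull-backs between several such systems. -/
structure Fam (D : IvlSys.{u} P) where
  val : ∀ {x y : I} (h : P x y), V.obj (D.D h)
  mul : ∀ {x y z : I} (hxy : P x y) (hyz : P y z) (hxz : P x z),
    (V.pull (D.r hxy hxz le_rfl (D.le hyz))).obj (val hxy) ⊗
      (V.pull (D.r hyz hxz (D.le hxy) le_rfl)).obj (val hyz) ≅ val hxz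
  one : ∀ {x : I} (h : P x x), 𝟙_ (V.obj (D.D h)) ≅ val h
  assoc : ∀ {x y z t : I} (hxy : P x y) (hyz : P y z) (hzt : P z t) (hxz : P x z) (hyt : P y t)
    (hxt : P x t),
    ((((V.cmp (D.r_comp hxy hxz hxt le_rfl (D.le hyz) le_rfl (D.le hzt)) (val hxy)).hom ⊗ₘ
          (V.cmp (D.r_comp hyz hxz hxt (D.le hxy) le_rfl le_rfl (D.le hzt)) (val hyz)).hom) ≫
        μ (V.pull (D.r hxz hxt le_rfl (D.le hzt))) _ _ ≫
        (V.pull (D.r hxz hxt le_rfl (D.le hzt))).map (mul hxy hyz hxz).hom) ▷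
          (V.pull (D.r hzt hxt (D.le hxz) le_rfl)).obj (val hzt)) ≫
        (mul hxz hzt hxt).hom =
      (α_ _ _ _).hom ≫
      ((V.pull (D.r hxy hxt le_rfl (D.le hyt))).obj (val hxy) ◁
        (((V.cmp (D.r_comp hyz hyt hxt le_rfl (D.le hzt) (D.le hxy) le_rfl) (val hyz)).hom ⊗ₘ
          (V.cmp (D.r_comp hzt hyt hxt (D.le hyz) le_rfl (D.le hxy) le_rfl) (val hzt)).hom) ≫
        μ (V.pull (D.r hyt hxt (D.le hxy) le_rfl)) _ _ ≫
        (V.pull (D.r hyt hxt (D.le hxy) le_rfl)).map (mul hyz hzt hyt).hom)) ≫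
        (mul hxy hyt hxt).hom
  one_mul : ∀ {x y : I} (hx : P x x) (hxy : P x y),
    ((ε (V.pull (D.r hx hxy le_rfl (D.le hxy))) ≫
        (V.pull (D.r hx hxy le_rfl (D.le hxy))).map (one hx).hom) ▷
          (V.pull (D.r hxy hxy le_rfl le_rfl)).obj (val hxy)) ≫ (mul hx hxy hxy).hom =
      (λ_ _).hom ≫ (V.cid (D.r_self hxy) (val hxy)).hom
  mul_one : ∀ {x y : I} (hxy : P x y) (hy : P y y),
    ((V.pull (D.r hxy hxy le_rfl le_rfl)).obj (val hxy) ◁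
        (ε (V.pull (D.r hy hxy (D.le hxy) le_rfl)) ≫
          (V.pull (D.r hy hxy (D.le hxy) le_rfl)).map (one hy).hom)) ≫ (mul hxy hy hxy).hom =
      (ρ_ _).hom ≫ (V.cid (D.r_self hxy) (val hxy)).hom

/-- A lax monoidal functor preserves associativity constraints of the form arising in `Fam`. -/
theorem map_assoc {C E : Type*} [Category* C] [Category* E] [MonoidalCategory C]
    [MonoidalCategory E] (G : C ⥤ E) [G.LaxMonoidal] {X Y Z XY YZ W : C} {X' Y' Z' : E}
    (a : X ⊗ Y ⟶ XY) (b : Y ⊗ Z ⟶ YZ) (m : XY ⊗ Z ⟶ W) (m' : X ⊗ YZ ⟶ W)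
    (p : X' ⟶ G.obj X) (q : Y' ⟶ G.obj Y) (r : Z' ⟶ G.obj Z)
    (h : (a ▷ Z) ≫ m = (α_ _ _ _).hom ≫ (X ◁ b) ≫ m') :
    (((p ⊗ₘ q) ≫ μ G _ _ ≫ G.map a) ⊗ₘ r) ≫ μ G _ _ ≫ G.map m =
      (α_ _ _ _).hom ≫ (p ⊗ₘ ((q ⊗ₘ r) ≫ μ G _ _ ≫ G.map b)) ≫ μ G _ _ ≫ G.map m' := by
  have e₁ : (((p ⊗ₘ q) ≫ μ G X Y ≫ G.map a) ⊗ₘ r) =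
      ((p ⊗ₘ q) ⊗ₘ r) ≫ (μ G X Y ▷ _) ≫ (G.map a ▷ _) := by
    simp only [← tensorHom_id, tensorHom_comp_tensorHom, Category.comp_id]
  have e₂ : (p ⊗ₘ ((q ⊗ₘ r) ≫ μ G Y Z ≫ G.map b)) =
      (p ⊗ₘ (q ⊗ₘ r)) ≫ (_ ◁ μ G Y Z) ≫ (_ ◁ G.map b) := by
    simp only [← id_tensorHom, tensorHom_comp_tensorHom, Category.comp_id]
  rw [e₁, e₂]
  simp only [Category.assoc]
  rw [Functor.LaxMonoidal.μ_natural_left_assoc, Functor.LaxMonoidal.μ_natural_right_assoc,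
    ← G.map_comp, h, G.map_comp, Functor.LaxMonoidal.associativity_assoc, G.map_comp,
    associator_naturality_assoc]

namespace Fam

variable {V} {D D' : IvlSys.{u} P} {A A' : Grpd.{u, u}}

section Flat

variable (B : V.Fam D)

/-- The multiplication of a family, pulled back to a groupoid `A` over `D_[x, z]`; the pull-backs of
the two factors are expressed by functors `K₁`, `K₂` which are only propositionally equal to the
composites. -/
def m {x y z : I} (hxy : P x y) (hyz : P y z) (hxz : P x z) {F : A ⥤ D.D hxz} {K₁ : A ⥤ D.D hxy}
    {K₂ : A ⥤ D.D hyz} (e₁ : F ⋙ D.r hxy hxz le_rfl (D.le hyz) = K₁)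
    (e₂ : F ⋙ D.r hyz hxz (D.le hxy) le_rfl = K₂) :
    (V.pull K₁).obj (B.val hxy) ⊗ (V.pull K₂).obj (B.val hyz) ⟶ (V.pull F).obj (B.val hxz) :=
  ((V.cmp e₁ _).hom ⊗ₘ (V.cmp e₂ _).hom) ≫ μ (V.pull F) _ _ ≫ (V.pull F).map (B.mul hxy hyz hxz).hom

/-- The unit of a family, pulled back along `F`. -/
def e {x : I} (h : P x x) (F : A ⥤ D.D h) : 𝟙_ _ ⟶ (V.pull F).obj (B.val h) :=
  ε (V.pull F) ≫ (V.pull F).map (B.one h).hom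

/-- Pulling back a pulled back multiplication gives the multiplication pulled back along the
composite. -/
theorem m_pull {x y z : I} (hxy : P x y) (hyz : P y z) (hxz : P x z) {F : A ⥤ D.D hxz}
    {K₁ : A ⥤ D.D hxy} {K₂ : A ⥤ D.D hyz} (e₁ : F ⋙ D.r hxy hxz le_rfl (D.le hyz) = K₁)
    (e₂ : F ⋙ D.r hyz hxz (D.le hxy) le_rfl = K₂) {Q : A' ⥤ A} {F' : A' ⥤ D.D hxz}
    {K₁' : A' ⥤ D.D hxy} {K₂' : A' ⥤ D.D hyz} (f : Q ⋙ F = F') (k₁ : Q ⋙ K₁ = K₁')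
    (k₂ : Q ⋙ K₂ = K₂') (e₁' : F' ⋙ D.r hxy hxz le_rfl (D.le hyz) = K₁')
    (e₂' : F' ⋙ D.r hyz hxz (D.le hxy) le_rfl = K₂') :
    ((V.cmp k₁ _).hom ⊗ₘ (V.cmp k₂ _).hom) ≫ μ (V.pull Q) _ _ ≫
        (V.pull Q).map (B.m hxy hyz hxz e₁ e₂) =
      B.m hxy hyz hxz e₁' e₂' ≫ (V.cmp f _).hom := by
  simp only [m, Functor.map_comp, Category.assoc]
  rw [← Functor.LaxMonoidal.μ_natural_assoc, V.cmp_nat f, reassoc_of% V.cmp_tensor f,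
    tensorHom_comp_tensorHom_assoc, tensorHom_comp_tensorHom_assoc,
    V.cmp_assoc f e₁' e₁ k₁, V.cmp_assoc f e₂' e₂ k₂]

theorem e_pull {x : I} (h : P x x) {F : A ⥤ D.D h} {Q : A' ⥤ A} {F' : A' ⥤ D.D h}
    (f : Q ⋙ F = F') :
    ε (V.pull Q) ≫ (V.pull Q).map (B.e h F) = B.e h F' ≫ (V.cmp f _).hom := by
  simp only [e, Functor.map_comp, Category.assoc]
  rw [V.cmp_nat f, reassoc_of% V.cmp_unit f]

/-- Associativity of the multiplication of a family, pulled back to a groupoid over `D_[x, t]`. -/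
theorem m_assoc {x y z t : I} (hxy : P x y) (hyz : P y z) (hzt : P z t) (hxz : P x z) (hyt : P y t)
    (hxt : P x t) {G : A ⥤ D.D hxt} {Kxy : A ⥤ D.D hxy} {Kyz : A ⥤ D.D hyz} {Kzt : A ⥤ D.D hzt}
    {Kxz : A ⥤ D.D hxz} {Kyt : A ⥤ D.D hyt}
    (e₁ : G ⋙ D.r hxz hxt le_rfl (D.le hzt) = Kxz)
    (e₂ : G ⋙ D.r hzt hxt (D.le hxz) le_rfl = Kzt)
    (e₃ : G ⋙ D.r hxy hxt le_rfl (D.le hyt) = Kxy)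
    (e₄ : G ⋙ D.r hyt hxt (D.le hxy) le_rfl = Kyt)
    (e₅ : Kxz ⋙ D.r hxy hxz le_rfl (D.le hyz) = Kxy)
    (e₆ : Kxz ⋙ D.r hyz hxz (D.le hxy) le_rfl = Kyz)
    (e₇ : Kyt ⋙ D.r hyz hyt le_rfl (D.le hzt) = Kyz)
    (e₈ : Kyt ⋙ D.r hzt hyt (D.le hyz) le_rfl = Kzt) :
    (B.m hxy hyz hxz e₅ e₆ ▷ _) ≫ B.m hxz hzt hxt e₁ e₂ =
      (α_ _ _ _).hom ≫ (_ ◁ B.m hyz hzt hyt e₇ e₈) ≫ B.m hxy hyt hxt e₃ e₄ := by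
  have key := B.assoc hxy hyz hzt hxz hyt hxt
  have e₉ : G ⋙ D.r hyz hxt (D.le hxy) (D.le hzt) = Kyz := by
    rw [← e₆, ← e₁, Functor.assoc, D.r_comp]
  have h₁ := B.m_pull hxy hyz hxz (D.r_comp hxy hxz hxt le_rfl (D.le hyz) le_rfl (D.le hzt))
    (D.r_comp hyz hxz hxt (D.le hxy) le_rfl le_rfl (D.le hzt)) e₁ e₃ e₉ e₅ e₆
  have h₂ := B.m_pull hyz hzt hyt (D.r_comp hyz hyt hxt le_rfl (D.le hzt) (D.le hxy) le_rfl)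
    (D.r_comp hzt hyt hxt (D.le hyz) le_rfl (D.le hxy) le_rfl) e₄ e₉ e₂ e₇ e₈
  have l : B.m hxz hzt hxt e₁ e₂ = ((V.cmp e₁ _).hom ⊗ₘ (V.cmp e₂ _).hom) ≫ μ (V.pull G) _ _ ≫
    (V.pull G).map (B.mul hxz hzt hxt).hom := rfl
  have l' : B.m hxy hyt hxt e₃ e₄ = ((V.cmp e₃ _).hom ⊗ₘ (V.cmp e₄ _).hom) ≫ μ (V.pull G) _ _ ≫
    (V.pull G).map (B.mul hxy hyt hxt).hom := rfl
  rw [l, l', whiskerRight_comp_tensorHom_assoc, ← h₁, whiskerLeft_comp_tensorHom_assoc, ← h₂]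
  have key' : (B.m hxy hyz hxz (D.r_comp hxy hxz hxt le_rfl (D.le hyz) le_rfl (D.le hzt))
      (D.r_comp hyz hxz hxt (D.le hxy) le_rfl le_rfl (D.le hzt)) ▷ _) ≫ (B.mul hxz hzt hxt).hom =
      (α_ _ _ _).hom ≫ (_ ◁ B.m hyz hzt hyt
        (D.r_comp hyz hyt hxt le_rfl (D.le hzt) (D.le hxy) le_rfl)
        (D.r_comp hzt hyt hxt (D.le hyz) le_rfl (D.le hxy) le_rfl)) ≫ (B.mul hxy hyt hxt).hom := key
  exact map_assoc (V.pull G) _ _ _ _ _ _ _ key'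

/-- The left unit law of a family, pulled back to a groupoid over `D_[x, y]`. -/
theorem e_m {x y : I} (hx : P x x) (hxy : P x y) {G : A ⥤ D.D hxy} {K : A ⥤ D.D hx}
    (e₁ : G ⋙ D.r hx hxy le_rfl (D.le hxy) = K) (e₂ : G ⋙ D.r hxy hxy le_rfl le_rfl = G) :
    (B.e hx K ▷ _) ≫ B.m hx hxy hxy e₁ e₂ = (λ_ _).hom := by
  have key : (B.e hx (D.r hx hxy le_rfl (D.le hxy)) ▷ _) ≫ (B.mul hx hxy hxy).hom =
      (λ_ _).hom ≫ (V.cid (D.r_self hxy) (B.val hxy)).hom := B.one_mul hx hxy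
  rw [m, whiskerRight_comp_tensorHom_assoc, ← B.e_pull hx e₁]
  have h : ((ε (V.pull G) ≫ (V.pull G).map (B.e hx (D.r hx hxy le_rfl (D.le hxy)))) ⊗ₘ
      (V.cmp e₂ (B.val hxy)).hom) = (_ ◁ (V.cmp e₂ (B.val hxy)).hom) ≫ (ε (V.pull G) ▷ _) ≫
        ((V.pull G).map (B.e hx (D.r hx hxy le_rfl (D.le hxy))) ▷ _) := by
    simp only [← tensorHom_id, ← id_tensorHom, tensorHom_comp_tensorHom, Category.comp_id,
      Category.id_comp]
  rw [h]
  simp only [Category.assoc]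
  rw [Functor.LaxMonoidal.μ_natural_left_assoc, ← (V.pull G).map_comp, key, (V.pull G).map_comp,
    ← Functor.LaxMonoidal.left_unitality_assoc, leftUnitor_naturality_assoc,
    V.cmp_cid_right (D.r_self hxy) e₂]
  exact Category.comp_id _

/-- The right unit law of a family, pulled back to a groupoid over `D_[x, y]`. -/
theorem m_e {x y : I} (hxy : P x y) (hy : P y y) {G : A ⥤ D.D hxy} {K : A ⥤ D.D hy}
    (e₁ : G ⋙ D.r hxy hxy le_rfl le_rfl = G) (e₂ : G ⋙ D.r hy hxy (D.le hxy) le_rfl = K) :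
    (_ ◁ B.e hy K) ≫ B.m hxy hy hxy e₁ e₂ = (ρ_ _).hom := by
  have key : (_ ◁ B.e hy (D.r hy hxy (D.le hxy) le_rfl)) ≫ (B.mul hxy hy hxy).hom =
      (ρ_ _).hom ≫ (V.cid (D.r_self hxy) (B.val hxy)).hom := B.mul_one hxy hy
  rw [m, whiskerLeft_comp_tensorHom_assoc, ← B.e_pull hy e₂]
  have h : ((V.cmp e₁ (B.val hxy)).hom ⊗ₘ
      (ε (V.pull G) ≫ (V.pull G).map (B.e hy (D.r hy hxy (D.le hxy) le_rfl)))) =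
      ((V.cmp e₁ (B.val hxy)).hom ▷ _) ≫ (_ ◁ ε (V.pull G)) ≫
        (_ ◁ (V.pull G).map (B.e hy (D.r hy hxy (D.le hxy) le_rfl))) := by
    simp only [← tensorHom_id, ← id_tensorHom, tensorHom_comp_tensorHom, Category.comp_id,
      Category.id_comp]
  rw [h]
  simp only [Category.assoc]
  rw [Functor.LaxMonoidal.μ_natural_right_assoc, ← (V.pull G).map_comp, key, (V.pull G).map_comp,
    ← Functor.LaxMonoidal.right_unitality_assoc, rightUnitor_naturality_assoc,
    V.cmp_cid_right (D.r_self hxy) e₁]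
  exact Category.comp_id _

end Flat

variable (T : IvlSys.Hom D' D) (B : V.Fam D)

/-- The multiplication of the pulled back family `T^* B`. -/
def pullMul {x y z : I} (hxy : P x y) (hyz : P y z) (hxz : P x z) :
    (V.pull (D'.r hxy hxz le_rfl (D'.le hyz))).obj ((V.pull (T.F hxy)).obj (B.val hxy)) ⊗
      (V.pull (D'.r hyz hxz (D'.le hxy) le_rfl)).obj ((V.pull (T.F hyz)).obj (B.val hyz)) ≅
      (V.pull (T.F hxz)).obj (B.val hxz) :=
  (V.csq (T.nat hxy hxz le_rfl (D.le hyz)) (B.val hxy) ⊗ᵢ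
    V.csq (T.nat hyz hxz (D.le hxy) le_rfl) (B.val hyz)) ≪≫
    Functor.Monoidal.μIso (V.pull (T.F hxz)) _ _ ≪≫
    (V.pull (T.F hxz)).mapIso (B.mul hxy hyz hxz)

/-- The unit of the pulled back family `T^* B`. -/
def pullOne {x : I} (h : P x x) : 𝟙_ (V.obj (D'.D h)) ≅ (V.pull (T.F h)).obj (B.val h) :=
  Functor.Monoidal.εIso (V.pull (T.F h)) ≪≫ (V.pull (T.F h)).mapIso (B.one h)

theorem pullMul_hom {x y z : I} (hxy : P x y) (hyz : P y z) (hxz : P x z)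
    {K₁ : D'.D hxz ⥤ D.D hxy} {K₂ : D'.D hxz ⥤ D.D hyz}
    (k₁ : D'.r hxy hxz le_rfl (D.le hyz) ⋙ T.F hxy = K₁)
    (k₂ : D'.r hyz hxz (D.le hxy) le_rfl ⋙ T.F hyz = K₂) :
    (pullMul T B hxy hyz hxz).hom = ((V.cmp k₁ _).inv ⊗ₘ (V.cmp k₂ _).inv) ≫
      B.m hxy hyz hxz (F := T.F hxz) ((T.nat _ _ _ _).symm.trans k₁)
        ((T.nat _ _ _ _).symm.trans k₂) := by
  simp only [pullMul, m, Iso.trans_hom, tensorIso_hom, Functor.Monoidal.μIso_hom,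
    Functor.mapIso_hom, tensorHom_comp_tensorHom_assoc]
  rw [V.csq_eq _ k₁, V.csq_eq _ k₂]

/-- The multiplication of `T^* B` pulled back along a functor `F` is that of `B` pulled back along
`F ⋙ T`. -/
theorem pullMul_flat {x y z : I} (hxy : P x y) (hyz : P y z) (hxz : P x z)
    {F : A ⥤ D'.D hxz} {K₁ : A ⥤ D'.D hxy} {K₂ : A ⥤ D'.D hyz}
    (e₁ : F ⋙ D'.r hxy hxz le_rfl (D'.le hyz) = K₁)
    (e₂ : F ⋙ D'.r hyz hxz (D'.le hxy) le_rfl = K₂)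
    {F' : A ⥤ D.D hxz} {K₁' : A ⥤ D.D hxy} {K₂' : A ⥤ D.D hyz} (f : F ⋙ T.F hxz = F')
    (k₁ : K₁ ⋙ T.F hxy = K₁') (k₂ : K₂ ⋙ T.F hyz = K₂')
    (e₁' : F' ⋙ D.r hxy hxz le_rfl (D.le hyz) = K₁')
    (e₂' : F' ⋙ D.r hyz hxz (D.le hxy) le_rfl = K₂') :
    ((V.cmp e₁ _).hom ⊗ₘ (V.cmp e₂ _).hom) ≫ μ (V.pull F) _ _ ≫
        (V.pull F).map (pullMul T B hxy hyz hxz).hom =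
      ((V.cmp k₁ _).inv ⊗ₘ (V.cmp k₂ _).inv) ≫ B.m hxy hyz hxz e₁' e₂' ≫ (V.cmp f _).hom := by
  have g₁ : F ⋙ D'.r hxy hxz le_rfl (D.le hyz) ⋙ T.F hxy = K₁' := by
    rw [← k₁, ← e₁, Functor.assoc]
  have g₂ : F ⋙ D'.r hyz hxz (D.le hxy) le_rfl ⋙ T.F hyz = K₂' := by
    rw [← k₂, ← e₂, Functor.assoc]
  rw [pullMul_hom T B hxy hyz hxz rfl rfl, Functor.map_comp, ← Functor.LaxMonoidal.μ_natural_assoc,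
    tensorHom_comp_tensorHom_assoc, ← B.m_pull hxy hyz hxz (T.nat _ _ _ _).symm (T.nat _ _ _ _).symm f g₁ g₂ e₁' e₂',
    tensorHom_comp_tensorHom_assoc]
  congr 2
  · rw [Iso.eq_inv_comp, reassoc_of% V.cmp_assoc e₁ k₁ rfl g₁, ← Functor.map_comp]
    simp
  · rw [Iso.eq_inv_comp, reassoc_of% V.cmp_assoc e₂ k₂ rfl g₂, ← Functor.map_comp]
    simp

theorem pullOne_flat {x : I} (h : P x x) {F : A ⥤ D'.D h} {F' : A ⥤ D.D h} (f : F ⋙ T.F h = F') :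
    ε (V.pull F) ≫ (V.pull F).map (pullOne T B h).hom = B.e h F' ≫ (V.cmp f _).hom :=
  B.e_pull h f

/-- The pull-back `T^* B` of a multiplicative family along a transformation of interval systems. -/
abbrev pull : V.Fam D' where
  val h := (V.pull (T.F h)).obj (B.val h)
  mul := pullMul T B
  one := pullOne T B
  assoc {x y z t} hxy hyz hzt hxz hyt hxt := by
    have n : ∀ {a b : I} (h : P a b) (hx : x ≤ a) (hy : b ≤ t),
      T.F hxt ⋙ D.r h hxt hx hy = D'.r h hxt hx hy ⋙ T.F h := fun h hx hy => (T.nat h hxt hx hy).symm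
    have q : ∀ {a b a' b' : I} (h : P a b) (h' : P a' b') (hx : x ≤ a') (hy : b' ≤ t)
        (hx' : a' ≤ a) (hy' : b ≤ b'), (D'.r h' hxt hx hy ⋙ T.F h') ⋙ D.r h h' hx' hy' =
        D'.r h hxt (hx.trans hx') (hy'.trans hy) ⋙ T.F h := fun h h' hx hy hx' hy' => by
      rw [Functor.assoc, ← T.nat, ← Functor.assoc, D'.r_comp]
    rw [pullMul_flat T B hxy hyz hxz _ _ rfl rfl rfl (q _ _ _ _ _ _) (q _ _ _ _ _ _),
      pullMul_flat T B hyz hzt hyt _ _ rfl rfl rfl (q _ _ _ _ _ _) (q _ _ _ _ _ _),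
      pullMul_hom T B hxz hzt hxt rfl rfl, pullMul_hom T B hxy hyt hxt rfl rfl,
      whiskerRight_comp_tensorHom_assoc, whiskerLeft_comp_tensorHom_assoc]
    simp only [Category.assoc, Iso.hom_inv_id, Category.comp_id]
    have a := B.m_assoc hxy hyz hzt hxz hyt hxt (n _ _ _) (n _ _ _) (n _ _ _) (n _ _ _)
      (q _ _ _ _ _ _) (q _ _ _ _ _ _) (q _ _ _ _ _ _) (q _ _ _ _ _ _)
    rw [← tensorHom_comp_whiskerRight_assoc, ← tensorHom_comp_whiskerLeft_assoc, a,
      associator_naturality_assoc]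
  one_mul {x y} hx hxy := by
    have q : (D'.r hxy hxy le_rfl le_rfl ⋙ T.F hxy) = T.F hxy := by
      rw [D'.r_self]; rfl
    rw [pullOne_flat T B hx rfl, pullMul_hom T B hx hxy hxy rfl q, whiskerRight_comp_tensorHom_assoc]
    simp only [Category.assoc, Iso.hom_inv_id, Category.comp_id]
    rw [tensorHom_def', Category.assoc, B.e_m hx hxy, leftUnitor_naturality,
      V.cmp_inv_left (D'.r_self hxy) q]
  mul_one {x y} hxy hy := by
    have q : (D'.r hxy hxy le_rfl le_rfl ⋙ T.F hxy) = T.F hxy := by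
      rw [D'.r_self]; rfl
    rw [pullOne_flat T B hy rfl, pullMul_hom T B hxy hy hxy q rfl, whiskerLeft_comp_tensorHom_assoc]
    simp only [Category.assoc, Iso.hom_inv_id, Category.comp_id]
    rw [MonoidalCategory.tensorHom_def, Category.assoc, B.m_e hxy hy, rightUnitor_naturality,
      V.cmp_inv_left (D'.r_self hxy) q]

theorem pull_m {x y z : I} (hxy : P x y) (hyz : P y z) (hxz : P x z)
    {F : A ⥤ D'.D hxz} {K₁ : A ⥤ D'.D hxy} {K₂ : A ⥤ D'.D hyz}
    (e₁ : F ⋙ D'.r hxy hxz le_rfl (D'.le hyz) = K₁)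
    (e₂ : F ⋙ D'.r hyz hxz (D'.le hxy) le_rfl = K₂)
    {F' : A ⥤ D.D hxz} {K₁' : A ⥤ D.D hxy} {K₂' : A ⥤ D.D hyz} (f : F ⋙ T.F hxz = F')
    (k₁ : K₁ ⋙ T.F hxy = K₁') (k₂ : K₂ ⋙ T.F hyz = K₂')
    (e₁' : F' ⋙ D.r hxy hxz le_rfl (D.le hyz) = K₁')
    (e₂' : F' ⋙ D.r hyz hxz (D.le hxy) le_rfl = K₂') :
    (B.pull T).m hxy hyz hxz e₁ e₂ =
      ((V.cmp k₁ _).inv ⊗ₘ (V.cmp k₂ _).inv) ≫ B.m hxy hyz hxz e₁' e₂' ≫ (V.cmp f _).hom :=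
  pullMul_flat T B hxy hyz hxz e₁ e₂ f k₁ k₂ e₁' e₂'

theorem pull_e {x : I} (h : P x x) {F : A ⥤ D'.D h} {F' : A ⥤ D.D h} (f : F ⋙ T.F h = F') :
    (B.pull T).e h F = B.e h F' ≫ (V.cmp f _).hom :=
  B.e_pull h f

/-- A morphism of multiplicative families over the same interval system. -/
structure Hom (A B : V.Fam D) where
  app : ∀ {x y : I} (h : P x y), A.val h ⟶ B.val h
  mul : ∀ {x y z : I} (hxy : P x y) (hyz : P y z) (hxz : P x z),
    (A.mul hxy hyz hxz).hom ≫ app hxz =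
      ((V.pull (D.r hxy hxz le_rfl (D.le hyz))).map (app hxy) ⊗ₘ
        (V.pull (D.r hyz hxz (D.le hxy) le_rfl)).map (app hyz)) ≫ (B.mul hxy hyz hxz).hom
  one : ∀ {x : I} (h : P x x), (A.one h).hom ≫ app h = (B.one h).hom

namespace Hom

attribute [ext] Hom

/-- The composition of morphisms of families. -/
def comp {A B C : V.Fam D} (φ : Hom A B) (ψ : Hom B C) : Hom A C where
  app h := φ.app h ≫ ψ.app h
  mul hxy hyz hxz := by
    rw [← Category.assoc, φ.mul, Category.assoc, ψ.mul, tensorHom_comp_tensorHom_assoc,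
      ← Functor.map_comp, ← Functor.map_comp]
  one h := by rw [← Category.assoc, φ.one, ψ.one]

/-- The pull-back of a morphism of families along a transformation of interval systems. -/
def pull {A B : V.Fam D} (φ : Hom A B) (T : IvlSys.Hom D' D) : Hom (A.pull T) (B.pull T) where
  app h := (V.pull (T.F h)).map (φ.app h)
  mul hxy hyz hxz := by
    simp only [Fam.pull, pullMul, Iso.trans_hom, tensorIso_hom, Functor.Monoidal.μIso_hom,
      Functor.mapIso_hom, Category.assoc, tensorHom_comp_tensorHom_assoc]
    rw [← Functor.map_comp, φ.mul, V.csq_nat, V.csq_nat, Functor.map_comp,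
      ← Functor.LaxMonoidal.μ_natural_assoc, tensorHom_comp_tensorHom_assoc]
  one h := by
    simp only [Fam.pull, pullOne, Iso.trans_hom, Functor.Monoidal.εIso_hom, Functor.mapIso_hom,
      Category.assoc]
    rw [← Functor.map_comp, φ.one]

end Hom

/-- The canonical morphism from an iterated pull-back `T^* T'^* B` to the pull-back along a
transformation with the components of the composite. -/
def pullPull {D'' : IvlSys.{u} P} (T : IvlSys.Hom D'' D') (T' : IvlSys.Hom D' D)
    (T'' : IvlSys.Hom D'' D) (e : ∀ {x y : I} (h : P x y), T.F h ⋙ T'.F h = T''.F h) (B : V.Fam D) :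
    Hom ((B.pull T').pull T) (B.pull T'') where
  app h := (V.cmp (e h) (B.val h)).inv
  mul {x y z} hxy hyz hxz := by
    have k₁ : (D''.r hxy hxz le_rfl (D.le hyz) ⋙ T.F hxy) ⋙ T'.F hxy =
      D''.r hxy hxz le_rfl (D.le hyz) ⋙ T''.F hxy := by rw [Functor.assoc, e]
    have k₂ : (D''.r hyz hxz (D.le hxy) le_rfl ⋙ T.F hyz) ⋙ T'.F hyz =
      D''.r hyz hxz (D.le hxy) le_rfl ⋙ T''.F hyz := by rw [Functor.assoc, e]
    have n : ∀ {a b : I} (h : P a b) (hx : x ≤ a) (hy : b ≤ z),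
      T''.F hxz ⋙ D.r h hxz hx hy = D''.r h hxz hx hy ⋙ T''.F h :=
        fun h hx hy => (T''.nat h hxz hx hy).symm
    have n' : ∀ {a b : I} (h : P a b) (hx : x ≤ a) (hy : b ≤ z),
      T.F hxz ⋙ D'.r h hxz hx hy = D''.r h hxz hx hy ⋙ T.F h :=
        fun h hx hy => (T.nat h hxz hx hy).symm
    change (pullMul T (B.pull T') hxy hyz hxz).hom ≫ _ = _ ≫ (pullMul T'' B hxy hyz hxz).hom
    rw [pullMul_hom T (B.pull T') hxy hyz hxz rfl rfl, pullMul_hom T'' B hxy hyz hxz rfl rfl,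
      pull_m T' B hxy hyz hxz (n' _ _ _) (n' _ _ _) (e hxz) k₁ k₂ (n _ _ _) (n _ _ _)]
    simp only [Category.assoc, Iso.hom_inv_id, Category.comp_id]
    rw [tensorHom_comp_tensorHom_assoc, tensorHom_comp_tensorHom_assoc]
    congr 2
    · exact V.cmp_assoc_inv rfl k₁ (e hxy) rfl (B.val hxy)
    · exact V.cmp_assoc_inv rfl k₂ (e hyz) rfl (B.val hyz)
  one h := by
    change (B.pull T').e h (T.F h) ≫ _ = B.e h (T''.F h)
    rw [pull_e T' B h (e h), Category.assoc, Iso.hom_inv_id, Category.comp_id]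

end Fam
end MonoidalPrederivator

/-! ### Morphisms of families given on the edges -/

namespace MonoidalPrederivator

open Functor.LaxMonoidal (μ ε)

variable {V : MonoidalPrederivator.{u, v, w}}

namespace Fam

section Compat

variable {I : Type} [Preorder I] {P : I → I → Prop} {D : IvlSys.{u} P} {A B : V.Fam D}

instance m_isIso (A : V.Fam D) {A' : Grpd.{u, u}} {x y z : I} (hxy : P x y) (hyz : P y z)
    (hxz : P x z) {F : A' ⥤ D.D hxz} {K₁ : A' ⥤ D.D hxy} {K₂ : A' ⥤ D.D hyz}
    (e₁ : F ⋙ D.r hxy hxz le_rfl (D.le hyz) = K₁)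
    (e₂ : F ⋙ D.r hyz hxz (D.le hxy) le_rfl = K₂) : IsIso (A.m hxy hyz hxz e₁ e₂) := by
  unfold m; infer_instance

/-- The components of `φ` on `[x, y]`, `[y, z]`, `[x, z]` are compatible with the multiplication. -/
def Compat (φ : ∀ {x y : I} (h : P x y), A.val h ⟶ B.val h) {x y z : I} (hxy : P x y)
    (hyz : P y z) (hxz : P x z) : Prop :=
  (A.mul hxy hyz hxz).hom ≫ φ hxz =
    ((V.pull (D.r hxy hxz le_rfl (D.le hyz))).map (φ hxy) ⊗ₘ
      (V.pull (D.r hyz hxz (D.le hxy) le_rfl)).map (φ hyz)) ≫ (B.mul hxy hyz hxz).hom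

variable {φ : ∀ {x y : I} (h : P x y), A.val h ⟶ B.val h}

theorem Compat.flat {x y z : I} {hxy : P x y} {hyz : P y z} {hxz : P x z}
    (h : Compat φ hxy hyz hxz) {A' : Grpd.{u, u}} {F : A' ⥤ D.D hxz} {K₁ : A' ⥤ D.D hxy}
    {K₂ : A' ⥤ D.D hyz} (e₁ : F ⋙ D.r hxy hxz le_rfl (D.le hyz) = K₁)
    (e₂ : F ⋙ D.r hyz hxz (D.le hxy) le_rfl = K₂) :
    A.m hxy hyz hxz e₁ e₂ ≫ (V.pull F).map (φ hxz) =
      ((V.pull K₁).map (φ hxy) ⊗ₘ (V.pull K₂).map (φ hyz)) ≫ B.m hxy hyz hxz e₁ e₂ := by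
  simp only [m, Category.assoc, tensorHom_comp_tensorHom_assoc]
  rw [← Functor.map_comp, h, V.cmp_nat, V.cmp_nat, Functor.map_comp,
    ← Functor.LaxMonoidal.μ_natural_assoc, tensorHom_comp_tensorHom_assoc]

/-- Compatibility for the decompositions of `[x, t]` at `z`, of `[x, z]` at `y` and of `[y, t]` at
`z` implies compatibility for the decomposition of `[x, t]` at `y`. -/
theorem Compat.of_assoc {x y z t : I} {hxy : P x y} {hyz : P y z} {hzt : P z t} {hxz : P x z}
    {hyt : P y t} {hxt : P x t} (h₁ : Compat φ hxy hyz hxz) (h₂ : Compat φ hyz hzt hyt)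
    (h₃ : Compat φ hxz hzt hxt) : Compat φ hxy hyt hxt := by
  have f₁ := h₁.flat (D.r_comp hxy hxz hxt le_rfl (D.le hyz) le_rfl (D.le hzt))
    (D.r_comp hyz hxz hxt (D.le hxy) le_rfl le_rfl (D.le hzt))
  have f₂ := h₂.flat (D.r_comp hyz hyt hxt le_rfl (D.le hzt) (D.le hxy) le_rfl)
    (D.r_comp hzt hyt hxt (D.le hyz) le_rfl (D.le hxy) le_rfl)
  have a : ∀ A : V.Fam D, (A.m hxy hyz hxz
      (D.r_comp hxy hxz hxt le_rfl (D.le hyz) le_rfl (D.le hzt))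
      (D.r_comp hyz hxz hxt (D.le hxy) le_rfl le_rfl (D.le hzt)) ▷ _) ≫ (A.mul hxz hzt hxt).hom =
      (α_ _ _ _).hom ≫ (_ ◁ A.m hyz hzt hyt
        (D.r_comp hyz hyt hxt le_rfl (D.le hzt) (D.le hxy) le_rfl)
        (D.r_comp hzt hyt hxt (D.le hyz) le_rfl (D.le hxy) le_rfl)) ≫ (A.mul hxy hyt hxt).hom :=
    fun A => A.assoc hxy hyz hzt hxz hyt hxt
  unfold Compat at h₃ ⊢
  rw [← cancel_epi (_ ◁ A.m hyz hzt hyt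
        (D.r_comp hyz hyt hxt le_rfl (D.le hzt) (D.le hxy) le_rfl)
        (D.r_comp hzt hyt hxt (D.le hyz) le_rfl (D.le hxy) le_rfl)),
    ← cancel_epi (α_ _ _ _).hom, ← reassoc_of% a A, h₃, whiskerRight_comp_tensorHom_assoc, f₁,
    ← tensorHom_comp_whiskerRight_assoc, a B, associator_naturality_assoc,
    tensorHom_comp_whiskerLeft_assoc, ← f₂, whiskerLeft_comp_tensorHom_assoc]

theorem Compat.one_left {x y : I} (hx : P x x) (hxy : P x y)
    (h : (A.one hx).hom ≫ φ hx = (B.one hx).hom) : Compat φ hx hxy hxy := by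
  have f : A.e hx (D.r hx hxy le_rfl (D.le hxy)) ≫ (V.pull _).map (φ hx) = B.e hx _ := by
    rw [e, Category.assoc, ← Functor.map_comp, h, e]
  have : IsIso (A.e hx (D.r hx hxy le_rfl (D.le hxy))) := by unfold e; infer_instance
  have a : ∀ A : V.Fam D, (A.e hx (D.r hx hxy le_rfl (D.le hxy)) ▷ _) ≫ (A.mul hx hxy hxy).hom =
    (λ_ _).hom ≫ (V.cid (D.r_self hxy) (A.val hxy)).hom := fun A => A.one_mul hx hxy
  rw [Compat, ← cancel_epi (A.e hx (D.r hx hxy le_rfl (D.le hxy)) ▷ _), reassoc_of% a A,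
    whiskerRight_comp_tensorHom_assoc, f, tensorHom_def', Category.assoc, a B,
    leftUnitor_naturality_assoc, V.cid_nat]

theorem Compat.one_right {x y : I} (hxy : P x y) (hy : P y y)
    (h : (A.one hy).hom ≫ φ hy = (B.one hy).hom) : Compat φ hxy hy hxy := by
  have f : A.e hy (D.r hy hxy (D.le hxy) le_rfl) ≫ (V.pull _).map (φ hy) = B.e hy _ := by
    rw [e, Category.assoc, ← Functor.map_comp, h, e]
  have : IsIso (A.e hy (D.r hy hxy (D.le hxy) le_rfl)) := by unfold e; infer_instance
  have a : ∀ A : V.Fam D, (_ ◁ A.e hy (D.r hy hxy (D.le hxy) le_rfl)) ≫ (A.mul hxy hy hxy).hom =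
    (ρ_ _).hom ≫ (V.cid (D.r_self hxy) (A.val hxy)).hom := fun A => A.mul_one hxy hy
  rw [Compat, ← cancel_epi (_ ◁ A.e hy (D.r hy hxy (D.le hxy) le_rfl)), reassoc_of% a A,
    whiskerLeft_comp_tensorHom_assoc, f, MonoidalCategory.tensorHom_def, Category.assoc, a B,
    rightUnitor_naturality_assoc, V.cid_nat]

end Compat

section Extension

variable {n : ℕ} {P : Fin (n + 1) → Fin (n + 1) → Prop} {D : IvlSys.{u} P} {A B : V.Fam D}

/-- A morphism of families is determined by its components on the edges. -/
theorem Hom.ext_edges (hP : ∀ x y, x < y → P x y) {φ ψ : Hom A B}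
    (h : ∀ (i : Fin n) (h : P i.castSucc i.succ), φ.app h = ψ.app h) : φ = ψ := by
  have key : ∀ (k : ℕ) (x y : Fin (n + 1)) (h : P x y), (y : ℕ) = x + k → φ.app h = ψ.app h := by
    intro k
    -- `k` is the number of edges of `[x, y]`; the last edge is split off
    induction k with
    | zero =>
      intro x y hxy e
      obtain rfl : x = y := Fin.ext e.symm
      rw [← cancel_epi (A.one hxy).hom, φ.one, ψ.one]
    | succ k ih =>
      intro x y hxy e
      have hi : (x : ℕ) + k < n := by have := y.2; omega
      let i : Fin n := ⟨x + k, hi⟩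
      obtain rfl : y = i.succ := Fin.ext e
      rcases Nat.eq_zero_or_pos k with rfl | hk
      · have hx : x = i.castSucc := rfl
        clear_value i
        subst hx
        exact h i hxy
      · have h₁ := hP x i.castSucc (Fin.lt_def.2 (by simp [i, hk]))
        have h₂ := hP _ _ i.castSucc_lt_succ
        rw [← cancel_epi (A.mul h₁ h₂ hxy).hom, φ.mul, ψ.mul, ih x _ h₁ rfl, h i h₂]
  apply Hom.ext
  ext x y hxy
  exact key ((y : ℕ) - x) x y hxy (by have := Fin.le_def.1 (D.le hxy); omega)

/-- The component on an interval with `k` edges of the extension of a family of morphisms given on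
the edges.  An interval with at least two edges is decomposed by splitting off its last edge;
intervals with a single edge form a case of their own because the point `[x, x]` need not be among
the intervals satisfying `P`. -/
noncomputable def extend (hP : ∀ x y, x < y → P x y)
    (φ : ∀ (i : Fin n) (h : P i.castSucc i.succ), A.val h ⟶ B.val h) :
    ∀ (k : ℕ) {x y : Fin (n + 1)} (h : P x y), (y : ℕ) = x + k → (A.val h ⟶ B.val h)
  | 0, x, y, h, e => by
    have e' : x = y := Fin.ext e.symm
    subst e'
    exact (A.one h).inv ≫ (B.one h).hom
  | 1, x, y, h, e => by
    have hi : (x : ℕ) < n := by have := y.2; omega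
    have e' : y = Fin.succ (n := n) ⟨x, hi⟩ := Fin.ext e
    subst e'
    exact φ ⟨x, hi⟩ h
  | k + 2, x, y, h, e => by
    have hi : (x : ℕ) + (k + 1) < n := by have := y.2; omega
    have e' : y = Fin.succ (n := n) ⟨x + (k + 1), hi⟩ := Fin.ext e
    subst e'
    have h₁ : P x (Fin.castSucc (n := n) ⟨x + (k + 1), hi⟩) :=
      hP _ _ (Fin.lt_def.2 (by simp))
    have h₂ := hP _ _ (Fin.castSucc_lt_succ (i := (⟨x + (k + 1), hi⟩ : Fin n)))
    exact (A.mul h₁ h₂ h).inv ≫ ((V.pull (D.r h₁ h le_rfl (D.le h₂))).map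
      (extend hP φ (k + 1) h₁ rfl) ⊗ₘ (V.pull (D.r h₂ h (D.le h₁) le_rfl)).map (φ _ h₂)) ≫
      (B.mul h₁ h₂ h).hom

/-- Every family of morphisms on the edges extends to a morphism of multiplicative families. -/
theorem Hom.exists_of_edges (hP : ∀ x y, x < y → P x y)
    (φ : ∀ (i : Fin n) (h : P i.castSucc i.succ), A.val h ⟶ B.val h) :
    ∃ ψ : Hom A B, ∀ (i : Fin n) (h : P i.castSucc i.succ), ψ.app h = φ i h := by
  let ψ : ∀ {x y : Fin (n + 1)} (h : P x y), A.val h ⟶ B.val h := fun {x y} h =>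
    extend hP φ ((y : ℕ) - x) h (by have := Fin.le_def.1 (D.le h); omega)
  have hψ : ∀ (k : ℕ) {x y : Fin (n + 1)} (h : P x y) (e : (y : ℕ) = x + k),
      ψ h = extend hP φ k h e := by
    intro k x y h e
    obtain rfl : k = (y : ℕ) - x := by omega
    rfl
  have one : ∀ {x : Fin (n + 1)} (h : P x x), (A.one h).hom ≫ ψ h = (B.one h).hom := by
    intro x h
    rw [hψ 0 h rfl]
    simp [extend]
  have edge : ∀ (i : Fin n) (h : P i.castSucc i.succ), ψ h = φ i h := by
    intro i h
    rw [hψ 1 h rfl]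
    rfl
  -- compatibility with splitting off the last edge holds by construction
  have step : ∀ (x : Fin (n + 1)) (i : Fin n) (h₁ : P x i.castSucc) (h₂ : P i.castSucc i.succ)
      (h : P x i.succ), Compat (A := A) (B := B) ψ h₁ h₂ h := by
    intro x i h₁ h₂ h
    rcases (D.le h₁).eq_or_lt with e | e
    · subst e
      exact Compat.one_left h₁ h (one h₁)
    · obtain ⟨k, hk⟩ : ∃ k, (i : ℕ) = x + (k + 1) :=
        ⟨i - x - 1, by have := Fin.lt_def.1 e; simp at this; omega⟩
      have hi' : (x : ℕ) + (k + 1) < n := by omega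
      have hi : i = ⟨x + (k + 1), hi'⟩ := Fin.ext hk
      have e₁ := hψ (k + 2) h (by simp [hk]; omega)
      subst hi
      rw [Compat, e₁, edge _ h₂, hψ (k + 1) h₁ rfl]
      simp [extend]
  -- compatibility with the other decompositions follows by associativity, by induction on the
  -- number `k` of edges of the second interval
  have mul : ∀ (k : ℕ) {x y z : Fin (n + 1)} (hxy : P x y) (hyz : P y z) (hxz : P x z),
      (z : ℕ) = y + k → Compat (A := A) (B := B) ψ hxy hyz hxz := by
    intro k
    induction k with
    | zero =>
      intro x y z hxy hyz hxz e
      obtain rfl : y = z := Fin.ext e.symm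
      exact Compat.one_right hxy hyz (one hyz)
    | succ k ih =>
      intro x y z hxy hyz hxz e
      have hi : (y : ℕ) + k < n := by have := z.2; omega
      let i : Fin n := ⟨y + k, hi⟩
      obtain rfl : z = i.succ := Fin.ext e
      rcases Nat.eq_zero_or_pos k with rfl | hk
      · exact step x i hxy hyz hxz
      · have hyi : y < i.castSucc := Fin.lt_def.2 (by simp [i, hk])
        have h₁ := hP y i.castSucc hyi
        have h₂ := hP x i.castSucc ((D.le hxy).trans_lt hyi)
        have h₃ := hP _ _ i.castSucc_lt_succ
        exact Compat.of_assoc (ih hxy h₁ h₂ rfl) (step y i h₁ h₃ hyz) (step x i h₂ h₃ hxz)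
  exact ⟨⟨ψ, fun {x y z} hxy hyz hxz =>
    mul ((z : ℕ) - y) hxy hyz hxz (by have := Fin.le_def.1 (D.le hyz); omega), one⟩, edge⟩

end Extension

end Fam
end MonoidalPrederivator

/-! ### Families with prescribed values on the edges -/

/-- The unique way to go from `x` to `y ≥ x` by successive increments.  Iterated tensor products are
defined by recursion on `Steps x y`: unlike in a recursion on the length `y - x`, both end points
remain visible in the types. -/
inductive Steps (x : ℕ) : ℕ → Type
  | nil : Steps x x
  | cons {y : ℕ} : Steps x y → Steps x (y + 1)

namespace Steps

theorem le {x : ℕ} : ∀ {y : ℕ}, Steps x y → x ≤ y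
  | _, nil => le_rfl
  | _, cons p => p.le.trans (Nat.le_succ _)

theorem eq_of {x : ℕ} : ∀ {y y' : ℕ} (p : Steps x y) (q : Steps x y') (_ : y = y'), HEq p q
  | _, _, nil, nil, _ => HEq.rfl
  | _, _, nil, cons q, e => absurd q.le (by omega)
  | _, _, cons p, nil, e => absurd p.le (by omega)
  | _, _, cons p, cons q, e => by
    obtain rfl := Nat.succ.inj e
    rw [eq_of_heq (eq_of p q rfl)]

instance {x y : ℕ} : Subsingleton (Steps x y) := ⟨fun p q => eq_of_heq (eq_of p q rfl)⟩

theorem nonempty {x y : ℕ} (h : x ≤ y) : Nonempty (Steps x y) := by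
  induction h with
  | refl => exact ⟨nil⟩
  | step _ ih => exact ih.map cons

/-- Concatenation. -/
def append {x y : ℕ} (p : Steps x y) : ∀ {z : ℕ}, Steps y z → Steps x z
  | _, nil => p
  | _, cons q => cons (append p q)

section Tensor

variable {C : Type*} [Category* C] [MonoidalCategory C]

/-- The tensor product `E x ⊗ ⋯ ⊗ E (y - 1)`. -/
def tensor {x : ℕ} : ∀ {y : ℕ} (_ : Steps x y) (_ : ∀ i, x ≤ i → i < y → C), C
  | _, nil, _ => 𝟙_ C
  | y + 1, cons p, E => tensor p (fun i h h' => E i h (h'.trans y.lt_succ_self)) ⊗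
      E y p.le y.lt_succ_self

/-- The tensor product over a concatenation. -/
def tensorAppend {x y : ℕ} (p : Steps x y) : ∀ {z : ℕ} (q : Steps y z)
    (E : ∀ i, x ≤ i → i < z → C),
    p.tensor (fun i h h' => E i h (h'.trans_le q.le)) ⊗
      q.tensor (fun i h h' => E i (p.le.trans h) h') ≅ (p.append q).tensor E
  | _, nil, _ => ρ_ _
  | z + 1, cons q, E => (α_ _ _ _).symm ≪≫
      whiskerRightIso (tensorAppend p q (fun i h h' => E i h (h'.trans z.lt_succ_self))) _

/-- The multiplication `(E x ⊗ ⋯ ⊗ E (y - 1)) ⊗ (E y ⊗ ⋯ ⊗ E (z - 1)) ≅ E x ⊗ ⋯ ⊗ E (z - 1)`. -/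
def tensorMul {x y z : ℕ} (p : Steps x y) (q : Steps y z) (s : Steps x z)
    (E : ∀ i, x ≤ i → i < z → C) :
    p.tensor (fun i h h' => E i h (h'.trans_le q.le)) ⊗
      q.tensor (fun i h h' => E i (p.le.trans h) h') ≅ s.tensor E :=
  tensorAppend p q E ≪≫ eqToIso (by rw [Subsingleton.elim (p.append q) s])

/-- The empty tensor product is the unit. -/
def tensorOne {x : ℕ} (p : Steps x x) (E : ∀ i, x ≤ i → i < x → C) : 𝟙_ C ≅ p.tensor E :=
  eqToIso (by rw [Subsingleton.elim p nil]; rfl)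

/-- The recursive description of the multiplication: the last factor is reassociated. -/
theorem tensorMul_cons {x y z : ℕ} (p : Steps x y) (q : Steps y z) (s : Steps x z)
    (E : ∀ i, x ≤ i → i < z + 1 → C) :
    (tensorMul p q.cons s.cons E).hom = (α_ _ _ _).inv ≫
      (tensorMul p q s (fun i h h' => E i h (h'.trans z.lt_succ_self))).hom ▷ _ := by
  obtain rfl := Subsingleton.elim (p.append q) s
  have h : (tensorMul p q (p.append q) (fun i h h' => E i h (h'.trans z.lt_succ_self))).hom =
    (tensorAppend p q (fun i h h' => E i h (h'.trans z.lt_succ_self))).hom := Category.comp_id _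
  rw [h]
  exact Category.comp_id _

theorem tensorMul_nil {x y : ℕ} (p : Steps x y) (E : ∀ i, x ≤ i → i < y → C) :
    (tensorMul p nil p E).hom = (ρ_ _).hom := Category.comp_id _

theorem tensorMul_assoc {x y z : ℕ} (p : Steps x y) (q : Steps y z) (pq : Steps x z) :
    ∀ {t : ℕ} (s : Steps z t) (qs : Steps y t) (pqs : Steps x t) (E : ∀ i, x ≤ i → i < t → C),
    ((tensorMul p q pq (fun i h h' => E i h (h'.trans_le s.le))).hom ▷ _) ≫
      (tensorMul pq s pqs E).hom =
    (α_ _ _ _).hom ≫ (_ ◁ (tensorMul q s qs (fun i h h' => E i (p.le.trans h) h')).hom) ≫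
      (tensorMul p qs pqs E).hom
  | _, nil, qs, pqs, E => by
    obtain rfl := Subsingleton.elim q qs
    obtain rfl := Subsingleton.elim pq pqs
    rw [tensorMul_nil, tensorMul_nil]
    have h : ∀ {X Y Z : C} (k : X ⊗ Y ⟶ Z),
      k ▷ 𝟙_ C ≫ (ρ_ _).hom = (α_ _ _ _).hom ≫ X ◁ (ρ_ Y).hom ≫ k := by intros; simp
    exact h _
  | t + 1, cons s, qs, pqs, E => by
    obtain ⟨pqs'⟩ := nonempty (p.le.trans (q.le.trans s.le))
    obtain ⟨qs'⟩ := nonempty (q.le.trans s.le)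
    obtain rfl := Subsingleton.elim qs'.cons qs
    obtain rfl := Subsingleton.elim pqs'.cons pqs
    have ih := tensorMul_assoc p q pq s qs' pqs' (fun i h h' => E i h (h'.trans t.lt_succ_self))
    rw [tensorMul_cons, tensorMul_cons, tensorMul_cons]
    have h : ∀ {X Y Z XY YZ W U : C} {k₁ : X ⊗ Y ⟶ XY} {k₂ : XY ⊗ Z ⟶ W} {k₃ : Y ⊗ Z ⟶ YZ}
        {k₄ : X ⊗ YZ ⟶ W} (_ : k₁ ▷ Z ≫ k₂ = (α_ _ _ _).hom ≫ X ◁ k₃ ≫ k₄),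
        k₁ ▷ (Z ⊗ U) ≫ (α_ _ _ _).inv ≫ k₂ ▷ U =
          (α_ _ _ _).hom ≫ X ◁ ((α_ _ _ _).inv ≫ k₃ ▷ U) ≫ (α_ _ _ _).inv ≫ k₄ ▷ U := by
      intro X Y Z XY YZ W U k₁ k₂ k₃ k₄ e
      have e' := congrArg (fun f => (α_ _ _ _).inv ≫ f ▷ U) e
      simp only [comp_whiskerRight] at e'
      rw [associator_inv_naturality_left_assoc, e', MonoidalCategory.whiskerLeft_comp,
        Category.assoc, associator_inv_naturality_middle_assoc]
      simp
    exact h ih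

theorem tensorOne_mul {x : ℕ} (p : Steps x x) : ∀ {y : ℕ} (q : Steps x y)
    (E : ∀ i, x ≤ i → i < y → C), ((tensorOne p _).hom ▷ _) ≫ (tensorMul p q q E).hom = (λ_ _).hom
  | _, nil, E => by
    obtain rfl := Subsingleton.elim nil p
    rw [tensorMul_nil]
    have h : 𝟙 (𝟙_ C) ▷ 𝟙_ C ≫ (ρ_ (𝟙_ C)).hom = (λ_ (𝟙_ C)).hom := by simp [unitors_equal]
    exact h
  | y + 1, cons q, E => by
    rw [tensorMul_cons]
    have ih := tensorOne_mul p q (fun i h h' => E i h (h'.trans y.lt_succ_self))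
    have h : ∀ {X Y Z : C} {k : 𝟙_ C ⟶ X} {k' : X ⊗ Y ⟶ Y} (_ : k ▷ Y ≫ k' = (λ_ _).hom),
        k ▷ (Y ⊗ Z) ≫ (α_ _ _ _).inv ≫ k' ▷ Z = (λ_ _).hom := by
      intro X Y Z k k' e
      have e' := congrArg (fun f => (α_ _ _ _).inv ≫ f ▷ Z) e
      simpa using e'
    exact h ih

theorem tensorMul_one {x y : ℕ} (p : Steps x y) (q : Steps y y)
    (E : ∀ i, x ≤ i → i < y → C) :
    (_ ◁ (tensorOne q _).hom) ≫ (tensorMul p q p E).hom = (ρ_ _).hom := by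
  obtain rfl := Subsingleton.elim nil q
  rw [tensorMul_nil]
  have h : ∀ X : C, X ◁ 𝟙 (𝟙_ C) ≫ (ρ_ X).hom = (ρ_ X).hom := by simp
  exact h _

end Tensor

end Steps

namespace MonoidalPrederivator

open Functor.LaxMonoidal (μ ε)

variable {V : MonoidalPrederivator.{u, v, w}}

section TensorPull

variable {A B C : Grpd.{u, u}}

/-- The tensor product `L_x^* E_x ⊗ ⋯ ⊗ L_(y - 1)^* E_(y - 1)` of pull-backs. -/
def pullTensor {x y : ℕ} (p : Steps x y) {D : ∀ i, x ≤ i → i < y → Grpd.{u, u}}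
    (E : ∀ i h h', V.obj (D i h h')) (L : ∀ i h h', A ⥤ D i h h') : V.obj A :=
  p.tensor fun i h h' => (V.pull (L i h h')).obj (E i h h')

/-- Pull-back commutes with tensor products of pull-backs. -/
def pullTensorIso {x : ℕ} : ∀ {y : ℕ} (p : Steps x y) {D : ∀ i, x ≤ i → i < y → Grpd.{u, u}}
    (E : ∀ i h h', V.obj (D i h h')) {F : A ⥤ B} {M : ∀ i h h', B ⥤ D i h h'}
    {L : ∀ i h h', A ⥤ D i h h'} (_ : ∀ i h h', F ⋙ M i h h' = L i h h'),
    pullTensor p E L ≅ (V.pull F).obj (pullTensor p E M)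
  | _, .nil, _, _, F, _, _, _ => Functor.Monoidal.εIso (V.pull F)
  | y + 1, .cons p, _, E, F, _, _, e =>
    (pullTensorIso p (fun i h h' => E i h (h'.trans y.lt_succ_self))
      (fun i h h' => e i h (h'.trans y.lt_succ_self)) ⊗ᵢ
      V.cmp (e y p.le y.lt_succ_self) (E y p.le y.lt_succ_self)) ≪≫
    Functor.Monoidal.μIso (V.pull F) _ _

theorem pullTensorIso_cons {x y : ℕ} (p : Steps x y) {D : ∀ i, x ≤ i → i < y + 1 → Grpd.{u, u}}
    (E : ∀ i h h', V.obj (D i h h')) {F : A ⥤ B} {M : ∀ i h h', B ⥤ D i h h'}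
    {L : ∀ i h h', A ⥤ D i h h'} (e : ∀ i h h', F ⋙ M i h h' = L i h h') :
    (pullTensorIso p.cons E e).hom =
    ((pullTensorIso p (fun i h h' => E i h (h'.trans y.lt_succ_self))
      (fun i h h' => e i h (h'.trans y.lt_succ_self))).hom ⊗ₘ
      (V.cmp (e y p.le y.lt_succ_self) (E y p.le y.lt_succ_self)).hom) ≫ μ (V.pull F) _ _ := rfl

/-- The isomorphisms `pullTensorIso` are compatible with the composition of functors. -/
theorem pullTensorIso_comp {x : ℕ} : ∀ {y : ℕ} (p : Steps x y)
    {D : ∀ i, x ≤ i → i < y → Grpd.{u, u}} (E : ∀ i h h', V.obj (D i h h')) {F : A ⥤ B} {G : B ⥤ C}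
    {H : A ⥤ C} (f : F ⋙ G = H) {M : ∀ i h h', C ⥤ D i h h'} {L : ∀ i h h', B ⥤ D i h h'}
    {K : ∀ i h h', A ⥤ D i h h'} (e₁ : ∀ i h h', H ⋙ M i h h' = K i h h')
    (e₂ : ∀ i h h', F ⋙ L i h h' = K i h h') (e₃ : ∀ i h h', G ⋙ M i h h' = L i h h'),
    (pullTensorIso p E e₁).hom ≫ (V.cmp f _).hom =
      (pullTensorIso p E e₂).hom ≫ (V.pull F).map (pullTensorIso p E e₃).hom
  | _, .nil, _, _, _, _, _, f, _, _, _, _, _, _ => V.cmp_unit f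
  | y + 1, .cons p, _, E, F, G, H, f, _, _, _, e₁, e₂, e₃ => by
    have ih := pullTensorIso_comp p (fun i h h' => E i h (h'.trans y.lt_succ_self)) f
      (fun i h h' => e₁ i h (h'.trans y.lt_succ_self))
      (fun i h h' => e₂ i h (h'.trans y.lt_succ_self))
      (fun i h h' => e₃ i h (h'.trans y.lt_succ_self))
    have h : ∀ {Z W : V.obj C} {Z' W' : V.obj B} {Z'' W'' : V.obj A}
        {a : Z'' ⟶ (V.pull H).obj Z} {a' : W'' ⟶ (V.pull H).obj W} {b : Z'' ⟶ (V.pull F).obj Z'}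
        {b' : W'' ⟶ (V.pull F).obj W'} {c : Z' ⟶ (V.pull G).obj Z} {c' : W' ⟶ (V.pull G).obj W}
        (_ : a ≫ (V.cmp f Z).hom = b ≫ (V.pull F).map c)
        (_ : a' ≫ (V.cmp f W).hom = b' ≫ (V.pull F).map c'),
        ((a ⊗ₘ a') ≫ μ (V.pull H) _ _) ≫ (V.cmp f (Z ⊗ W)).hom =
          ((b ⊗ₘ b') ≫ μ (V.pull F) _ _) ≫ (V.pull F).map ((c ⊗ₘ c') ≫ μ (V.pull G) _ _) := by
      intro Z W Z' W' Z'' W'' a a' b b' c c' h h'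
      rw [Category.assoc, Category.assoc, V.cmp_tensor, Functor.map_comp,
        ← Functor.LaxMonoidal.μ_natural_assoc, tensorHom_comp_tensorHom_assoc, h, h',
        tensorHom_comp_tensorHom_assoc]
    exact h ih (V.cmp_assoc f (e₁ y p.le y.lt_succ_self) (e₃ y p.le y.lt_succ_self)
      (e₂ y p.le y.lt_succ_self) (E y p.le y.lt_succ_self))

theorem pullTensorIso_id {x : ℕ} : ∀ {y : ℕ} (p : Steps x y)
    {D : ∀ i, x ≤ i → i < y → Grpd.{u, u}} (E : ∀ i h h', V.obj (D i h h')) {F : A ⥤ A} (f : F = 𝟭 A)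
    {M : ∀ i h h', A ⥤ D i h h'} (e : ∀ i h h', F ⋙ M i h h' = M i h h'),
    (pullTensorIso p E e).hom ≫ (V.cid f _).hom = 𝟙 _
  | _, .nil, _, _, _, f, _, _ => V.cid_unit f
  | y + 1, .cons p, _, E, F, f, _, e => by
    have ih := pullTensorIso_id p (fun i h h' => E i h (h'.trans y.lt_succ_self)) f
      (fun i h h' => e i h (h'.trans y.lt_succ_self))
    have h : ∀ {Z W : V.obj A} {a : Z ⟶ (V.pull F).obj Z} {a' : W ⟶ (V.pull F).obj W}
        (_ : a ≫ (V.cid f Z).hom = 𝟙 _) (_ : a' ≫ (V.cid f W).hom = 𝟙 _),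
        ((a ⊗ₘ a') ≫ μ (V.pull F) _ _) ≫ (V.cid f (Z ⊗ W)).hom = 𝟙 _ := by
      intro Z W a a' h h'
      rw [Category.assoc, V.cid_tensor, tensorHom_comp_tensorHom, h, h', id_tensorHom_id]
    exact h ih (V.cmp_cid_left f (e y p.le y.lt_succ_self) _)

theorem pullTensorIso_one {x : ℕ} (p : Steps x x) {D : ∀ i, x ≤ i → i < x → Grpd.{u, u}}
    (E : ∀ i h h', V.obj (D i h h')) {F : A ⥤ B} {M : ∀ i h h', B ⥤ D i h h'}
    {L : ∀ i h h', A ⥤ D i h h'} (e : ∀ i h h', F ⋙ M i h h' = L i h h') :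
    ε (V.pull F) ≫ (V.pull F).map (p.tensorOne fun i h h' => (V.pull (M i h h')).obj (E i h h')).hom =
      (p.tensorOne fun i h h' => (V.pull (L i h h')).obj (E i h h')).hom ≫
        (pullTensorIso p E e).hom := by
  obtain rfl := Subsingleton.elim .nil p
  have h : ε (V.pull F) ≫ (V.pull F).map (𝟙 _) = 𝟙 _ ≫ ε (V.pull F) := by simp
  exact h

/-- The isomorphisms `pullTensorIso` are compatible with the concatenation of tensor products. -/
theorem pullTensorIso_mul {x y : ℕ} (p : Steps x y) : ∀ {z : ℕ} (q : Steps y z) (s : Steps x z)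
    {D : ∀ i, x ≤ i → i < z → Grpd.{u, u}}
    (E : ∀ i h h', V.obj (D i h h')) {F : A ⥤ B} {M : ∀ i h h', B ⥤ D i h h'}
    {L : ∀ i h h', A ⥤ D i h h'} (e : ∀ i h h', F ⋙ M i h h' = L i h h'),
    ((pullTensorIso p (fun i h h' => E i h (h'.trans_le q.le))
          (fun i h h' => e i h (h'.trans_le q.le))).hom ⊗ₘ
        (pullTensorIso q (fun i h h' => E i (p.le.trans h) h')
          (fun i h h' => e i (p.le.trans h) h')).hom) ≫ μ (V.pull F) _ _ ≫
        (V.pull F).map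
          (Steps.tensorMul p q s fun i h h' => (V.pull (M i h h')).obj (E i h h')).hom =
      (Steps.tensorMul p q s fun i h h' => (V.pull (L i h h')).obj (E i h h')).hom ≫
        (pullTensorIso s E e).hom
  | _, .nil, s, _, E, F, _, _, e => by
    obtain rfl := Subsingleton.elim p s
    rw [Steps.tensorMul_nil, Steps.tensorMul_nil]
    have h : ∀ {X : V.obj B} {Y : V.obj A} (t : Y ⟶ (V.pull F).obj X),
        (t ⊗ₘ ε (V.pull F)) ≫ μ (V.pull F) _ _ ≫ (V.pull F).map (ρ_ X).hom = (ρ_ Y).hom ≫ t := by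
      intro X Y t
      rw [MonoidalCategory.tensorHom_def, Category.assoc,
        ← Functor.LaxMonoidal.right_unitality, rightUnitor_naturality]
    exact h _
  | z + 1, .cons q, s, _, E, F, _, _, e => by
    obtain ⟨s'⟩ := Steps.nonempty (p.le.trans q.le)
    obtain rfl := Subsingleton.elim s'.cons s
    have ih := pullTensorIso_mul p q s' (fun i h h' => E i h (h'.trans z.lt_succ_self))
      (fun i h h' => e i h (h'.trans z.lt_succ_self))
    rw [Steps.tensorMul_cons, Steps.tensorMul_cons, pullTensorIso_cons, pullTensorIso_cons]
    have h : ∀ {X Y Z XY : V.obj B} {X' Y' Z' XY' : V.obj A} {m : X ⊗ Y ⟶ XY} {m' : X' ⊗ Y' ⟶ XY'}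
        {a : X' ⟶ (V.pull F).obj X} {b : Y' ⟶ (V.pull F).obj Y} {ab : XY' ⟶ (V.pull F).obj XY}
        {c : Z' ⟶ (V.pull F).obj Z}
        (_ : (a ⊗ₘ b) ≫ μ (V.pull F) _ _ ≫ (V.pull F).map m = m' ≫ ab),
        (a ⊗ₘ ((b ⊗ₘ c) ≫ μ (V.pull F) _ _)) ≫ μ (V.pull F) _ _ ≫
          (V.pull F).map ((α_ _ _ _).inv ≫ m ▷ Z) =
        ((α_ _ _ _).inv ≫ m' ▷ Z') ≫ (ab ⊗ₘ c) ≫ μ (V.pull F) _ _ := by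
      intro X Y Z XY X' Y' Z' XY' m m' a b ab c e
      have := map_assoc (V.pull F) m (𝟙 _) (𝟙 _) ((α_ _ _ _).inv ≫ m ▷ Z) a b c (by simp)
      simp only [CategoryTheory.Functor.map_id, Category.comp_id, e] at this
      rw [Category.assoc, Iso.eq_inv_comp, ← this, whiskerRight_comp_tensorHom_assoc]
    exact h ih

end TensorPull

namespace Fam

variable {n : ℕ} {P : Fin (n + 1) → Fin (n + 1) → Prop} (D : IvlSys.{u} P)
  (hE : ∀ i : Fin n, P i.castSucc i.succ) (E : ∀ i, V.obj (D.D (hE i)))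

/-- The edge `{i, i + 1}`, for a natural number `i < y`. -/
def edgeIdx {y : Fin (n + 1)} (i : ℕ) (h : i < (y : ℕ)) : Fin n := ⟨i, by omega⟩

/-- The restriction to the edge `{i, i + 1}` of the interval `[x, y]`. -/
def toEdge {x y : Fin (n + 1)} (h : P x y) (i : ℕ) (hx : (x : ℕ) ≤ i) (hy : i < (y : ℕ)) :
    D.D h ⥤ D.D (hE (edgeIdx i hy)) :=
  D.r (hE (edgeIdx i hy)) h (Fin.le_def.2 hx) (Fin.le_def.2 hy)

/-- The edges of the interval from `x` to `y`. -/
noncomputable def steps {x y : Fin (n + 1)} (h : P x y) : Steps x y :=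
  (Steps.nonempty (Fin.le_def.1 (D.le h))).some

theorem r_toEdge {x y x' y' : Fin (n + 1)} (h : P x y) (h' : P x' y') (hx : x' ≤ x) (hy : y ≤ y')
    (i : ℕ) (hi : (x : ℕ) ≤ i) (hi' : i < (y : ℕ)) :
    D.r h h' hx hy ⋙ toEdge D hE h i hi hi' =
      toEdge D hE h' i ((Fin.le_def.1 hx).trans hi) (hi'.trans_le (Fin.le_def.1 hy)) :=
  D.r_comp _ _ _ _ _ _ _

/-- The pull-back to `[x', y']` of the tensor product over the edges of `[x, y]`. -/
noncomputable def edgeIso {x y x' y' : Fin (n + 1)} (h : P x y) (h' : P x' y') (hx : x' ≤ x)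
    (hy : y ≤ y') :
    pullTensor (steps D h) (fun i _ hi => E (edgeIdx i hi)) (fun i hi hi' =>
        toEdge D hE h' i ((Fin.le_def.1 hx).trans hi) (hi'.trans_le (Fin.le_def.1 hy))) ≅
      (V.pull (D.r h h' hx hy)).obj
        (pullTensor (steps D h) (fun i _ hi => E (edgeIdx i hi)) (toEdge D hE h)) :=
  pullTensorIso _ _ (r_toEdge D hE h h' hx hy)

/-- The multiplication of the family `ofEdges`: both factors are written as tensor products over
edges of `[x, z]` and are then concatenated. -/
noncomputable def edgeMul {x y z : Fin (n + 1)} (hxy : P x y) (hyz : P y z) (hxz : P x z) :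
    (V.pull (D.r hxy hxz le_rfl (D.le hyz))).obj
        (pullTensor (steps D hxy) (fun i _ hi => E (edgeIdx i hi)) (toEdge D hE hxy)) ⊗
      (V.pull (D.r hyz hxz (D.le hxy) le_rfl)).obj
        (pullTensor (steps D hyz) (fun i _ hi => E (edgeIdx i hi)) (toEdge D hE hyz)) ≅
      pullTensor (steps D hxz) (fun i _ hi => E (edgeIdx i hi)) (toEdge D hE hxz) :=
  ((edgeIso D hE E hxy hxz le_rfl (D.le hyz)) ⊗ᵢ
    (edgeIso D hE E hyz hxz (D.le hxy) le_rfl)).symm ≪≫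
    Steps.tensorMul (steps D hxy) (steps D hyz) (steps D hxz)
      (fun i hi hi' => (V.pull (toEdge D hE hxz i hi hi')).obj (E (edgeIdx i hi')))

theorem edgeMul_hom {x y z : Fin (n + 1)} (hxy : P x y) (hyz : P y z) (hxz : P x z) :
    ((edgeIso D hE E hxy hxz le_rfl (D.le hyz)).hom ⊗ₘ
      (edgeIso D hE E hyz hxz (D.le hxy) le_rfl).hom) ≫ (edgeMul D hE E hxy hyz hxz).hom =
    (Steps.tensorMul (steps D hxy) (steps D hyz) (steps D hxz)
      (fun i hi hi' => (V.pull (toEdge D hE hxz i hi hi')).obj (E (edgeIdx i hi')))).hom :=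
  Iso.hom_inv_id_assoc (edgeIso D hE E hxy hxz le_rfl (D.le hyz) ⊗ᵢ
    edgeIso D hE E hyz hxz (D.le hxy) le_rfl) _

/-- The pull-back of `edgeMul` to a larger interval is concatenation there. -/
theorem edgeMul_pull {x y z x' z' : Fin (n + 1)} (hxy : P x y) (hyz : P y z) (hxz : P x z)
    (h' : P x' z') (hx : x' ≤ x) (hz : z ≤ z') :
    ((V.cmp (D.r_comp hxy hxz h' le_rfl (D.le hyz) hx hz) _).hom ⊗ₘ
        (V.cmp (D.r_comp hyz hxz h' (D.le hxy) le_rfl hx hz) _).hom) ≫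
      μ (V.pull (D.r hxz h' hx hz)) _ _ ≫
        (V.pull (D.r hxz h' hx hz)).map (edgeMul D hE E hxy hyz hxz).hom =
    ((edgeIso D hE E hxy h' hx ((D.le hyz).trans hz)).inv ⊗ₘ
      (edgeIso D hE E hyz h' (hx.trans (D.le hxy)) hz).inv) ≫
      (Steps.tensorMul (steps D hxy) (steps D hyz) (steps D hxz)
        (fun i hi hi' => (V.pull (toEdge D hE h' i ((Fin.le_def.1 hx).trans hi)
          (hi'.trans_le (Fin.le_def.1 hz)))).obj (E (edgeIdx i hi')))).hom ≫
      (edgeIso D hE E hxz h' hx hz).hom := by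
  have key := pullTensorIso_mul (steps D hxy) (steps D hyz) (steps D hxz)
    (fun i _ hi => E (edgeIdx i hi)) (r_toEdge D hE hxz h' hx hz)
  have c₁ := pullTensorIso_comp (steps D hxy) (fun i _ hi => E (edgeIdx i hi))
    (D.r_comp hxy hxz h' le_rfl (D.le hyz) hx hz) (r_toEdge D hE hxy h' hx ((D.le hyz).trans hz))
    (fun i hi hi' => r_toEdge D hE hxz h' hx hz i hi (hi'.trans_le (Fin.le_def.1 (D.le hyz))))
    (r_toEdge D hE hxy hxz le_rfl (D.le hyz))
  have c₂ := pullTensorIso_comp (steps D hyz) (fun i _ hi => E (edgeIdx i hi))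
    (D.r_comp hyz hxz h' (D.le hxy) le_rfl hx hz) (r_toEdge D hE hyz h' (hx.trans (D.le hxy)) hz)
    (fun i hi hi' => r_toEdge D hE hxz h' hx hz i ((Fin.le_def.1 (D.le hxy)).trans hi) hi')
    (r_toEdge D hE hyz hxz (D.le hxy) le_rfl)
  rw [← cancel_epi ((edgeIso D hE E hxy h' hx ((D.le hyz).trans hz)).hom ⊗ₘ
      (edgeIso D hE E hyz h' (hx.trans (D.le hxy)) hz).hom), tensorHom_comp_tensorHom_assoc,
    tensorHom_comp_tensorHom_assoc, Iso.hom_inv_id, Iso.hom_inv_id, id_tensorHom_id,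
    Category.id_comp]
  refine Eq.trans ?_ key
  have d₁ : (edgeIso D hE E hxy h' hx ((D.le hyz).trans hz)).hom ≫
      (V.cmp (D.r_comp hxy hxz h' le_rfl (D.le hyz) hx hz) _).hom =
      _ ≫ (V.pull _).map (edgeIso D hE E hxy hxz le_rfl (D.le hyz)).hom := c₁
  have d₂ : (edgeIso D hE E hyz h' (hx.trans (D.le hxy)) hz).hom ≫
      (V.cmp (D.r_comp hyz hxz h' (D.le hxy) le_rfl hx hz) _).hom =
      _ ≫ (V.pull _).map (edgeIso D hE E hyz hxz (D.le hxy) le_rfl).hom := c₂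
  rw [d₁, d₂, ← tensorHom_comp_tensorHom_assoc, Functor.LaxMonoidal.μ_natural_assoc,
    ← Functor.map_comp, edgeMul_hom]
  rfl

theorem edgeIso_self_inv {x y : Fin (n + 1)} (h : P x y) :
    (edgeIso D hE E h h le_rfl le_rfl).inv = (V.cid (D.r_self h) _).hom := by
  have a : (edgeIso D hE E h h le_rfl le_rfl).hom ≫ (V.cid (D.r_self h) _).hom = 𝟙 _ :=
    pullTensorIso_id (steps D h) (fun i _ hi => E (edgeIdx i hi)) (D.r_self h)
      (r_toEdge D hE h h le_rfl le_rfl)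
  exact (((Iso.eq_inv_comp _).2 a).trans (Category.comp_id _)).symm

/-- The multiplicative family `A_[x, y] = E_x ⊗ ⋯ ⊗ E_(y - 1)` with prescribed values on the edges,
the factors being pulled back to the groupoid of `[x, y]`. -/
noncomputable def ofEdges : V.Fam D where
  val h := pullTensor (steps D h) (fun i _ hi => E (edgeIdx i hi)) (toEdge D hE h)
  mul := edgeMul D hE E
  one h := (steps D h).tensorOne _
  assoc {x y z t} hxy hyz hzt hxz hyt hxt := by
    rw [edgeMul_pull, edgeMul_pull]
    have a := Steps.tensorMul_assoc (steps D hxy) (steps D hyz) (steps D hxz) (steps D hzt)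
      (steps D hyt) (steps D hxt)
      (fun i hi hi' => (V.pull (toEdge D hE hxt i hi hi')).obj (E (edgeIdx i hi')))
    have h : ∀ {X X' Y Y' Z Z' XY XY' YZ YZ' W : V.obj (D.D hxt)} (i₁ : X' ≅ X) (i₂ : Y' ≅ Y)
        (i₃ : Z' ≅ Z) (j : XY' ≅ XY) (j' : YZ' ≅ YZ) {k : X' ⊗ Y' ⟶ XY'} {k' : Y' ⊗ Z' ⟶ YZ'}
        {l : XY' ⊗ Z' ⟶ W} {l' : X' ⊗ YZ' ⟶ W}
        (_ : (k ▷ Z') ≫ l = (α_ _ _ _).hom ≫ (X' ◁ k') ≫ l'),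
        (((i₁.inv ⊗ₘ i₂.inv) ≫ k ≫ j.hom) ▷ Z) ≫ (j.inv ⊗ₘ i₃.inv) ≫ l =
          (α_ _ _ _).hom ≫ (X ◁ ((i₂.inv ⊗ₘ i₃.inv) ≫ k' ≫ j'.hom)) ≫ (i₁.inv ⊗ₘ j'.inv) ≫ l' := by
      intro X X' Y Y' Z Z' XY XY' YZ YZ' W i₁ i₂ i₃ j j' k k' l l' e
      rw [whiskerRight_comp_tensorHom_assoc, whiskerLeft_comp_tensorHom_assoc]
      simp only [Category.assoc, Iso.hom_inv_id, Category.comp_id]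
      rw [← tensorHom_comp_whiskerRight_assoc, ← tensorHom_comp_whiskerLeft_assoc, e,
        associator_naturality_assoc]
    exact h _ _ _ _ _ a
  one_mul {x y} hx hxy := by
    have o : ε (V.pull (D.r hx hxy le_rfl (D.le hxy))) ≫ (V.pull _).map
        ((steps D hx).tensorOne _).hom = _ ≫ (edgeIso D hE E hx hxy le_rfl (D.le hxy)).hom :=
      pullTensorIso_one (steps D hx) (fun i _ hi => E (edgeIdx i hi)) _
    have a := Steps.tensorOne_mul (steps D hx) (steps D hxy)
      (fun i hi hi' => (V.pull (toEdge D hE hxy i hi hi')).obj (E (edgeIdx i hi')))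
    have h : ∀ {X X' Y Y' : V.obj (D.D hxy)} (i : X' ≅ X) (j : Y' ≅ Y) {u : 𝟙_ _ ⟶ X'}
        {k : X' ⊗ Y' ⟶ Y'} {v : 𝟙_ _ ⟶ X} {c : Y ⟶ Y'} (_ : v = u ≫ i.hom) (_ : j.inv = c)
        (_ : (u ▷ Y') ≫ k = (λ_ _).hom), (v ▷ Y) ≫ (i.inv ⊗ₘ j.inv) ≫ k = (λ_ _).hom ≫ c := by
      intro X X' Y Y' i j u k v c hv hc e
      rw [hv, ← hc, whiskerRight_comp_tensorHom_assoc, Category.assoc, Iso.hom_inv_id, Category.comp_id,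
        tensorHom_def', Category.assoc, e, leftUnitor_naturality]
    exact h _ _ o (edgeIso_self_inv D hE E hxy) a
  mul_one {x y} hxy hy := by
    have o : ε (V.pull (D.r hy hxy (D.le hxy) le_rfl)) ≫ (V.pull _).map
        ((steps D hy).tensorOne _).hom = _ ≫ (edgeIso D hE E hy hxy (D.le hxy) le_rfl).hom :=
      pullTensorIso_one (steps D hy) (fun i _ hi => E (edgeIdx i hi)) _
    have a := Steps.tensorMul_one (steps D hxy) (steps D hy)
      (fun i hi hi' => (V.pull (toEdge D hE hxy i hi hi')).obj (E (edgeIdx i hi')))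
    have h : ∀ {X X' Y Y' : V.obj (D.D hxy)} (i : X' ≅ X) (j : Y' ≅ Y) {u : 𝟙_ _ ⟶ X'}
        {k : Y' ⊗ X' ⟶ Y'} {v : 𝟙_ _ ⟶ X} {c : Y ⟶ Y'} (_ : v = u ≫ i.hom) (_ : j.inv = c)
        (_ : (Y' ◁ u) ≫ k = (ρ_ _).hom), (Y ◁ v) ≫ (j.inv ⊗ₘ i.inv) ≫ k = (ρ_ _).hom ≫ c := by
      intro X X' Y Y' i j u k v c hv hc e
      rw [hv, ← hc, whiskerLeft_comp_tensorHom_assoc, Category.assoc, Iso.hom_inv_id, Category.comp_id,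
        MonoidalCategory.tensorHom_def, Category.assoc, e, rightUnitor_naturality]
    exact h _ _ o (edgeIso_self_inv D hE E hxy) a

theorem ofEdges_edge (i : Fin n) : Nonempty ((ofEdges D hE E).val (hE i) ≅ E i) := by
  have h : ∀ (p : Steps (i : ℕ) (i + 1)) (C : V.obj (D.D (hE i)))
      (F : ∀ j, (i : ℕ) ≤ j → j < i + 1 → V.obj (D.D (hE i))),
      Nonempty (F i le_rfl (Nat.lt_succ_self _) ≅ C) → Nonempty (p.tensor F ≅ C) := by
    rintro p C F ⟨c⟩
    obtain rfl := Subsingleton.elim (Steps.cons .nil) p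
    exact ⟨(λ_ _) ≪≫ c⟩
  exact h _ _ _ ⟨V.cid (D.r_self (hE i)) (E i)⟩

end Fam

end MonoidalPrederivator

/-! ### Left Kan extensions and tensor products -/

namespace MonoidalPrederivator

open Functor.LaxMonoidal (μ ε)

variable {V : MonoidalPrederivator.{u, v, w}}

section Squares

variable (V)
variable {A B B' C C' : Grpd.{u, u}}

theorem csq_map_cmp {F : A ⥤ B} {G : B ⥤ C} {F' : A ⥤ B'} {G' : B' ⥤ C} (e : F ⋙ G = F' ⋙ G')
    {K : B' ⥤ C'} {L : C' ⥤ C} {F'' : A ⥤ C'} (e₁ : K ⋙ L = G') (e₂ : F' ⋙ K = F'')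
    (e₃ : F ⋙ G = F'' ⋙ L) (Z : V.obj C) :
    (V.csq e Z).hom ≫ (V.pull F').map (V.cmp e₁ Z).hom =
      (V.csq e₃ Z).hom ≫ (V.cmp e₂ ((V.pull L).obj Z)).hom := by
  rw [V.csq_eq e rfl e.symm, V.csq_eq e₃ rfl e₃.symm, Category.assoc, Category.assoc,
    V.cmp_assoc e₂ e₃.symm e₁ e.symm]

theorem cmp_map_csq {F : A ⥤ B} {G : B ⥤ B'} {F' : A ⥤ B'} {K : B' ⥤ C} {L : B ⥤ C'} {M : C' ⥤ C}
    {N : A ⥤ C'} (e₁ : F ⋙ G = F') (e₂ : G ⋙ K = L ⋙ M) (e₃ : F ⋙ L = N) (e₄ : F' ⋙ K = N ⋙ M)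
    (Z : V.obj C) :
    (V.cmp e₁ ((V.pull K).obj Z)).hom ≫ (V.pull F).map (V.csq e₂ Z).hom =
      (V.csq e₄ Z).hom ≫ (V.cmp e₃ ((V.pull M).obj Z)).hom := by
  have h : F ⋙ G ⋙ K = F' ⋙ K := by rw [← e₁, Functor.assoc]
  rw [V.csq_eq e₂ rfl e₂.symm, V.csq_eq e₄ rfl e₄.symm, Functor.map_comp, Category.assoc,
    V.cmp_assoc e₃ e₄.symm e₂.symm h, Iso.eq_inv_comp, reassoc_of% V.cmp_assoc e₁ rfl rfl h,
    ← Functor.map_comp_assoc, Iso.hom_inv_id, CategoryTheory.Functor.map_id, Category.id_comp]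

theorem csq_tensor {F : A ⥤ B} {G : B ⥤ C} {F' : A ⥤ B'} {G' : B' ⥤ C} (e : F ⋙ G = F' ⋙ G')
    (Z W : V.obj C) :
    μ (V.pull F) _ _ ≫ (V.pull F).map (μ (V.pull G) Z W) ≫ (V.csq e (Z ⊗ W)).hom =
      ((V.csq e Z).hom ⊗ₘ (V.csq e W).hom) ≫ μ (V.pull F') _ _ ≫
        (V.pull F').map (μ (V.pull G') Z W) := by
  rw [← cancel_epi ((V.cmp rfl Z).hom ⊗ₘ (V.cmp rfl W).hom), ← reassoc_of% V.cmp_tensor rfl,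
    V.cmp_csq e rfl e.symm, tensorHom_comp_tensorHom_assoc, V.cmp_csq e rfl e.symm,
    V.cmp_csq e rfl e.symm, V.cmp_tensor e.symm]

theorem cid_inv_csq {F : A ⥤ B} {G : B ⥤ B} {F' : A ⥤ B'} {G' : B' ⥤ B} (h : G = 𝟭 B)
    (e : F ⋙ G = F' ⋙ G') (e' : F' ⋙ G' = F) (Z : V.obj B) :
    (V.pull F).map (V.cid h Z).inv ≫ (V.csq e Z).hom = (V.cmp e' Z).hom := by
  have e₁ : F ⋙ G = F := by rw [h]; rfl
  rw [V.csq_eq e e₁ e', V.cmp_inv_right h e₁, ← Functor.map_comp_assoc, Iso.inv_hom_id,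
    CategoryTheory.Functor.map_id, Category.id_comp]

/-- The compatibility of the structure isomorphisms with the pasting of squares and triangles. -/
theorem cmp_map_csq_csq {E : Grpd.{u, u}} {F : A ⥤ B} {G : B ⥤ B'} {F' : A ⥤ B'} {K : B' ⥤ C}
    {L : B ⥤ C'} {M : C' ⥤ C} {T : A ⥤ E} {Q : E ⥤ C'} {R : E ⥤ C} (e₁ : F ⋙ G = F')
    (e₂ : G ⋙ K = L ⋙ M) (e₃ : F ⋙ L = T ⋙ Q) (e₄ : Q ⋙ M = R) (e₅ : F' ⋙ K = T ⋙ R)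
    (Z : V.obj C) :
    (V.cmp e₁ ((V.pull K).obj Z)).hom ≫ (V.pull F).map (V.csq e₂ Z).hom ≫
        (V.csq e₃ ((V.pull M).obj Z)).hom =
      (V.csq e₅ Z).hom ≫ (V.pull T).map (V.cmp e₄ Z).hom := by
  have e₆ : F' ⋙ K = (T ⋙ Q) ⋙ M := by rw [e₅, ← e₄, Functor.assoc]
  rw [reassoc_of% V.cmp_map_csq e₁ e₂ e₃ e₆, V.csq_map_cmp e₅ e₄ rfl e₆, V.cmp_csq e₃ e₃ rfl]

theorem pull₂_eqToHom {F G : A ⥤ B} (h : F = G) :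
    V.pull₂ (eqToHom h) = eqToHom (congrArg V.pull h) := by
  subst h
  exact V.pull₂_id F

/-- For a strictly commutative square the base change of a morphism is given by `csq`. -/
theorem baseChange_eqToIso {F : B ⥤ C} {G : B' ⥤ C} {H : A ⥤ B} {K : A ⥤ B'} (e : H ⋙ F = K ⋙ G)
    {Z : V.obj B} {W : V.obj C} (η : Z ⟶ (V.pull F).obj W) :
    V.baseChange (eqToIso e) η = (V.pull H).map η ≫ (V.csq e W).hom := by
  simp only [baseChange, csq, Iso.trans_hom, Iso.symm_hom, eqToIso.hom, pull₂_eqToHom]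
  simp [cmp]

theorem extPull_hom {A B A' B' : Grpd.{u, u}} (F : A ⥤ A') (G : B ⥤ B') (Z : V.obj A')
    (Z' : V.obj B') : (V.extPull F G Z Z').hom =
      ((V.csq (show pr₁ A B ⋙ F = prodMap F G ⋙ pr₁ A' B' from rfl) Z).hom ⊗ₘ
        (V.csq (show pr₂ A B ⋙ G = prodMap F G ⋙ pr₂ A' B' from rfl) Z').hom) ≫
      μ (V.pull (prodMap F G)) ((V.pull (pr₁ A' B')).obj Z) ((V.pull (pr₂ A' B')).obj Z') := by
  have h₁ := (V.csq_eq (show pr₁ A B ⋙ F = prodMap F G ⋙ pr₁ A' B' from rfl) rfl rfl Z).trans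
    (congrArg₂ (· ≫ ·) (V.cmp_rfl_inv (pr₁ A B) F Z) (V.cmp_rfl_hom (prodMap F G) (pr₁ A' B') Z))
  have h₂ := (V.csq_eq (show pr₂ A B ⋙ G = prodMap F G ⋙ pr₂ A' B' from rfl) rfl rfl Z').trans
    (congrArg₂ (· ≫ ·) (V.cmp_rfl_inv (pr₂ A B) G Z') (V.cmp_rfl_hom (prodMap F G) (pr₂ A' B') Z'))
  rw [h₁, h₂]
  rfl

end Squares

section Kan

variable {A B C : Grpd.{u, u}}

/-- Left Kan extensions compose. -/
theorem IsLeftKan.comp {F : A ⥤ B} {G : B ⥤ C} {H : A ⥤ C} (e : F ⋙ G = H) {Z : V.obj A}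
    {W : V.obj B} {U : V.obj C} {η : Z ⟶ (V.pull F).obj W} {θ : W ⟶ (V.pull G).obj U}
    (hη : V.IsLeftKan F η) (hθ : V.IsLeftKan G θ) :
    V.IsLeftKan H (η ≫ (V.pull F).map θ ≫ (V.cmp e U).inv) := by
  intro W'
  have h : (fun g : U ⟶ W' => (η ≫ (V.pull F).map θ ≫ (V.cmp e U).inv) ≫ (V.pull H).map g) =
      (fun k => k ≫ (V.cmp e W').inv) ∘ (fun k => η ≫ (V.pull F).map k) ∘
        fun g => θ ≫ (V.pull G).map g := by
    ext g
    simp [← V.cmp_inv_nat]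
  rw [h]
  exact (Function.bijective_iff_has_inverse.2 ⟨fun k => k ≫ (V.cmp e W').hom, fun k => by simp,
    fun k => by simp⟩).comp ((hη _).comp (hθ _))

theorem IsLeftKan.of_iso {F : A ⥤ B} {Z Z' : V.obj A} {W W' : V.obj B}
    {η : Z ⟶ (V.pull F).obj W} (hη : V.IsLeftKan F η) (a : Z' ≅ Z) (b : W ≅ W') :
    V.IsLeftKan F (a.hom ≫ η ≫ (V.pull F).map b.hom) := by
  intro U
  have h : (fun g : W' ⟶ U => (a.hom ≫ η ≫ (V.pull F).map b.hom) ≫ (V.pull F).map g) =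
      (fun k => a.hom ≫ k) ∘ (fun k => η ≫ (V.pull F).map k) ∘ fun g => b.hom ≫ g := by
    ext g
    simp
  rw [h]
  exact (Function.bijective_iff_has_inverse.2 ⟨fun k => a.inv ≫ k, fun k => by simp,
    fun k => by simp⟩).comp ((hη _).comp (Function.bijective_iff_has_inverse.2
      ⟨fun k => b.inv ≫ k, fun k => by simp, fun k => by simp⟩))

/-- Pull-back along an equivalence is an equivalence. -/
theorem pull_isEquivalence (F : A ⥤ B) [F.IsEquivalence] : (V.pull F).IsEquivalence := by
  have p : ∀ {A B : Grpd.{u, u}} {F G : A ⥤ B}, (F ≅ G) → (V.pull F ≅ V.pull G) := fun i =>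
    ⟨V.pull₂ i.hom, V.pull₂ i.inv, by rw [← V.pull₂_comp, i.hom_inv_id, V.pull₂_id],
      by rw [← V.pull₂_comp, i.inv_hom_id, V.pull₂_id]⟩
  exact (CategoryTheory.Equivalence.mk (V.pull F) (V.pull F.inv)
    ((V.pullId B).symm ≪≫ p F.asEquivalence.counitIso.symm ≪≫ V.pullComp F.inv F)
    ((V.pullComp F F.inv).symm ≪≫ p F.asEquivalence.unitIso.symm ≪≫
      V.pullId A)).isEquivalence_functor

theorem isLeftKan_of_isIso (F : A ⥤ B) [F.IsEquivalence] {Z : V.obj A} {W : V.obj B}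
    (η : Z ⟶ (V.pull F).obj W) [IsIso η] : V.IsLeftKan F η := by
  have := V.pull_isEquivalence F
  intro W'
  exact (Function.bijective_iff_has_inverse.2 ⟨fun k => inv η ≫ k, fun k => by simp,
    fun k => by simp⟩).comp (Functor.FullyFaithful.map_bijective
      (.ofFullyFaithful (V.pull F)) W W')

/-- The shape of the computation in `ext_isLeftKan`, with `G` the pull-back along `F × 𝟭`: a
composite of two tensor products of morphisms is computed factor by factor. -/
theorem tensor_map_comp {C E : Type*} [Category* C] [Category* E] [MonoidalCategory C]
    [MonoidalCategory E] (G : C ⥤ E) [G.LaxMonoidal] {P P' Q Q' R : C} {f : P ⟶ P'} {g : Q ⟶ Q'}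
    {ν : P' ⊗ Q' ⟶ R} {X Y X₀ Y₀ X₁ Y₁ T : E} {a : X ⟶ G.obj P} {b : Y ⟶ G.obj Q} {x : X ⟶ X₀}
    {y : Y ⟶ Y₀} {c : X₀ ⟶ X₁} {d : Y₀ ⟶ Y₁} {m : X₁ ⊗ Y₁ ⟶ T} {k : T ⟶ G.obj R}
    {p : X₁ ⟶ G.obj P'} {q : Y₁ ⟶ G.obj Q'}
    (h : m ≫ k = (p ⊗ₘ q) ≫ μ G P' Q' ≫ G.map ν) (h₁ : a ≫ G.map f = x ≫ c ≫ p)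
    (h₂ : b ≫ G.map g = y ≫ d ≫ q) :
    ((a ⊗ₘ b) ≫ μ G P Q) ≫ G.map ((f ⊗ₘ g) ≫ ν) = ((x ⊗ₘ y) ≫ (c ⊗ₘ d) ≫ m) ≫ k := by
  simp only [Category.assoc, h, Functor.map_comp]
  rw [← Functor.LaxMonoidal.μ_natural_assoc]
  simp only [tensorHom_comp_tensorHom_assoc, h₁, h₂]

/-- The external product of two left Kan extensions is a left Kan extension along the product of
the functors, which is factored as `(F × 𝟭) ⋙ (𝟭 × G)`. -/
theorem ext_isLeftKan (hV' : V.IsComponentwiseCocontinuous) {A' B' : Grpd.{u, u}} (F : A ⥤ A')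
    (G : B ⥤ B') {Z : V.obj A} {W : V.obj A'} {η : Z ⟶ (V.pull F).obj W} (hη : V.IsLeftKan F η)
    {Z' : V.obj B} {W' : V.obj B'} {η' : Z' ⟶ (V.pull G).obj W'} (hη' : V.IsLeftKan G η') :
    V.IsLeftKan (prodMap F G) (V.extMap η η' ≫ (V.extPull F G W W').hom) := by
  have a : ∀ {A : Grpd.{u, u}} (Z : V.obj A), (V.pullId A).inv.app Z = (V.cid rfl Z).inv := by
    intro A Z
    simp [cid]
  have h₁ : V.IsLeftKan (prodMap F (𝟭 B)) (Z := V.ext Z Z') (W := V.ext W Z')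
      ((((V.pull (pr₁ A B)).map η ≫
        (V.csq (show pr₁ A B ⋙ F = prodMap F (𝟭 B) ⋙ pr₁ A' B from rfl) W).hom) ⊗ₘ
        (V.cmp (show prodMap F (𝟭 B) ⋙ pr₂ A' B = pr₂ A B from rfl) Z').hom) ≫
      μ (V.pull (prodMap F (𝟭 B))) ((V.pull (pr₁ A' B)).obj W) ((V.pull (pr₂ A' B)).obj Z')) := by
    have l := hV'.left F B η hη Z'
    rw [extPull_hom, a, extMap] at l
    refine cast (congrArg (V.IsLeftKan _) ?_) l
    exact (tensorHom_comp_tensorHom_assoc _ _ _ _ _).trans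
      (congrArg (fun t => (_ ⊗ₘ t) ≫ _) (V.cid_inv_csq rfl
        (show pr₂ A B ⋙ 𝟭 B = prodMap F (𝟭 B) ⋙ pr₂ A' B from rfl)
        (show prodMap F (𝟭 B) ⋙ pr₂ A' B = pr₂ A B from rfl) Z'))
  have h₂ : V.IsLeftKan (prodMap (𝟭 A') G) (Z := V.ext W Z') (W := V.ext W W')
      (((V.cmp (show prodMap (𝟭 A') G ⋙ pr₁ A' B' = pr₁ A' B from rfl) W).hom ⊗ₘ
        ((V.pull (pr₂ A' B)).map η' ≫
        (V.csq (show pr₂ A' B ⋙ G = prodMap (𝟭 A') G ⋙ pr₂ A' B' from rfl) W').hom)) ≫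
      μ (V.pull (prodMap (𝟭 A') G)) ((V.pull (pr₁ A' B')).obj W)
        ((V.pull (pr₂ A' B')).obj W')) := by
    have l := hV'.right G A' η' hη' W
    rw [extPull_hom, a, extMap] at l
    refine cast (congrArg (V.IsLeftKan _) ?_) l
    exact (tensorHom_comp_tensorHom_assoc _ _ _ _ _).trans
      (congrArg (fun t => (t ⊗ₘ _) ≫ _) (V.cid_inv_csq rfl
        (show pr₁ A' B ⋙ 𝟭 A' = prodMap (𝟭 A') G ⋙ pr₁ A' B' from rfl)
        (show prodMap (𝟭 A') G ⋙ pr₁ A' B' = pr₁ A' B from rfl) W))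
  have h := h₁.comp (show prodMap F (𝟭 B) ⋙ prodMap (𝟭 A') G = prodMap F G from rfl) h₂
  have t := V.cmp_tensor (show prodMap F (𝟭 B) ⋙ prodMap (𝟭 A') G = prodMap F G from rfl)
    ((V.pull (pr₁ A' B')).obj W) ((V.pull (pr₂ A' B')).obj W')
  have s₁ := V.csq_map_cmp (show pr₁ A B ⋙ F = prodMap F (𝟭 B) ⋙ pr₁ A' B from rfl)
    (show prodMap (𝟭 A') G ⋙ pr₁ A' B' = pr₁ A' B from rfl)
    (show prodMap F (𝟭 B) ⋙ prodMap (𝟭 A') G = prodMap F G from rfl) rfl W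
  have s₂ := V.cmp_map_csq (show prodMap F (𝟭 B) ⋙ pr₂ A' B = pr₂ A B from rfl)
    (show pr₂ A' B ⋙ G = prodMap (𝟭 A') G ⋙ pr₂ A' B' from rfl)
    (show prodMap F (𝟭 B) ⋙ prodMap (𝟭 A') G = prodMap F G from rfl) rfl W'
  refine cast (congrArg (V.IsLeftKan _) ?_) h
  rw [← Category.assoc]
  refine ((Iso.comp_inv_eq _).2 ?_)
  have e₁ : ((V.pull (pr₁ A B)).map η ≫
        (V.csq (show pr₁ A B ⋙ F = prodMap F (𝟭 B) ⋙ pr₁ A' B from rfl) W).hom) ≫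
      (V.pull (prodMap F (𝟭 B))).map
        (V.cmp (show prodMap (𝟭 A') G ⋙ pr₁ A' B' = pr₁ A' B from rfl) W).hom = _ :=
    (Category.assoc _ _ _).trans (congrArg (_ ≫ ·) s₁)
  have e₂ : (V.cmp (show prodMap F (𝟭 B) ⋙ pr₂ A' B = pr₂ A B from rfl) Z').hom ≫
      (V.pull (prodMap F (𝟭 B))).map ((V.pull (pr₂ A' B)).map η' ≫
        (V.csq (show pr₂ A' B ⋙ G = prodMap (𝟭 A') G ⋙ pr₂ A' B' from rfl) W').hom) =
      (V.pull (pr₂ A B)).map η' ≫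
        (V.csq (show pr₂ A B ⋙ G = prodMap F G ⋙ pr₂ A' B' from rfl) W').hom ≫
        (V.cmp (show prodMap F (𝟭 B) ⋙ prodMap (𝟭 A') G = prodMap F G from rfl) _).hom := by
    rw [Functor.map_comp, ← reassoc_of% V.cmp_nat, s₂]
  rw [extPull_hom, extMap]
  exact tensor_map_comp (V.pull (prodMap F (𝟭 B))) t e₁ e₂

theorem extMap_extPull {A' B' : Grpd.{u, u}} (F : A ⥤ A')
    (G : B ⥤ B') {Z : V.obj A} {W : V.obj A'} (η : Z ⟶ (V.pull F).obj W)
    {Z' : V.obj B} {W' : V.obj B'} (η' : Z' ⟶ (V.pull G).obj W') :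
    V.extMap η η' ≫ (V.extPull F G W W').hom =
      (((V.pull (pr₁ A B)).map η ≫
        (V.csq (show pr₁ A B ⋙ F = prodMap F G ⋙ pr₁ A' B' from rfl) W).hom) ⊗ₘ
      ((V.pull (pr₂ A B)).map η' ≫
        (V.csq (show pr₂ A B ⋙ G = prodMap F G ⋙ pr₂ A' B' from rfl) W').hom)) ≫
      μ (V.pull (prodMap F G)) ((V.pull (pr₁ A' B')).obj W) ((V.pull (pr₂ A' B')).obj W') := by
  rw [extPull_hom]
  exact tensorHom_comp_tensorHom_assoc _ _ _ _ _

/-- The shape of the computation in `Fam.Hom.isLeftKan_mul`: for a square of monoidal functors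
`L ⋙ G`, `Q ⋙ T` related by monoidal comparison morphisms `c`, `cx`, `cy`, the comparison of a tensor
product of morphisms is computed factor by factor. -/
theorem tensor_square {C₁ C₂ C₃ C₄ : Type*} [Category* C₁] [Category* C₂] [Category* C₃]
    [Category* C₄] [MonoidalCategory C₁] [MonoidalCategory C₂] [MonoidalCategory C₃]
    [MonoidalCategory C₄] (G : C₂ ⥤ C₁) (L : C₄ ⥤ C₂) (T : C₃ ⥤ C₁) (Q : C₄ ⥤ C₃)
    [G.LaxMonoidal] [L.LaxMonoidal] [T.LaxMonoidal] [Q.LaxMonoidal] {X Y : C₄}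
    {c : G.obj (L.obj (X ⊗ Y)) ⟶ T.obj (Q.obj (X ⊗ Y))} {cx : G.obj (L.obj X) ⟶ T.obj (Q.obj X)}
    {cy : G.obj (L.obj Y) ⟶ T.obj (Q.obj Y)}
    (h : μ G _ _ ≫ G.map (μ L X Y) ≫ c = (cx ⊗ₘ cy) ≫ μ T _ _ ≫ T.map (μ Q X Y))
    {P P' : C₂} {p : P ⟶ L.obj X} {p' : P' ⟶ L.obj Y} {R R' : C₁} {k : R ⟶ G.obj P}
    {k' : R' ⟶ G.obj P'} {S S' B : C₃} {q : S ⟶ Q.obj X} {q' : S' ⟶ Q.obj Y} {w : R ⟶ T.obj S}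
    {w' : R' ⟶ T.obj S'} {m : Q.obj (X ⊗ Y) ⟶ B} {b : S ⊗ S' ⟶ B}
    (h₁ : k ≫ G.map p ≫ cx = w ≫ T.map q) (h₂ : k' ≫ G.map p' ≫ cy = w' ≫ T.map q')
    (h₃ : ((q ⊗ₘ q') ≫ μ Q X Y) ≫ m = b) :
    ((k ⊗ₘ k') ≫ μ G _ _) ≫ (G.map ((p ⊗ₘ p') ≫ μ L X Y) ≫ c) ≫ T.map m =
      (w ⊗ₘ w') ≫ μ T _ _ ≫ T.map b := by
  rw [← h₃]
  simp only [Category.assoc, Functor.map_comp]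
  rw [← Functor.LaxMonoidal.μ_natural_assoc, reassoc_of% h, ← Functor.LaxMonoidal.μ_natural_assoc]
  simp only [tensorHom_comp_tensorHom_assoc, h₁, h₂]

end Kan

section Families

variable {I : Type} [Preorder I] {P : I → I → Prop} {D' D : IvlSys.{u} P}

/-- The functor to a product of groupoids with the given components. -/
abbrev prodLift {A B C : Grpd.{u, u}} (F : A ⥤ B) (G : A ⥤ C) : A ⥤ prodGrpd B C := F.prod' G

/-- A strictly commutative square of groupoids is 2-Cartesian. -/
def IsCartSq {A B C E : Grpd.{u, u}} {F : B ⥤ E} {G : C ⥤ E} {H : A ⥤ B} {K : A ⥤ C}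
    (e : H ⋙ F = K ⋙ G) : Prop :=
  ((CategoricalPullback.CatCommSqOver.toFunctorToCategoricalPullback F G A).obj
    { fst := H, snd := K, iso := eqToIso e }).IsEquivalence

/-- The square of groupoids which compares the values of a transformation of interval systems on
`[x, z]` and on `[x, y]`, `[y, z]`. -/
theorem _root_.Hall.IvlSys.Hom.square (T : IvlSys.Hom D' D) {x y z : I} (hxy : P x y) (hyz : P y z)
    (hxz : P x z) :
    prodLift (D'.r hxy hxz le_rfl (D'.le hyz)) (D'.r hyz hxz (D'.le hxy) le_rfl) ⋙
        prodMap (T.F hxy) (T.F hyz) =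
      T.F hxz ⋙ prodLift (D.r hxy hxz le_rfl (D.le hyz)) (D.r hyz hxz (D.le hxy) le_rfl) := by
  have h₁ := T.nat hxy hxz le_rfl (D.le hyz)
  have h₂ := T.nat hyz hxz (D.le hxy) le_rfl
  exact congrArg₂ (fun (F : D'.D hxz ⥤ D.D hxy) (G : D'.D hxz ⥤ D.D hyz) => F.prod' G) h₁ h₂

/-- A component of a morphism of families is a left Kan extension if the components on two
complementary subintervals are and the corresponding square of groupoids is 2-Cartesian.  Indeed,
up to the multiplication isomorphisms it is the base change along this square of the external
product of the two components. -/
theorem Fam.Hom.isLeftKan_mul (hV : V.IsLeftDerivator) (hV' : V.IsComponentwiseCocontinuous)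
    {T : IvlSys.Hom D' D} {A : V.Fam D'} {B : V.Fam D} (φ : Fam.Hom A (B.pull T)) {x y z : I}
    (hxy : P x y) (hyz : P y z) (hxz : P x z) (hT : IsCartSq (T.square hxy hyz hxz))
    (h₁ : V.IsLeftKan (W := B.val hxy) (T.F hxy) (φ.app hxy))
    (h₂ : V.IsLeftKan (W := B.val hyz) (T.F hyz) (φ.app hyz)) :
    V.IsLeftKan (W := B.val hxz) (T.F hxz) (φ.app hxz) := by
  have k := hV.baseChange _ hT _ (ext_isLeftKan hV' _ _ h₁ h₂)
  rw [baseChange_eqToIso, extMap_extPull] at k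
  let Q' : D'.D hxz ⥤ prodGrpd (D'.D hxy) (D'.D hyz) :=
    prodLift (D'.r hxy hxz le_rfl (D'.le hyz)) (D'.r hyz hxz (D'.le hxy) le_rfl)
  let Q : D.D hxz ⥤ prodGrpd (D.D hxy) (D.D hyz) :=
    prodLift (D.r hxy hxz le_rfl (D.le hyz)) (D.r hyz hxz (D.le hxy) le_rfl)
  let b := ((V.cmp (show Q ⋙ pr₁ _ _ = D.r hxy hxz le_rfl (D.le hyz) from rfl) (B.val hxy)) ⊗ᵢ
    (V.cmp (show Q ⋙ pr₂ _ _ = D.r hyz hxz (D.le hxy) le_rfl from rfl) (B.val hyz))) ≪≫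
    Functor.Monoidal.μIso (V.pull Q) _ _
  let a := ((V.cmp (show Q' ⋙ pr₁ _ _ = D'.r hxy hxz le_rfl (D'.le hyz) from rfl) (A.val hxy)) ⊗ᵢ
    (V.cmp (show Q' ⋙ pr₂ _ _ = D'.r hyz hxz (D'.le hxy) le_rfl from rfl) (A.val hyz))) ≪≫
    Functor.Monoidal.μIso (V.pull Q') _ _
  have t := V.csq_tensor (T.square hxy hyz hxz) ((V.pull (pr₁ _ _)).obj (B.val hxy))
    ((V.pull (pr₂ _ _)).obj (B.val hyz))
  have c₁ := V.cmp_map_csq_csq (show Q' ⋙ pr₁ _ _ = D'.r hxy hxz le_rfl (D'.le hyz) from rfl)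
    (show pr₁ _ _ ⋙ T.F hxy = prodMap (T.F hxy) (T.F hyz) ⋙ pr₁ _ _ from rfl)
    (T.square hxy hyz hxz) (show Q ⋙ pr₁ _ _ = D.r hxy hxz le_rfl (D.le hyz) from rfl)
    (T.nat _ _ _ _) (B.val hxy)
  have c₂ := V.cmp_map_csq_csq (show Q' ⋙ pr₂ _ _ = D'.r hyz hxz (D'.le hxy) le_rfl from rfl)
    (show pr₂ _ _ ⋙ T.F hyz = prodMap (T.F hxy) (T.F hyz) ⋙ pr₂ _ _ from rfl)
    (T.square hxy hyz hxz) (show Q ⋙ pr₂ _ _ = D.r hyz hxz (D.le hxy) le_rfl from rfl)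
    (T.nat _ _ _ _) (B.val hyz)
  have d₁ : (V.cmp (show Q' ⋙ pr₁ _ _ = D'.r hxy hxz le_rfl (D'.le hyz) from rfl) _).hom ≫
      (V.pull Q').map ((V.pull (pr₁ _ _)).map (φ.app hxy) ≫
        (V.csq (show pr₁ _ _ ⋙ T.F hxy = prodMap (T.F hxy) (T.F hyz) ⋙ pr₁ _ _ from rfl) _).hom) ≫
      (V.csq (T.square hxy hyz hxz) _).hom =
      ((V.pull (D'.r hxy hxz le_rfl (D'.le hyz))).map (φ.app hxy) ≫
        (V.csq (T.nat hxy hxz le_rfl (D'.le hyz)) (B.val hxy)).hom) ≫ (V.pull (T.F hxz)).map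
        (V.cmp (show Q ⋙ pr₁ _ _ = D.r hxy hxz le_rfl (D.le hyz) from rfl) (B.val hxy)).hom := by
    rw [Functor.map_comp, Category.assoc, ← reassoc_of% V.cmp_nat, Category.assoc, ← c₁]
  have d₂ : (V.cmp (show Q' ⋙ pr₂ _ _ = D'.r hyz hxz (D'.le hxy) le_rfl from rfl) _).hom ≫
      (V.pull Q').map ((V.pull (pr₂ _ _)).map (φ.app hyz) ≫
        (V.csq (show pr₂ _ _ ⋙ T.F hyz = prodMap (T.F hxy) (T.F hyz) ⋙ pr₂ _ _ from rfl) _).hom) ≫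
      (V.csq (T.square hxy hyz hxz) _).hom =
      ((V.pull (D'.r hyz hxz (D'.le hxy) le_rfl)).map (φ.app hyz) ≫
        (V.csq (T.nat hyz hxz (D'.le hxy) le_rfl) (B.val hyz)).hom) ≫ (V.pull (T.F hxz)).map
        (V.cmp (show Q ⋙ pr₂ _ _ = D.r hyz hxz (D.le hxy) le_rfl from rfl) (B.val hyz)).hom := by
    rw [Functor.map_comp, Category.assoc, ← reassoc_of% V.cmp_nat, Category.assoc, ← c₂]
  have key := tensor_square (V.pull Q') (V.pull (prodMap (T.F hxy) (T.F hyz))) (V.pull (T.F hxz))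
    (V.pull Q) t d₁ d₂ (m := b.inv ≫ (B.mul hxy hyz hxz).hom) (b.hom_inv_id_assoc _)
  have l := k.of_iso ((A.mul hxy hyz hxz).symm ≪≫ a) (b.symm ≪≫ B.mul hxy hyz hxz)
  refine cast (congrArg (V.IsLeftKan _) ?_) l
  refine (Category.assoc _ _ _).trans
    ((congrArg (fun t => (A.mul hxy hyz hxz).inv ≫ t) key).trans ?_)
  rw [Iso.inv_comp_eq, φ.mul]
  change _ = _ ≫ (Fam.pullMul T B hxy hyz hxz).hom
  simp only [Fam.pullMul, Iso.trans_hom, tensorIso_hom, Functor.Monoidal.μIso_hom,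
    Functor.mapIso_hom, tensorHom_comp_tensorHom_assoc]

/-- On a point a morphism of families is an isomorphism between units, hence a left Kan extension
along an equivalence. -/
theorem Fam.Hom.isLeftKan_one {T : IvlSys.Hom D' D} {A : V.Fam D'} {B : V.Fam D}
    (φ : Fam.Hom A (B.pull T)) {x : I} (h : P x x) [(T.F h).IsEquivalence] :
    V.IsLeftKan (W := B.val h) (T.F h) (φ.app h) := by
  have : φ.app h = (A.one h).inv ≫ ((B.pull T).one h).hom := by rw [Iso.eq_inv_comp, φ.one]
  have : IsIso (φ.app h) := by rw [this]; infer_instance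
  exact isLeftKan_of_isIso _ _

/-- A morphism of families consists of left Kan extensions if its components on the edges are left
Kan extensions, provided that the relevant squares are 2-Cartesian. -/
theorem Fam.Hom.isLeftKan_of_edges (hV : V.IsLeftDerivator) (hV' : V.IsComponentwiseCocontinuous)
    {n : ℕ} {P : Fin (n + 1) → Fin (n + 1) → Prop} {D' D : IvlSys.{u} P}
    (hP : ∀ x y, x < y → P x y)
    {T : IvlSys.Hom D' D} {A : V.Fam D'} {B : V.Fam D} (φ : Fam.Hom A (B.pull T))
    (hT : ∀ {x y z : Fin (n + 1)} (hxy : P x y) (hyz : P y z) (hxz : P x z),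
      IsCartSq (T.square hxy hyz hxz))
    (hT' : ∀ {x : Fin (n + 1)} (h : P x x), (T.F h).IsEquivalence)
    (hφ : ∀ (i : Fin n) (h : P i.castSucc i.succ), V.IsLeftKan (W := B.val h) (T.F h) (φ.app h))
    {x y : Fin (n + 1)} (h : P x y) : V.IsLeftKan (W := B.val h) (T.F h) (φ.app h) := by
  have key : ∀ (k : ℕ) (x y : Fin (n + 1)) (h : P x y), (y : ℕ) = x + k →
      V.IsLeftKan (W := B.val h) (T.F h) (φ.app h) := by
    intro k
    induction k with
    | zero =>
      intro x y hxy e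
      obtain rfl : x = y := Fin.ext e.symm
      have := hT' hxy
      exact φ.isLeftKan_one hxy
    | succ k ih =>
      intro x y hxy e
      have hi : (x : ℕ) + k < n := by have := y.2; omega
      let i : Fin n := ⟨x + k, hi⟩
      obtain rfl : y = i.succ := Fin.ext e
      rcases Nat.eq_zero_or_pos k with rfl | hk
      · have hx : x = i.castSucc := rfl
        clear_value i
        subst hx
        exact hφ i hxy
      · have h₁ := hP x i.castSucc (Fin.lt_def.2 (by simp [i, hk]))
        have h₂ := hP _ _ i.castSucc_lt_succ
        exact φ.isLeftKan_mul hV hV' h₁ h₂ hxy (hT _ _ _) (ih x _ h₁ rfl) (hφ i h₂)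
  exact key (y - x) x y h (by have := D'.le h; rw [Fin.le_def] at this; omega)

end Families

end MonoidalPrederivator

/-! ### Families of 2-Cartesian squares of groupoids -/

section CartFam

variable {A C : Grpd.{u, u}} {ι κ : Type} {B D : ι → Grpd.{u, u}}

/-- The squares `A ⥤ B i`, `A ⥤ C` over `D i` exhibit `A` as the 2-fibre product of `C` and
`∏ᵢ B i` over `∏ᵢ D i`: the comparison functor is faithful, full and essentially surjective. -/
structure IsCartFam (H : ∀ i, A ⥤ B i) (K : A ⥤ C) (F : ∀ i, B i ⥤ D i) (G : ∀ i, C ⥤ D i)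
    (e : ∀ i, H i ⋙ F i ≅ K ⋙ G i) : Prop where
  faithful : ∀ {a a' : A} {p q : a ⟶ a'}, (∀ i, (H i).map p = (H i).map q) →
    K.map p = K.map q → p = q
  full : ∀ {a a' : A} (b : ∀ i, (H i).obj a ⟶ (H i).obj a') (c : K.obj a ⟶ K.obj a'),
    (∀ i, (F i).map (b i) ≫ (e i).hom.app a' = (e i).hom.app a ≫ (G i).map c) →
    ∃ p : a ⟶ a', K.map p = c ∧ ∀ i, (H i).map p = b i
  es : ∀ (b : ∀ i, B i) (c : C) (θ : ∀ i, (F i).obj (b i) ⟶ (G i).obj c),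
    ∃ (a : A) (γ : K.obj a ⟶ c), ∀ i, ∃ β : (H i).obj a ⟶ b i,
      (F i).map β ≫ θ i = (e i).hom.app a ≫ (G i).map γ

variable {H : ∀ i, A ⥤ B i} {K : A ⥤ C} {F : ∀ i, B i ⥤ D i} {G : ∀ i, C ⥤ D i}
  {e : ∀ i, H i ⋙ F i ≅ K ⋙ G i}

/-- A 2-Cartesian square over a product of groupoids, as a family of squares over its factors.  The
two legs are exchanged, so that the isomorphisms `e i` are inverse to the components of `j`. -/
theorem IsCartFam.of_isEquivalence
    (j : K ⋙ Functor.pi' G ≅ Functor.pi' H ⋙ Functor.pi F)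
    (h : ((CategoricalPullback.CatCommSqOver.toFunctorToCategoricalPullback
      (Functor.pi' G) (Functor.pi F) A).obj { fst := K, snd := Functor.pi' H, iso := j }).IsEquivalence)
    (hj : ∀ a i, (e i).hom.app a = j.inv.app a i) : IsCartFam H K F G e := by
  have hj' : ∀ a i, j.hom.app a i ≫ (e i).hom.app a = 𝟙 _ := fun a i => by
    rw [hj]
    exact congrFun (j.hom_inv_id_app a) i
  have hj'' : ∀ a i, (e i).hom.app a ≫ j.hom.app a i = 𝟙 _ := fun a i => by
    rw [hj]
    exact congrFun (j.inv_hom_id_app a) i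
  have aux : ∀ {T : Type u} [Groupoid.{u} T] {x y x' y' : T} {f : x ⟶ x'} {g : y ⟶ y'} {s : x ⟶ y}
      {s' : x' ⟶ y'} {t : y ⟶ x} {t' : y' ⟶ x'}, t ≫ s = 𝟙 y → s' ≫ t' = 𝟙 x' → f ≫ s' = s ≫ g →
      g ≫ t' = t ≫ f := by
    intro T _ x y x' y' f g s s' t t' h₁ h₂ h₃
    rw [← Category.id_comp g, ← h₁, Category.assoc, Category.assoc, ← reassoc_of% h₃, h₂,
      Category.comp_id]
  have aux' : ∀ {T : Type u} [Groupoid.{u} T] {x y x' y' : T} {f : x ⟶ x'} {g : y ⟶ y'} {s : x ⟶ y}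
      {θ : x' ⟶ y'} {t : y ⟶ x}, s ≫ t = 𝟙 x → g ≫ Groupoid.inv θ = t ≫ f → f ≫ θ = s ≫ g := by
    intro T _ x y x' y' f g s θ t h₁ h₂
    rw [← Category.id_comp f, ← h₁, Category.assoc, Category.assoc, ← reassoc_of% h₂]
    simp
  set Θ := (CategoricalPullback.CatCommSqOver.toFunctorToCategoricalPullback
      (Functor.pi' G) (Functor.pi F) A).obj { fst := K, snd := Functor.pi' H, iso := j } with hΘ
  constructor
  · intro a a' p q h₁ h₂
    apply Θ.map_injective
    apply CategoricalPullback.hom_ext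
    · exact h₂
    · funext i
      exact h₁ i
  · intro a a' b c hbc
    obtain ⟨p, hp⟩ := Θ.map_surjective (X := a) (Y := a') (CategoricalPullback.Hom.mk c b (by
      funext i
      change (G i).map c ≫ j.hom.app a' i = j.hom.app a i ≫ (F i).map (b i)
      exact aux (hj' a i) (hj'' a' i) (hbc i)))
    exact ⟨p, congrArg CategoricalPullback.Hom.fst hp,
      fun i => congrFun (congrArg CategoricalPullback.Hom.snd hp) i⟩
  · intro b c θ
    let y : CategoricalPullback (Functor.pi' G) (Functor.pi F) :=
      { fst := c
        snd := b
        iso := Pi.isoMk fun i => (Groupoid.isoEquivHom _ _).symm (Groupoid.inv (θ i)) }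
    let w := Θ.objObjPreimageIso y
    refine ⟨Θ.objPreimage y, w.hom.fst, fun i => ⟨w.hom.snd i, ?_⟩⟩
    have h₁ : (G i).map w.hom.fst ≫ Groupoid.inv (θ i) =
        j.hom.app _ i ≫ (F i).map (w.hom.snd i) := congrFun w.hom.w i
    exact aux' (hj'' _ i) h₁

/-- Cartesianness may be tested after reindexing along a surjection and composing with fully
faithful functors. -/
theorem IsCartFam.of_surjective {ρ : κ → ι} (hρ : Function.Surjective ρ)
    {B' D' : κ → Grpd.{u, u}} {H' : ∀ k, A ⥤ B' k} {F' : ∀ k, B' k ⥤ D' k} {G' : ∀ k, C ⥤ D' k}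
    {e' : ∀ k, H' k ⋙ F' k ≅ K ⋙ G' k} (h : IsCartFam H' K F' G' e') (E : ∀ k, B (ρ k) ⥤ B' k)
    (E' : ∀ k, D (ρ k) ⥤ D' k) [∀ k, (E k).Full] [∀ k, (E k).Faithful] [∀ k, (E' k).Faithful]
    (jH : ∀ k, H (ρ k) ⋙ E k ≅ H' k) (jG : ∀ k, G (ρ k) ⋙ E' k ≅ G' k)
    (jF : ∀ k, E k ⋙ F' k ≅ F (ρ k) ⋙ E' k)
    (hj : ∀ k a, (F' k).map ((jH k).hom.app a) ≫ (e' k).hom.app a =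
      (jF k).hom.app ((H (ρ k)).obj a) ≫ (E' k).map ((e (ρ k)).hom.app a) ≫
        (jG k).hom.app (K.obj a)) :
    IsCartFam H K F G e := by
  constructor
  · intro a a' p q h₁ h₂
    refine h.faithful (fun k => ?_) h₂
    rw [← cancel_epi ((jH k).hom.app a), ← NatTrans.naturality, ← NatTrans.naturality]
    simp only [Functor.comp_map, h₁]
  · intro a a' b c hbc
    obtain ⟨p, hp, hp'⟩ := h.full
      (fun k => (jH k).inv.app a ≫ (E k).map (b (ρ k)) ≫ (jH k).hom.app a') c (fun k => by
        simp only [Functor.map_comp, Category.assoc]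
        rw [hj k a']
        have n := (jF k).hom.naturality (b (ρ k))
        simp only [Functor.comp_map] at n
        rw [reassoc_of% n, ← Functor.map_comp_assoc, hbc, Functor.map_comp, Category.assoc]
        have n' := (jG k).hom.naturality c
        simp only [Functor.comp_map] at n'
        rw [n', ← reassoc_of% hj k a, ← Functor.map_comp_assoc]
        simp)
    refine ⟨p, hp, fun i => ?_⟩
    obtain ⟨k, rfl⟩ := hρ i
    apply (E k).map_injective
    have n := (jH k).hom.naturality p
    simp only [Functor.comp_map, hp', Iso.hom_inv_id_app_assoc] at n
    exact (cancel_mono _).1 n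
  · intro b c θ
    obtain ⟨a, γ, hγ⟩ := h.es (fun k => (E k).obj (b (ρ k))) c
      (fun k => (jF k).hom.app _ ≫ (E' k).map (θ (ρ k)) ≫ (jG k).hom.app c)
    refine ⟨a, γ, fun i => ?_⟩
    obtain ⟨k, rfl⟩ := hρ i
    obtain ⟨β, hβ⟩ := hγ k
    refine ⟨(E k).preimage ((jH k).hom.app a ≫ β), (E' k).map_injective ?_⟩
    have n := (jF k).hom.naturality ((E k).preimage ((jH k).hom.app a ≫ β))
    have n' := (jG k).hom.naturality γ
    simp only [Functor.comp_map, Functor.map_preimage, Functor.map_comp, Category.assoc] at n n'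
    rw [← cancel_epi ((jF k).hom.app _), ← cancel_mono ((jG k).hom.app c)]
    simp only [Functor.map_comp, Category.assoc]
    rw [← reassoc_of% n, hβ, n', reassoc_of% hj k a]

/-- If `A` is the 2-fibre product of a family of squares which decomposes into subfamilies having
2-fibre products `B s` of their own, then `A` is the 2-fibre product of the `B s`. -/
theorem IsCartFam.of_sigma {σ : Type} {ι : σ → Type} {B D : σ → Grpd.{u, u}}
    {E E' : ∀ s, ι s → Grpd.{u, u}} {R' : ∀ s, A ⥤ B s} {Ks : ∀ s, B s ⥤ D s} {R : ∀ s, C ⥤ D s}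
    {n : ∀ s, R' s ⋙ Ks s ≅ K ⋙ R s} {H : ∀ s i, B s ⥤ E s i} {F : ∀ s i, E s i ⥤ E' s i}
    {G : ∀ s i, D s ⥤ E' s i} {e : ∀ s i, H s i ⋙ F s i ≅ Ks s ⋙ G s i}
    {e₀ : ∀ p : Σ s, ι s, (R' p.1 ⋙ H p.1 p.2) ⋙ F p.1 p.2 ≅ K ⋙ (R p.1 ⋙ G p.1 p.2)}
    (h₀ : IsCartFam (fun p : Σ s, ι s => R' p.1 ⋙ H p.1 p.2) K (fun p => F p.1 p.2)
      (fun p => R p.1 ⋙ G p.1 p.2) e₀)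
    (h : ∀ s, IsCartFam (H s) (Ks s) (F s) (G s) (e s))
    (he : ∀ s i a, (e₀ ⟨s, i⟩).hom.app a =
      (e s i).hom.app ((R' s).obj a) ≫ (G s i).map ((n s).hom.app a)) :
    IsCartFam R' K Ks R n := by
  have nat : ∀ s {a a' : A} (p : a ⟶ a'), (Ks s).map ((R' s).map p) ≫ (n s).hom.app a' =
      (n s).hom.app a ≫ (R s).map (K.map p) := fun s _ _ p => (n s).hom.naturality p
  constructor
  · intro a a' p q h₁ h₂
    exact h₀.faithful (fun i => congrArg (H i.1 i.2).map (h₁ i.1)) h₂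
  · intro a a' b c hbc
    obtain ⟨p, hp, hp'⟩ := h₀.full (fun i => (H i.1 i.2).map (b i.1)) c (fun i => by
      rw [he, he]
      have n := (e i.1 i.2).hom.naturality (b i.1)
      simp only [Functor.comp_map] at n ⊢
      rw [reassoc_of% n, ← Functor.map_comp, hbc, Functor.map_comp, Category.assoc])
    refine ⟨p, hp, fun s => (h s).faithful (fun i => hp' ⟨s, i⟩) ?_⟩
    rw [← cancel_mono ((n s).hom.app a'), nat, hbc, hp]
  · intro b c θ
    obtain ⟨a, γ, hγ⟩ := h₀.es (fun i => (H i.1 i.2).obj (b i.1)) c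
      (fun i => (e i.1 i.2).hom.app (b i.1) ≫ (G i.1 i.2).map (θ i.1))
    refine ⟨a, γ, fun s => ?_⟩
    have hγ' := fun i => hγ ⟨s, i⟩
    choose β hβ using hγ'
    obtain ⟨q, hq, -⟩ := (h s).full (a := (R' s).obj a) (a' := b s) β
      ((n s).hom.app a ≫ (R s).map γ ≫ Groupoid.inv (θ s)) (fun i => by
        have := hβ i
        dsimp only at this
        rw [← cancel_mono ((G s i).map (θ s)), Category.assoc, this, he]
        simp only [Category.assoc, ← Functor.map_comp, Functor.comp_map, Groupoid.inv_comp,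
          Category.comp_id])
    exact ⟨q, by rw [hq]; simp⟩

/-- A family of two squares, as a square over the product of two groupoids. -/
theorem isCartSq_of_isCartFam {B D : Bool → Grpd.{u, u}} {H : ∀ s, A ⥤ B s} {F : ∀ s, B s ⥤ D s}
    {G : ∀ s, C ⥤ D s} (n : ∀ s, H s ⋙ F s = K ⋙ G s)
    (h : IsCartFam H K F G fun s => eqToIso (n s))
    (e : MonoidalPrederivator.prodLift (H false) (H true) ⋙
      MonoidalPrederivator.prodMap (F false) (F true) =
      K ⋙ MonoidalPrederivator.prodLift (G false) (G true)) :
    MonoidalPrederivator.IsCartSq e := by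
  have e₁ : ∀ a, ((eqToIso e).hom.app a).1 = (eqToIso (n false)).hom.app a := by
    intro a
    rw [eqToIso.hom, eqToIso.hom, eqToHom_app, eqToHom_app]
    exact CategoryTheory.eqToHom_fst _
  have e₂ : ∀ a, ((eqToIso e).hom.app a).2 = (eqToIso (n true)).hom.app a := by
    intro a
    rw [eqToIso.hom, eqToIso.hom, eqToHom_app, eqToHom_app]
    exact CategoryTheory.eqToHom_snd _
  refine @Functor.IsEquivalence.mk _ _ _ _ _ ⟨?_⟩ ⟨?_⟩ ⟨?_⟩
  · intro a a' p q hpq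
    refine h.faithful (fun s => ?_) (congrArg CategoricalPullback.Hom.snd hpq)
    cases s
    · exact congrArg Prod.fst (congrArg CategoricalPullback.Hom.fst hpq)
    · exact congrArg Prod.snd (congrArg CategoricalPullback.Hom.fst hpq)
  · intro a a' g
    have w₁ := congrArg Prod.fst g.w
    have w₂ := congrArg Prod.snd g.w
    obtain ⟨p, hp, hp'⟩ := h.full (a := a) (a' := a')
      (fun s => match s with
        | false => g.fst.1
        | true => g.fst.2) g.snd (fun s => by
        cases s
        · rw [← e₁, ← e₁]
          exact w₁
        · rw [← e₂, ← e₂]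
          exact w₂)
    refine ⟨p, CategoricalPullback.hom_ext (Prod.ext ?_ ?_) hp⟩
    · exact hp' false
    · exact hp' true
  · intro y
    obtain ⟨a, γ, hγ⟩ := h.es (fun s => match s with
        | false => y.fst.1
        | true => y.fst.2) y.snd (fun s => match s with
        | false => y.iso.hom.1
        | true => y.iso.hom.2)
    obtain ⟨β₁, h₁⟩ := hγ false
    obtain ⟨β₂, h₂⟩ := hγ true
    rw [← e₁] at h₁
    rw [← e₂] at h₂
    refine ⟨a, ⟨CategoricalPullback.mkIso (Iso.prod ((Groupoid.isoEquivHom _ _).symm β₁)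
      ((Groupoid.isoEquivHom _ _).symm β₂)) ((Groupoid.isoEquivHom _ _).symm γ) (Prod.ext ?_ ?_)⟩⟩
    · exact h₁
    · exact h₂

/-- For the empty family being 2-Cartesian means that `A ⥤ C` is an equivalence. -/
theorem isEquivalence_of_isCartFam [IsEmpty ι] (h : IsCartFam H K F G e) : K.IsEquivalence where
  faithful := ⟨fun {_ _ p q} hpq => h.faithful (fun i => isEmptyElim i) hpq⟩
  full := ⟨fun {_ _} c => (h.full (fun i => isEmptyElim i) c fun i => isEmptyElim i).imp fun _ => And.left⟩
  essSurj := ⟨fun c => by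
    obtain ⟨a, γ, -⟩ := h.es (fun i => isEmptyElim i) c fun i => isEmptyElim i
    exact ⟨a, ⟨(Groupoid.isoEquivHom _ _).symm γ⟩⟩⟩

end CartFam

open SimplexSubcategory

variable {S : SimplexSubcategory.{s}}

/-! ### The squares of a 2-Segal functor -/

namespace SimplexSubcategory.IsIntervalInclusion

variable {J N : S.Obj} {j : J ⟶ N} {x y : S.El N}

theorem le_iff (hj : IsIntervalInclusion j x y) {a b : S.El J} : j.1 a ≤ j.1 b ↔ a ≤ b :=
  hj.1.le_iff_le

theorem mem (hj : IsIntervalInclusion j x y) (a : S.El J) : x ≤ j.1 a ∧ j.1 a ≤ y := by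
  have : j.1 a ∈ Set.Icc x y := hj.2.1 ▸ Set.mem_range_self a
  exact this

theorem exists_eq (hj : IsIntervalInclusion j x y) {z : S.El N} (hx : x ≤ z) (hy : z ≤ y) :
    ∃ a, j.1 a = z := by
  have : z ∈ Set.range j.1 := hj.2.1 ▸ ⟨hx, hy⟩
  exact this

theorem le (hj : IsIntervalInclusion j x y) : x ≤ y := (hj.mem 0).1.trans (hj.mem 0).2

theorem map_zero (hj : IsIntervalInclusion j x y) : j.1 0 = x := by
  obtain ⟨a, ha⟩ := hj.exists_eq le_rfl hj.le
  exact le_antisymm (ha ▸ j.1.monotone (Fin.zero_le a)) (hj.mem 0).1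

theorem map_last (hj : IsIntervalInclusion j x y) : j.1 (Fin.last _) = y := by
  obtain ⟨a, ha⟩ := hj.exists_eq hj.le le_rfl
  exact le_antisymm (hj.mem _).2 (ha ▸ j.1.monotone (Fin.le_last a))

theorem map_succ (hj : IsIntervalInclusion j x y) (k : Fin (S.len J)) :
    (j.1 k.succ : ℕ) = j.1 k.castSucc + 1 := by
  have h₁ : j.1 k.castSucc < j.1 k.succ := hj.1 k.castSucc_lt_succ
  by_contra h₂
  have h₃ : (j.1 k.castSucc : ℕ) + 1 < j.1 k.succ := by
    have := Fin.lt_def.1 h₁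
    omega
  obtain ⟨a, ha⟩ := hj.exists_eq (z := ⟨j.1 k.castSucc + 1, h₃.trans (j.1 k.succ).2⟩)
    ((hj.mem k.castSucc).1.trans (Fin.le_def.2 (Nat.le_succ _)))
    ((Fin.le_def.2 h₃.le).trans (hj.mem k.succ).2)
  have h₄ : k.castSucc < a := hj.1.lt_iff_lt.1 (by rw [ha]; exact Fin.lt_def.2 (Nat.lt_succ_self _))
  have h₅ : a < k.succ := hj.1.lt_iff_lt.1 (by rw [ha]; exact Fin.lt_def.2 h₃)
  simp only [Fin.lt_def, Fin.val_castSucc, Fin.val_succ] at h₄ h₅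
  omega

/-- The edge of `N` onto which an interval inclusion maps an edge of `J`. -/
theorem exists_edge (hj : IsIntervalInclusion j x y) (k : Fin (S.len J)) :
    ∃ i : Fin (S.len N), j.1 k.castSucc = i.castSucc ∧ j.1 k.succ = i.succ := by
  have h := hj.map_succ k
  have h' := (j.1 k.succ).2
  exact ⟨⟨j.1 k.castSucc, by omega⟩, rfl, Fin.ext h⟩

theorem exists_edge_eq (hj : IsIntervalInclusion j x y) {i : Fin (S.len N)} (hx : x ≤ i.castSucc)
    (hy : i.succ ≤ y) :
    ∃ k : Fin (S.len J), j.1 k.castSucc = i.castSucc ∧ j.1 k.succ = i.succ := by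
  obtain ⟨a, ha⟩ := hj.exists_eq hx (i.castSucc_lt_succ.le.trans hy)
  obtain ⟨b, hb⟩ := hj.exists_eq (hx.trans i.castSucc_lt_succ.le) hy
  have hab : a < b := hj.1.lt_iff_lt.1 (by rw [ha, hb]; exact i.castSucc_lt_succ)
  have ha' : (a : ℕ) < S.len J := by
    have := b.2
    have := Fin.lt_def.1 hab
    omega
  refine ⟨⟨a, ha'⟩, ha, ?_⟩
  have h := hj.map_succ ⟨a, ha'⟩
  have h' : j.1 (Fin.castSucc ⟨a, ha'⟩) = i.castSucc := ha
  apply Fin.ext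
  rw [h, h']
  rfl

/-- An interval inclusion identifies intervals of `J` with intervals of `N`. -/
theorem isIso_ivlMap (hj : IsIntervalInclusion j x y) {a b : S.El J} {a' b' : S.El N}
    (h : HasInterval J a b) (h' : HasInterval N a' b') (ha : j.1 a = a') (hb : j.1 b = b') :
    IsIso (ivlMap j h h' ha.ge hb.le) := by
  obtain ⟨q, hq⟩ := hj.2.2 (ivlι h') (by
    rintro _ ⟨k, rfl⟩
    exact ⟨(hj.mem a).1.trans (ha.le.trans (ivlι_mem h' k).1),
      (ivlι_mem h' k).2.trans (hb.ge.trans (hj.mem b).2)⟩)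
  have hq' : ∀ k, j.1 (q.1 k) = (ivlι h').1 k := fun k => congrArg (fun g : ivl h' ⟶ N => g.1 k) hq
  obtain ⟨r, hr⟩ := (ivlι_spec h).2.2 q (by
    rintro _ ⟨k, rfl⟩
    constructor
    · rw [← hj.le_iff, hq', ha]
      exact (ivlι_mem h' k).1
    · rw [← hj.le_iff, hq', hb]
      exact (ivlι_mem h' k).2)
  refine ⟨r, ivlι_cancel h ?_, ivlι_cancel h' ?_⟩
  · have : (ivlMap j h h' ha.ge hb.le ≫ r) ≫ ivlι h ≫ j = 𝟙 _ ≫ ivlι h ≫ j := by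
      rw [Category.assoc, reassoc_of% hr, hq, ivlMap_ι, Category.id_comp]
    apply Subtype.ext
    ext k : 2
    exact hj.1.injective (congrArg (fun g : ivl h ⟶ N => g.1 k) this)
  · rw [Category.assoc, ivlMap_ι, reassoc_of% hr, hq, Category.id_comp]

end SimplexSubcategory.IsIntervalInclusion

section TwoSegal

variable (X : S.Objᵒᵖ ⥤ Grpd.{u, u})

theorem res_isEquivalence {M N : S.Obj} (f : M ⟶ N) [IsIso f] : (res X f).IsEquivalence := by
  have h₁ : res X f ⋙ res X (inv f) = 𝟭 _ := by rw [← res_comp, IsIso.inv_hom_id, res_id]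
  have h₂ : res X (inv f) ⋙ res X f = 𝟭 _ := by rw [← res_comp, IsIso.hom_inv_id, res_id]
  exact (CategoryTheory.Equivalence.mk (res X f) (res X (inv f)) (eqToIso h₁.symm)
    (eqToIso h₂)).isEquivalence_functor

/-- The interval system `[x, y] ↦ X_[x, y]` of `N`. -/
noncomputable abbrev sysOf (N : S.Obj) : IvlSys.{u} (HasInterval N) where
  D h := X.obj (op (ivl h))
  le h := h.le
  r h h' hx hy := res X (ivlInc h h' hx hy)
  r_self h := by rw [ivlInc_self, res_id]
  r_comp h h' h'' hx hy hx' hy' := by rw [← res_comp, ivlInc_ivlInc]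

variable (hS : S.IsAdmissible)

/-- The interval system `[x, y] ↦ X_[f x, f y]` of `M`, for `f : M ⟶ N`. -/
noncomputable abbrev sysMap {M N : S.Obj} (f : M ⟶ N) : IvlSys.{u} (HasInterval M) where
  D h := X.obj (op (ivl (hS.map f h)))
  le h := h.le
  r h h' hx hy := res X (ivlInc (hS.map f h) (hS.map f h') (f.1.monotone hx) (f.1.monotone hy))
  r_self h := by rw [ivlInc_self, res_id]
  r_comp h h' h'' hx hy hx' hy' := by rw [← res_comp, ivlInc_ivlInc]

/-- The restriction functors `X_[f x, f y] ⥤ X_[x, y]`, for `f : M ⟶ N`. -/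
noncomputable abbrev sysHom {M N : S.Obj} (f : M ⟶ N) : (sysMap X hS f).Hom (sysOf X M) where
  F h := res X (ivlMap f h (hS.map f h) le_rfl le_rfl)
  nat h h' hx hy := by
    rw [← res_comp, ← res_comp]
    exact congrArg (res X) (ivlMap_ivlInc f h h' _ _ le_rfl le_rfl (f.1.monotone hx) (f.1.monotone hy) hx
      hy le_rfl le_rfl)

variable {X hS}

/-- The 2-Segal condition in terms of the family of squares given by the edges. -/
theorem isCartFam_of_isTwoSegal (hX : IsTwoSegal hS X) {M N : S.Obj} (f : M ⟶ N)
    (h₁ : f.1 0 = 0) (h₂ : f.1 (Fin.last _) = Fin.last _) :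
    IsCartFam (fun i => res X (ivlι (hS.map f (hS.edge M i)))) (res X f)
      (fun i => res X (ivlMap f (hS.edge M i) (hS.map f (hS.edge M i)) le_rfl le_rfl))
      (fun i => res X (ivlι (hS.edge M i)))
      (fun i => eqToIso (by rw [← res_comp, ← res_comp, ivlMap_ι])) :=
  IsCartFam.of_isEquivalence _ (hX f h₁ h₂) (fun a i => by
    rw [eqToIso.hom, eqToIso.inv, eqToHom_app, eqToHom_app]
    symm
    exact Functor.eqToHom_proj _ i)

/-- The 2-Segal condition for the restriction `[x, y] ⟶ [f x, f y]` of a morphism `f : M ⟶ N`,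
expressed by the edges of `M` in `[x, y]`, which `τ` enumerates.  The edges of the object `[x, y]` of
`Δ_S` are only isomorphic to edges of `M`, whence the comparison by means of
`IsCartFam.of_surjective`. -/
theorem isCartFam_interval (hX : IsTwoSegal hS X) {M N : S.Obj} (f : M ⟶ N) {x y : S.El M}
    (h : HasInterval M x y) {κ : Type} {τ : κ → Fin (S.len M)} (hτ : Function.Injective τ)
    (hτ₁ : ∀ k, x ≤ (τ k).castSucc) (hτ₂ : ∀ k, (τ k).succ ≤ y)
    (hτ₃ : ∀ i : Fin (S.len M), x ≤ i.castSucc → i.succ ≤ y → ∃ k, τ k = i)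
    {H : ∀ k, (sysMap X hS f).D h ⥤ (sysMap X hS f).D (hS.edge M (τ k))}
    (hH : ∀ k, H k = (sysMap X hS f).r (hS.edge M (τ k)) h (hτ₁ k) (hτ₂ k))
    {G : ∀ k, (sysOf X M).D h ⥤ (sysOf X M).D (hS.edge M (τ k))}
    (hG : ∀ k, G k = (sysOf X M).r (hS.edge M (τ k)) h (hτ₁ k) (hτ₂ k)) :
    IsCartFam H ((sysHom X hS f).F h) (fun k => (sysHom X hS f).F (hS.edge M (τ k))) G
      (fun k => eqToIso (by rw [hH, hG]; exact (sysHom X hS f).nat _ _ _ _)) := by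
  have i₁ := ivlι_spec h
  have i₂ := ivlι_spec (hS.map f h)
  let g := ivlMap f h (hS.map f h) le_rfl le_rfl
  have hg : ∀ a, (ivlι (hS.map f h)).1 (g.1 a) = f.1 ((ivlι h).1 a) := fun a =>
    congrArg (fun q : ivl h ⟶ N => q.1 a) (ivlMap_ι f h (hS.map f h) le_rfl le_rfl)
  have s := isCartFam_of_isTwoSegal hX g
    (i₂.1.injective (by rw [hg, i₁.map_zero, i₂.map_zero]))
    (i₂.1.injective (by rw [hg, i₁.map_last, i₂.map_last]))
  have hρ : ∀ k : Fin (S.len (ivl h)), ∃ k' : κ, (ivlι h).1 k.castSucc = (τ k').castSucc ∧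
      (ivlι h).1 k.succ = (τ k').succ := by
    intro k
    obtain ⟨i, hi₁, hi₂⟩ := i₁.exists_edge k
    obtain ⟨k', rfl⟩ := hτ₃ i (hi₁ ▸ (i₁.mem _).1) (hi₂ ▸ (i₁.mem _).2)
    exact ⟨k', hi₁, hi₂⟩
  choose ρ hρ₁ hρ₂ using hρ
  have hρs : Function.Surjective ρ := by
    intro k'
    obtain ⟨k, hk₁, hk₂⟩ := i₁.exists_edge_eq (hτ₁ k') (hτ₂ k')
    exact ⟨k, hτ (Fin.castSucc_injective _ ((hρ₁ k).symm.trans hk₁))⟩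
  have hf₁ : ∀ k, (ivlι (hS.map f h)).1 (g.1 k.castSucc) = f.1 (τ (ρ k)).castSucc := fun k => by
    rw [hg, hρ₁]
  have hf₂ : ∀ k, (ivlι (hS.map f h)).1 (g.1 k.succ) = f.1 (τ (ρ k)).succ := fun k => by
    rw [hg, hρ₂]
  let E k := res X (ivlMap (ivlι (hS.map f h)) (hS.map g (hS.edge (ivl h) k))
    (hS.map f (hS.edge M (τ (ρ k)))) (hf₁ k).ge (hf₂ k).le)
  let E' k := res X (ivlMap (ivlι h) (hS.edge (ivl h) k) (hS.edge M (τ (ρ k))) (hρ₁ k).ge (hρ₂ k).le)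
  have iE : ∀ k, (E k).IsEquivalence := fun k =>
    have := i₂.isIso_ivlMap (hS.map g (hS.edge (ivl h) k)) (hS.map f (hS.edge M (τ (ρ k))))
      (hf₁ k) (hf₂ k)
    res_isEquivalence X _
  have iE' : ∀ k, (E' k).IsEquivalence := fun k =>
    have := i₁.isIso_ivlMap (hS.edge (ivl h) k) (hS.edge M (τ (ρ k))) (hρ₁ k) (hρ₂ k)
    res_isEquivalence X _
  have jH : ∀ k, H (ρ k) ⋙ E k = res X (ivlι (hS.map g (hS.edge (ivl h) k))) := fun k => by
    rw [hH, ← res_comp]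
    congr 1
    apply ivlι_cancel
    rw [Category.assoc, ivlInc_ι, ivlMap_ι]
  have jG : ∀ k, G (ρ k) ⋙ E' k = res X (ivlι (hS.edge (ivl h) k)) := fun k => by
    rw [hG, ← res_comp]
    congr 1
    apply ivlι_cancel
    rw [Category.assoc, ivlInc_ι, ivlMap_ι]
  have jF : ∀ k, E k ⋙ res X (ivlMap g (hS.edge (ivl h) k) (hS.map g (hS.edge (ivl h) k)) le_rfl
      le_rfl) = (sysHom X hS f).F (hS.edge M (τ (ρ k))) ⋙ E' k := fun k => by
    rw [← res_comp, ← res_comp]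
    congr 1
    apply ivlι_cancel
    rw [Category.assoc, Category.assoc, ivlMap_ι, ivlMap_ι, reassoc_of% ivlMap_ι,
      reassoc_of% ivlMap_ι]
    exact congrArg _ (ivlMap_ι f h (hS.map f h) le_rfl le_rfl)
  refine IsCartFam.of_surjective hρs s E E' (fun k => eqToIso (jH k)) (fun k => eqToIso (jG k))
    (fun k => eqToIso (jF k)) (fun k a => ?_)
  simp [eqToHom_app, eqToHom_map]

/-- For 2-Segal `X` the restriction functors `X_[f x, f y] ⥤ X_[x, y]` are 2-Cartesian with respect
to the decomposition of an interval into two. -/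
theorem isCartSq_sysHom (hX : IsTwoSegal hS X) {M N : S.Obj} (f : M ⟶ N) {x y z : S.El M}
    (hxy : HasInterval M x y) (hyz : HasInterval M y z) (hxz : HasInterval M x z) :
    MonoidalPrederivator.IsCartSq ((sysHom X hS f).square hxy hyz hxz) := by
  -- `false` stands for the interval `[x, y]`, and `true` for `[y, z]`
  let lo : Bool → S.El M := fun s => bif s then y else x
  let hi : Bool → S.El M := fun s => bif s then z else y
  have h : ∀ s, HasInterval M (lo s) (hi s) := fun s => match s with
    | false => hxy
    | true => hyz
  have hlo : ∀ s, x ≤ lo s := fun s => match s with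
    | false => le_rfl
    | true => hxy.le
  have hhi : ∀ s, hi s ≤ z := fun s => match s with
    | false => hyz.le
    | true => le_rfl
  let ι : Bool → Type := fun s => {i : Fin (S.len M) // lo s ≤ i.castSucc ∧ i.succ ≤ hi s}
  have k := isCartFam_interval hX f hxz (κ := Σ s, ι s) (τ := fun p => p.2.1)
    (by
      rintro ⟨s, i, hi₁, hi₂⟩ ⟨t, i', hj₁, hj₂⟩ (rfl : i = i')
      rcases s <;> rcases t
      · rfl
      · exact absurd (hi₂.trans hj₁) (not_le.2 i.castSucc_lt_succ)
      · exact absurd (hj₂.trans hi₁) (not_le.2 i.castSucc_lt_succ)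
      · rfl)
    (fun p => (hlo p.1).trans p.2.2.1) (fun p => p.2.2.2.trans (hhi p.1))
    (fun i h₁ h₂ => by
      rcases le_or_gt i.succ y with h₃ | h₃
      · exact ⟨⟨false, i, h₁, h₃⟩, rfl⟩
      · exact ⟨⟨true, i, Fin.le_castSucc_iff.2 h₃, h₂⟩, rfl⟩)
    (H := fun p => (sysMap X hS f).r (h p.1) hxz (hlo p.1) (hhi p.1) ⋙
      (sysMap X hS f).r (hS.edge M p.2.1) (h p.1) p.2.2.1 p.2.2.2)
    (fun p => (sysMap X hS f).r_comp _ _ _ _ _ _ _)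
    (G := fun p => (sysOf X M).r (h p.1) hxz (hlo p.1) (hhi p.1) ⋙
      (sysOf X M).r (hS.edge M p.2.1) (h p.1) p.2.2.1 p.2.2.2)
    (fun p => (sysOf X M).r_comp _ _ _ _ _ _ _)
  have k' := fun s => isCartFam_interval hX f (h s) (κ := ι s) (τ := fun i => i.1)
    Subtype.val_injective (fun i => i.2.1) (fun i => i.2.2) (fun i h₁ h₂ => ⟨⟨i, h₁, h₂⟩, rfl⟩)
    (fun i => rfl) (fun i => rfl)
  exact isCartSq_of_isCartFam (fun s => (sysHom X hS f).nat (h s) hxz (hlo s) (hhi s))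
    (IsCartFam.of_sigma k k' fun s i a => by simp [eqToHom_app, eqToHom_map])
    ((sysHom X hS f).square hxy hyz hxz)

/-- For 2-Segal `X` the restriction functors `X_[f x, f x] ⥤ X_[x, x]` are equivalences: a point has
no edges. -/
theorem isEquivalence_sysHom (hX : IsTwoSegal hS X) {M N : S.Obj} (f : M ⟶ N) {x : S.El M}
    (h : HasInterval M x x) : ((sysHom X hS f).F h).IsEquivalence :=
  isEquivalence_of_isCartFam (isCartFam_interval hX f h (κ := Empty) (τ := Empty.elim)
    (fun i => i.elim) (fun i => i.elim) (fun i => i.elim)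
    (fun i h₁ h₂ => absurd (h₂.trans h₁) (not_le.2 i.castSucc_lt_succ))
    (fun _ => rfl) (fun _ => rfl))

/-- For an interval inclusion `j`, the functors `X_[j x, j y] ⥤ X_[x, y]` are equivalences. -/
theorem isEquivalence_sysHom_of_isIntervalInclusion {J N : S.Obj} {j : J ⟶ N} {x y : S.El N}
    (hj : IsIntervalInclusion j x y) {a b : S.El J} (h : HasInterval J a b) :
    ((sysHom X hS j).F h).IsEquivalence :=
  have := hj.isIso_ivlMap h (hS.map j h) rfl rfl
  res_isEquivalence X _

end TwoSegal

/-! ### Multiplicative families as families over interval systems -/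

namespace MonoidalPrederivator

open Functor.LaxMonoidal (μ ε)

variable {V : MonoidalPrederivator.{u, v, w}} {X Y : S.Objᵒᵖ ⥤ Grpd.{u, u}} {hS : S.IsAdmissible}

/-- The multiplicative family given by a family over the interval system of `X` on `N`. -/
noncomputable def Fam.toMulFamily {N : S.Obj} (A : V.Fam (sysOf X N)) : V.MulFamily X N where
  val h := A.val h
  mul hxy hyz hxz := A.mul hxy hyz hxz
  one h := A.one h
  assoc := A.assoc
  one_mul := A.one_mul
  mul_one := A.mul_one

/-- The family `[x, y] ↦ A_[f x, f y]`. -/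
noncomputable abbrev Fam.reindex {M N : S.Obj} (A : V.Fam (sysOf X N)) (f : M ⟶ N) :
    V.Fam (sysMap X hS f) where
  val h := A.val (hS.map f h)
  mul hxy hyz hxz := A.mul (hS.map f hxy) (hS.map f hyz) (hS.map f hxz)
  one h := A.one (hS.map f h)
  assoc hxy hyz hzt hxz hyt hxt := A.assoc (hS.map f hxy) (hS.map f hyz) (hS.map f hzt)
    (hS.map f hxz) (hS.map f hyt) (hS.map f hxt)
  one_mul hx hxy := A.one_mul (hS.map f hx) (hS.map f hxy)
  mul_one hxy hy := A.mul_one (hS.map f hxy) (hS.map f hy)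

theorem alongSq_hom_app (V : MonoidalPrederivator.{u, v, w}) {L M M' N : S.Obj} (g : L ⟶ M)
    (f : M ⟶ N) (g' : L ⟶ M') (f' : M' ⟶ N) (e : g ≫ f = g' ≫ f')
    (e' : res X f ⋙ res X g = res X f' ⋙ res X g') (Z : V.obj (X.obj (op L))) :
    (V.alongSq X g f g' f' e).hom.app Z = (V.csq e' Z).hom := by
  rw [V.csq_eq e' (res_comp X g f).symm (by rw [e, res_comp])]
  rfl

theorem pullAtSq_hom_app (V : MonoidalPrederivator.{u, v, w}) (Φ : Y ⟶ X) {M N : S.Obj} (f : M ⟶ N)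
    (e : res Y f ⋙ (Φ.app (op M) : Y.obj (op M) ⥤ X.obj (op M)) = Φ.app (op N) ⋙ res X f)
    (Z : V.obj (X.obj (op M))) :
    (V.pullAtSq Φ f).hom.app Z = (V.csq e Z).hom := by
  rw [V.csq_eq e rfl e.symm, V.cmp_rfl_inv]
  rfl

/-- The morphism of multiplicative families over `f` given by a morphism of families. -/
noncomputable def Fam.Hom.toMulFamilyHom {M N : S.Obj} {f : M ⟶ N} {A : V.Fam (sysOf X N)}
    {B : V.Fam (sysOf X M)} (φ : Fam.Hom (A.reindex (hS := hS) f) (B.pull (sysHom X hS f))) :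
    MulFamily.Hom hS f A.toMulFamily B.toMulFamily where
  app h := φ.app h
  mul hxy hyz hxz := by
    refine (φ.mul hxy hyz hxz).trans ?_
    change _ ≫ (Fam.pullMul (sysHom X hS f) B hxy hyz hxz).hom = _
    simp only [Fam.pullMul, Iso.trans_hom, tensorIso_hom, Functor.Monoidal.μIso_hom,
      Functor.mapIso_hom, tensorHom_comp_tensorHom_assoc]
    exact congrArg₂ (fun s t => ((V.pull _).map (φ.app hxy) ≫ s ⊗ₘ (V.pull _).map (φ.app hyz) ≫ t) ≫ _)
      (V.alongSq_hom_app _ _ _ _ _ _ _).symm (V.alongSq_hom_app _ _ _ _ _ _ _).symm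
  one h := φ.one h

end MonoidalPrederivator

/-! ### The Hall category -/

/-- The transformation of interval systems on `N` given by `Φ : X ⟶ Z`. -/
noncomputable abbrev sysNat {X Z : S.Objᵒᵖ ⥤ Grpd.{u, u}} (Φ : X ⟶ Z) (N : S.Obj) :
    (sysOf X N).Hom (sysOf Z N) where
  F h := Φ.app (op (ivl h))
  nat h h' hx hy := Φ.naturality (ivlInc h h' hx hy).op

/-- The transformation of interval systems `[x, y] ↦ X_[f x, f y]` given by `Φ : X ⟶ Z`. -/
noncomputable abbrev sysNatMap {X Z : S.Objᵒᵖ ⥤ Grpd.{u, u}} (hS : S.IsAdmissible) (Φ : X ⟶ Z)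
    {M N : S.Obj} (f : M ⟶ N) : (sysMap X hS f).Hom (sysMap Z hS f) where
  F h := Φ.app (op (ivl (hS.map f h)))
  nat h h' hx hy := Φ.naturality
    (ivlInc (hS.map f h) (hS.map f h') (f.1.monotone hx) (f.1.monotone hy)).op

/-- The restriction functors `X_[f g x, f g y] ⥤ X_[g x, g y]`, as a transformation of interval
systems on the source of `g`. -/
noncomputable abbrev sysHomMap (X : S.Objᵒᵖ ⥤ Grpd.{u, u}) (hS : S.IsAdmissible) {L M N : S.Obj}
    (g : L ⟶ M) (f : M ⟶ N) : (sysMap X hS (g ≫ f)).Hom (sysMap X hS g) where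
  F h := res X (ivlMap f (hS.map g h) (hS.map f (hS.map g h)) le_rfl le_rfl)
  nat h h' hx hy := (sysHom X hS f).nat (hS.map g h) (hS.map g h') (g.1.monotone hx)
    (g.1.monotone hy)

namespace MonoidalPrederivator

open Functor.LaxMonoidal (μ ε)

section Composition

variable (V : MonoidalPrederivator.{u, v, w}) {A B C D : Grpd.{u, u}}

theorem cid_inv_comp {F : A ⥤ A} {G : A ⥤ B} (h : F = 𝟭 A) (e : F ⋙ G = G) {Z : V.obj A}
    {W : V.obj B} (φ : Z ⟶ (V.pull G).obj W) :
    ((V.cid h Z).inv ≫ (V.pull F).map φ) ≫ (V.cmp e W).inv = φ := by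
  rw [← V.cid_inv_nat, V.cmp_inv_left h, Category.assoc, Iso.inv_hom_id, Category.comp_id]

theorem comp_cid_inv {F : A ⥤ B} {G : B ⥤ B} (h : G = 𝟭 B) (e : F ⋙ G = F) {Z : V.obj A}
    {W : V.obj B} (φ : Z ⟶ (V.pull F).obj W) :
    (φ ≫ (V.pull F).map (V.cid h W).inv) ≫ (V.cmp e W).inv = φ := by
  rw [V.cmp_inv_right h, Category.assoc, ← Functor.map_comp, Iso.inv_hom_id,
    CategoryTheory.Functor.map_id, Category.comp_id]

theorem comp_cmp_inv {F : A ⥤ B} {G : B ⥤ C} {K : C ⥤ D} {FG : A ⥤ C} {GK : B ⥤ D} {L : A ⥤ D}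
    (e₁ : F ⋙ G = FG) (e₂ : FG ⋙ K = L) (e₃ : G ⋙ K = GK) (e₄ : F ⋙ GK = L) {Z : V.obj A}
    {W : V.obj B} {U : V.obj C} {R : V.obj D} (φ : Z ⟶ (V.pull F).obj W)
    (ψ : W ⟶ (V.pull G).obj U) (χ : U ⟶ (V.pull K).obj R) :
    (((φ ≫ (V.pull F).map ψ) ≫ (V.cmp e₁ U).inv) ≫ (V.pull FG).map χ) ≫ (V.cmp e₂ R).inv =
      (φ ≫ (V.pull F).map ((ψ ≫ (V.pull G).map χ) ≫ (V.cmp e₃ R).inv)) ≫ (V.cmp e₄ R).inv := by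
  simp only [Category.assoc, Functor.map_comp]
  rw [← V.cmp_assoc_inv e₁ e₂ e₃ e₄, reassoc_of% V.cmp_inv_nat e₁]

/-- The identity of a family, as a morphism to its pull-back along a transformation all of whose
components are identities. -/
def Fam.pullSelf {V : MonoidalPrederivator.{u, v, w}} {I : Type} [Preorder I] {P : I → I → Prop}
    {D : IvlSys.{u} P} (T : IvlSys.Hom D D) (e : ∀ {x y : I} (h : P x y), T.F h = 𝟭 _)
    (A : V.Fam D) : Fam.Hom A (A.pull T) where
  app h := (V.cid (e h) (A.val h)).inv
  mul {x y z} hxy hyz hxz := by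
    have k₁ : D.r hxy hxz le_rfl (D.le hyz) ⋙ T.F hxy = D.r hxy hxz le_rfl (D.le hyz) := by
      rw [e]; rfl
    have k₂ : D.r hyz hxz (D.le hxy) le_rfl ⋙ T.F hyz = D.r hyz hxz (D.le hxy) le_rfl := by
      rw [e]; rfl
    have c : ∀ {A : Grpd.{u, u}} {F : A ⥤ A} (h : F = 𝟭 A) (Z W : V.obj A),
        (V.cid h (Z ⊗ W)).inv = ((V.cid h Z).inv ⊗ₘ (V.cid h W).inv) ≫ μ (V.pull F) Z W := by
      intro A F h Z W
      rw [← cancel_mono (V.cid h (Z ⊗ W)).hom, Category.assoc, V.cid_tensor h,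
        tensorHom_comp_tensorHom, Iso.inv_hom_id, Iso.inv_hom_id, Iso.inv_hom_id, id_tensorHom_id]
    have d : ∀ {A B : Grpd.{u, u}} {F : A ⥤ A} {G : A ⥤ B} (h : F = 𝟭 A) (e : F ⋙ G = G)
        (Z : V.obj B), (V.cmp e Z).hom = (V.cid h ((V.pull G).obj Z)).inv := by
      intro A B F G h e Z
      rw [← cancel_mono (V.cid h ((V.pull G).obj Z)).hom, V.cmp_cid_left h e, Iso.inv_hom_id]
    change _ = _ ≫ (pullMul T A hxy hyz hxz).hom
    rw [pullMul_hom T A hxy hyz hxz k₁ k₂, V.cmp_inv_right (e hxy) k₁, V.cmp_inv_right (e hyz) k₂,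
      tensorHom_comp_tensorHom_assoc, ← Functor.map_comp, ← Functor.map_comp, Iso.inv_hom_id,
      Iso.inv_hom_id, CategoryTheory.Functor.map_id, CategoryTheory.Functor.map_id,
      id_tensorHom_id, Category.id_comp, m, V.cid_inv_nat, d (e hxz), d (e hxz), c, Category.assoc]
  one h := by
    change _ = (pullOne T A h).hom
    simp only [pullOne, Iso.trans_hom, Functor.Monoidal.εIso_hom, Functor.mapIso_hom]
    rw [V.cid_inv_nat, ← Category.id_comp (V.cid (e h) (𝟙_ _)).inv, ← V.cid_unit (e h),
      Category.assoc, Category.assoc, Iso.hom_inv_id_assoc]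

end Composition

variable (V : MonoidalPrederivator.{u, v, w}) (X : S.Objᵒᵖ ⥤ Grpd.{u, u}) (hS : S.IsAdmissible)

/-- An object of the Hall category of `X` over `N`: the formal pull-back along `Φ : X ⟶ Z` of a
multiplicative family on the intervals of `N` for the functor `Z`.  With `Φ = 𝟙 X` all families for
`X` are obtained; keeping `Φ` as a part of the datum makes the pull-back of objects along
`Y ⟶ X`, which is composition with `Φ`, strictly functorial. -/
structure HallObj (V : MonoidalPrederivator.{u, v, w}) (X : S.Objᵒᵖ ⥤ Grpd.{u, u})
    (hS : S.IsAdmissible) where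
  base : S.Obj
  Z : S.Objᵒᵖ ⥤ Grpd.{u, u}
  Φ : X ⟶ Z
  val : V.Fam (sysOf Z base)

variable {V X hS}

/-- The multiplicative family which an object of the Hall category stands for. -/
noncomputable abbrev HallObj.fam (a : HallObj V X hS) : V.Fam (sysOf X a.base) :=
  a.val.pull (sysNat a.Φ a.base)

/-- The morphisms from a family `A` on `N` to a family `B` on `M` over `f : M ⟶ N`, as morphisms of
families over the interval system `[x, y] ↦ X_[f x, f y]` of `M`. -/
abbrev Fam.HomOver (hS : S.IsAdmissible) {M N : S.Obj} (f : M ⟶ N) (A : V.Fam (sysOf X N))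
    (B : V.Fam (sysOf X M)) :=
  Fam.Hom (A.reindex (hS := hS) f) (B.pull (sysHom X hS f))

namespace Fam.HomOver

/-- The restriction of a morphism of families over `f` along `g`. -/
noncomputable def reindex {L M N : S.Obj} {f : M ⟶ N} {A : V.Fam (sysOf X N)}
    {B : V.Fam (sysOf X M)} (φ : HomOver hS f A B) (g : L ⟶ M) :
    Fam.Hom (A.reindex (hS := hS) (g ≫ f)) ((B.reindex (hS := hS) g).pull (sysHomMap X hS g f)) where
  app h := φ.app (hS.map g h)
  mul hxy hyz hxz := φ.mul (hS.map g hxy) (hS.map g hyz) (hS.map g hxz)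
  one h := φ.one (hS.map g h)

theorem sysHomMap_comp {L M N : S.Obj} (g : L ⟶ M) (f : M ⟶ N) {x y : S.El L}
    (h : HasInterval L x y) :
    (sysHomMap X hS g f).F h ⋙ (sysHom X hS g).F h = (sysHom X hS (g ≫ f)).F h := by
  exact (res_comp X _ _).symm.trans (congrArg (res X) (ivlMap_comp g f _ _ _ _ _ _ _ _ _))

/-- The composition of morphisms of families over morphisms of the base. -/
noncomputable def comp {L M N : S.Obj} {f : M ⟶ N} {g : L ⟶ M} {A : V.Fam (sysOf X N)}
    {B : V.Fam (sysOf X M)} {C : V.Fam (sysOf X L)} (φ : HomOver hS f A B) (ψ : HomOver hS g B C) :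
    HomOver hS (g ≫ f) A C :=
  ((φ.reindex g).comp (Fam.Hom.pull ψ (sysHomMap X hS g f))).comp
    (pullPull (sysHomMap X hS g f) (sysHom X hS g) (sysHom X hS (g ≫ f))
      (sysHomMap_comp g f) C)

theorem sysHom_id (N : S.Obj) {x y : S.El N} (h : HasInterval N x y) :
    (sysHom X hS (𝟙 N)).F h = 𝟭 (X.obj (op (ivl h))) :=
  (congrArg (res X) (ivlInc_self h)).trans (res_id X _)

/-- The identity of a family, as a morphism over the identity. -/
noncomputable def id {N : S.Obj} (A : V.Fam (sysOf X N)) : HomOver hS (𝟙 N) A A :=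
  Fam.pullSelf (D := sysOf X N) (sysHom X hS (𝟙 N)) (sysHom_id N) A

theorem id_comp {M N : S.Obj} {f : M ⟶ N} {A : V.Fam (sysOf X N)} {B : V.Fam (sysOf X M)}
    (φ : HomOver hS f A B) : (id A).comp φ = φ := by
  apply Fam.Hom.ext
  funext x y h
  exact V.cid_inv_comp (sysHom_id N (hS.map f h)) (sysHomMap_comp f (𝟙 N) h) (φ.app h)

theorem comp_id {M N : S.Obj} {f : M ⟶ N} {A : V.Fam (sysOf X N)} {B : V.Fam (sysOf X M)}
    (φ : HomOver hS f A B) : φ.comp (id B) = φ := by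
  apply Fam.Hom.ext
  funext x y h
  exact V.comp_cid_inv (sysHom_id M h) (sysHomMap_comp (𝟙 M) f h) (φ.app h)

theorem comp_assoc {K L M N : S.Obj} {f : M ⟶ N} {g : L ⟶ M} {k : K ⟶ L} {A : V.Fam (sysOf X N)}
    {B : V.Fam (sysOf X M)} {C : V.Fam (sysOf X L)} {D : V.Fam (sysOf X K)} (φ : HomOver hS f A B)
    (ψ : HomOver hS g B C) (χ : HomOver hS k C D) :
    (φ.comp ψ).comp χ = φ.comp (ψ.comp χ) := by
  apply Fam.Hom.ext
  funext x y h
  exact V.comp_cmp_inv (sysHomMap_comp g f (hS.map k h)) (sysHomMap_comp k (g ≫ f) h)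
    (sysHomMap_comp k g h) (sysHomMap_comp (k ≫ g) f h) (φ.app (hS.map g (hS.map k h)))
    (ψ.app (hS.map k h)) (χ.app h)

end Fam.HomOver

/-- The morphisms of the Hall category: a morphism of the base together with a morphism of families
over it.  The base morphism goes in the opposite direction, as the Hall category lies over
`Δ_Sᵒᵖ`. -/
structure HallObj.Hom (a b : HallObj V X hS) where
  base : b.base ⟶ a.base
  hom : Fam.HomOver hS base a.fam b.fam

noncomputable instance : Category.{v} (HallObj V X hS) where
  Hom a b := HallObj.Hom a b
  id a := ⟨𝟙 _, Fam.HomOver.id a.fam⟩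
  comp φ ψ := ⟨ψ.base ≫ φ.base, φ.hom.comp ψ.hom⟩
  id_comp := fun (φ : HallObj.Hom _ _) => congrArg (HallObj.Hom.mk φ.base) φ.hom.id_comp
  comp_id := fun (φ : HallObj.Hom _ _) => congrArg (HallObj.Hom.mk φ.base) φ.hom.comp_id
  assoc := fun (φ : HallObj.Hom _ _) (ψ : HallObj.Hom _ _) (χ : HallObj.Hom _ _) =>
    congrArg (HallObj.Hom.mk (χ.base ≫ ψ.base ≫ φ.base)) (φ.hom.comp_assoc ψ.hom χ.hom)

variable (V X hS) in
/-- The Hall category of `X`, as a category over `Δ_Sᵒᵖ`. -/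
noncomputable def hall : BasedCategory.{v, max s (u + 1) v w} S.Objᵒᵖ where
  obj := HallObj V X hS
  p := { obj := fun a => op a.base, map := fun (φ : HallObj.Hom _ _) => φ.base.op }

end MonoidalPrederivator

/-! ### Objects and morphisms of the Hall category over a fixed base -/

namespace MonoidalPrederivator

variable {V : MonoidalPrederivator.{u, v, w}} {X : S.Objᵒᵖ ⥤ Grpd.{u, u}} {hS : S.IsAdmissible}

theorem _root_.Hall.SimplexSubcategory.IsAdmissible.of_lt (hS : S.IsAdmissible) (N : S.Obj)
    (x y : S.El N) (h : x < y) : HasInterval N x y :=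
  hS N x y h.le (Or.inl h)

namespace Fam.HomOver

variable {M N : S.Obj} {f : M ⟶ N} {A : V.Fam (sysOf X N)} {B : V.Fam (sysOf X M)}

theorem ext_edges {φ ψ : HomOver hS f A B} (h : ∀ i, φ.app (hS.edge M i) = ψ.app (hS.edge M i)) :
    φ = ψ :=
  Fam.Hom.ext_edges (hS.of_lt M) fun i _ => h i

theorem exists_of_edges (φ : ∀ i, A.val (hS.map f (hS.edge M i)) ⟶
      (V.pull ((sysHom X hS f).F (hS.edge M i))).obj (B.val (hS.edge M i))) :
    ∃ ψ : HomOver hS f A B, ∀ i, ψ.app (hS.edge M i) = φ i := by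
  obtain ⟨ψ, hψ⟩ := Fam.Hom.exists_of_edges (A := A.reindex (hS := hS) f)
    (B := B.pull (sysHom X hS f)) (hS.of_lt M) (fun i _ => φ i)
  exact ⟨ψ, fun i => hψ i _⟩

end Fam.HomOver

/-- Every family of objects on the edges of `N` is realized by an object of the Hall category. -/
theorem exists_hallObj_val (N : S.Obj)
    (E : ∀ i : Fin (S.len N), V.obj (X.obj (op (ivl (hS.edge N i))))) :
    ∃ A : V.Fam (sysOf X N), ∀ i, Nonempty
      ((HallObj.mk (hS := hS) N X (𝟙 X) A).fam.val (hS.edge N i) ≅ E i) := by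
  refine ⟨Fam.ofEdges (sysOf X N) (hS.edge N) E, fun i => ?_⟩
  obtain ⟨j⟩ := Fam.ofEdges_edge (sysOf X N) (hS.edge N) E i
  exact ⟨V.cid rfl _ ≪≫ j⟩

theorem eq_base_of_isHomLift {a b : HallObj V X hS} {f : b.base ⟶ a.base} (φ : a ⟶ b)
    (hφ : (hall V X hS).p.IsHomLift f.op φ) : f = HallObj.Hom.base φ :=
  Quiver.Hom.op_inj (@IsHomLift.eq_of_isHomLift _ _ _ _ (hall V X hS).p a b f.op φ hφ)

theorem exists_eq_mk {N : S.Obj} (a : (hall V X hS).p.Fiber (op N)) :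
    ∃ (Z : S.Objᵒᵖ ⥤ Grpd.{u, u}) (Φ : X ⟶ Z) (A : V.Fam (sysOf Z N)),
      a = ⟨HallObj.mk N Z Φ A, rfl⟩ := by
  obtain ⟨⟨M, Z, Φ, A⟩, h⟩ := a
  obtain rfl : M = N := Opposite.op_injective h
  exact ⟨Z, Φ, A, rfl⟩

/-- The multiplicative family given by an object of a fibre of the Hall category. -/
noncomputable def famOf {N : S.Obj} (a : (hall V X hS).p.Fiber (op N)) : V.Fam (sysOf X N) :=
  (Opposite.op_injective a.2 : a.1.base = N) ▸ a.1.fam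

/-- The morphism of families given by a morphism of the Hall category over `f`. -/
noncomputable def homOf {M N : S.Obj} (f : M ⟶ N) {a : (hall V X hS).p.Fiber (op N)}
    {b : (hall V X hS).p.Fiber (op M)} (φ : a.1 ⟶ b.1) (hφ : (hall V X hS).p.IsHomLift f.op φ) :
    Fam.HomOver hS f (famOf a) (famOf b) := by
  obtain ⟨a, ha⟩ := a
  obtain ⟨b, hb⟩ := b
  obtain rfl : a.base = N := Opposite.op_injective ha
  obtain rfl : b.base = M := Opposite.op_injective hb
  exact eq_base_of_isHomLift φ hφ ▸ HallObj.Hom.hom φ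

/-- The morphisms of the Hall category over `f` are the morphisms of families over `f`. -/
theorem exists_eq_of_isHomLift {a b : HallObj V X hS} {f : b.base ⟶ a.base} (φ : a ⟶ b)
    (hφ : (hall V X hS).p.IsHomLift f.op φ) :
    ∃ φ' : Fam.HomOver hS f a.fam b.fam, φ = ⟨f, φ'⟩ := by
  obtain rfl := eq_base_of_isHomLift φ hφ
  exact ⟨φ.hom, rfl⟩

instance isHomLift_mk {a b : HallObj V X hS} {f : b.base ⟶ a.base}
    (φ : Fam.HomOver hS f a.fam b.fam) :
    (hall V X hS).p.IsHomLift f.op (⟨f, φ⟩ : a ⟶ b) :=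
  IsHomLift.map (hall V X hS).p (⟨f, φ⟩ : a ⟶ b)

variable (V X hS) in
/-- The structure of a Hall category of `X` on the category `hall V X hS`. -/
noncomputable def hallCategory : V.HallCategory X hS (hall V X hS) where
  fam a := (famOf a).toMulFamily
  hom f _ _ φ hφ := (homOf f φ hφ).toMulFamilyHom
  hom_id := by
    rintro N a hφ x y h
    obtain ⟨Z, Φ, A, rfl⟩ := exists_eq_mk a
    rfl
  hom_comp := by
    rintro L M N g f a b c φ ψ hφ hψ hφψ x y h
    obtain ⟨Z, Φ, A, rfl⟩ := exists_eq_mk a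
    obtain ⟨Z', Φ', A', rfl⟩ := exists_eq_mk b
    obtain ⟨Z'', Φ'', A'', rfl⟩ := exists_eq_mk c
    obtain ⟨φ, rfl⟩ := exists_eq_of_isHomLift φ hφ
    obtain ⟨ψ, rfl⟩ := exists_eq_of_isHomLift ψ hψ
    exact Category.assoc _ _ _
  bijective := by
    rintro M N f a b
    obtain ⟨Z, Φ, A, rfl⟩ := exists_eq_mk a
    obtain ⟨Z', Φ', A', rfl⟩ := exists_eq_mk b
    constructor
    · rintro ⟨φ, hφ⟩ ⟨ψ, hψ⟩ h
      obtain ⟨φ, rfl⟩ := exists_eq_of_isHomLift φ hφ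
      obtain ⟨ψ, rfl⟩ := exists_eq_of_isHomLift ψ hψ
      obtain rfl : φ = ψ := Fam.HomOver.ext_edges fun i => congrFun h i
      rfl
    · intro φ
      obtain ⟨ψ, hψ⟩ := Fam.HomOver.exists_of_edges (hS := hS) (f := f) (A := A.pull (sysNat Φ N))
        (B := A'.pull (sysNat Φ' M)) φ
      exact ⟨⟨⟨f, ψ⟩, isHomLift_mk (a := ⟨N, Z, Φ, A⟩) (b := ⟨M, Z', Φ', A'⟩) ψ⟩,
        funext hψ⟩
  exists_val N E := by
    obtain ⟨A, hA⟩ := exists_hallObj_val (V := V) (hS := hS) N E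
    exact ⟨⟨⟨N, X, 𝟙 X, A⟩, rfl⟩, hA⟩

end MonoidalPrederivator

/-! ### Co-Cartesian morphisms of the Hall category -/

namespace MonoidalPrederivator

variable {V : MonoidalPrederivator.{u, v, w}} {X : S.Objᵒᵖ ⥤ Grpd.{u, u}} {hS : S.IsAdmissible}

theorem Fam.HomOver.comp_app_eq_iff {L M N : S.Obj} {f : M ⟶ N} {g : L ⟶ M} {A : V.Fam (sysOf X N)}
    {B : V.Fam (sysOf X M)} {C : V.Fam (sysOf X L)} (φ : HomOver hS f A B) (ψ : HomOver hS g B C)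
    (χ : HomOver hS (g ≫ f) A C) {x y : S.El L} (h : HasInterval L x y) :
    (φ.comp ψ).app h = χ.app h ↔
      φ.app (hS.map g h) ≫ (V.pull ((sysHomMap X hS g f).F h)).map (ψ.app h) =
        χ.app h ≫ (V.cmp (Fam.HomOver.sysHomMap_comp g f h) (C.val h)).hom :=
  Iso.comp_inv_eq _

/-- A morphism over `f` all of whose components are left Kan extensions is co-Cartesian: morphisms
out of its target are determined, and may be constructed, on the edges. -/
theorem isStronglyCocartesian_of_isLeftKan {a b : HallObj V X hS} {f : b.base ⟶ a.base}
    (φ : Fam.HomOver hS f a.fam b.fam)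
    (hφ : ∀ {x y : S.El b.base} (h : HasInterval b.base x y),
      V.IsLeftKan (W := b.fam.val h) ((sysHom X hS f).F h) (φ.app h)) :
    (hall V X hS).p.IsStronglyCocartesian f.op (⟨f, φ⟩ : a ⟶ b) := by
  refine @Functor.IsStronglyCocartesian.mk _ _ _ _ _ _ _ _ _ _ _ (isHomLift_mk φ) ?_
  intro (c : HallObj V X hS) g ψ hψ
  obtain ⟨k, rfl⟩ : ∃ k : c.base ⟶ b.base, g = k.op := ⟨g.unop, rfl⟩
  obtain ⟨ψ, rfl⟩ := exists_eq_of_isHomLift (f := k ≫ f) ψ hψ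
  have u : ∀ i : Fin (S.len c.base), ∃ χ : b.fam.val (hS.map k (hS.edge c.base i)) ⟶
      (V.pull ((sysHom X hS k).F (hS.edge c.base i))).obj (c.fam.val (hS.edge c.base i)),
      φ.app (hS.map k (hS.edge c.base i)) ≫ (V.pull ((sysHomMap X hS k f).F _)).map χ =
        ψ.app (hS.edge c.base i) ≫ (V.cmp (Fam.HomOver.sysHomMap_comp k f _) _).hom :=
    fun i => (hφ (hS.map k (hS.edge c.base i)) _).2 _
  choose χ hχ using u
  obtain ⟨χ, hχ'⟩ := Fam.HomOver.exists_of_edges (hS := hS) χ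
  refine ⟨⟨k, χ⟩, ⟨isHomLift_mk χ, congrArg (HallObj.Hom.mk (k ≫ f))
    (Fam.HomOver.ext_edges fun i => ?_)⟩, ?_⟩
  · refine (Fam.HomOver.comp_app_eq_iff φ χ ψ (hS.edge c.base i)).2 ?_
    rw [hχ']
    exact hχ i
  · rintro χ' ⟨h₁, h₂⟩
    obtain ⟨χ', rfl⟩ := exists_eq_of_isHomLift χ' h₁
    have h₂ : φ.comp χ' = ψ := by injection h₂
    refine congrArg (HallObj.Hom.mk k) (Fam.HomOver.ext_edges fun i => ?_)
    apply (hφ (hS.map k (hS.edge c.base i)) _).1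
    refine ((Fam.HomOver.comp_app_eq_iff φ χ' ψ (hS.edge c.base i)).1 (by rw [h₂])).trans ?_
    rw [hχ']
    exact (hχ i).symm

/-- For 2-Segal `X`, a morphism over `f` consists of left Kan extensions as soon as its components
on the edges are left Kan extensions. -/
theorem isLeftKan_of_edges (hV : V.IsLeftDerivator) (hV' : V.IsComponentwiseCocontinuous)
    (hX : IsTwoSegal hS X) {M N : S.Obj} {f : M ⟶ N} {A : V.Fam (sysOf X N)}
    {B : V.Fam (sysOf X M)} (φ : Fam.HomOver hS f A B)
    (hφ : ∀ i, V.IsLeftKan (W := B.val (hS.edge M i)) ((sysHom X hS f).F (hS.edge M i))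
      (φ.app (hS.edge M i))) {x y : S.El M} (h : HasInterval M x y) :
    V.IsLeftKan (W := B.val h) ((sysHom X hS f).F h) (φ.app h) :=
  Fam.Hom.isLeftKan_of_edges hV hV' (hS.of_lt M) φ (isCartSq_sysHom hX f) (isEquivalence_sysHom hX f)
    (fun i _ => hφ i) h

theorem IsLeftDerivator.exists_isLeftKan (hV : V.IsLeftDerivator) {A B : Grpd.{u, u}} (F : A ⥤ B)
    (Z : V.obj A) : ∃ (W : V.obj B) (η : Z ⟶ (V.pull F).obj W), V.IsLeftKan F η := by
  have := hV.leftKan F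
  refine ⟨(V.pull F).leftAdjoint.obj Z, (Adjunction.ofIsRightAdjoint (V.pull F)).unit.app Z, ?_⟩
  intro W
  have h := ((Adjunction.ofIsRightAdjoint (V.pull F)).homEquiv Z W).bijective
  convert h using 2 with g
  rw [Adjunction.homEquiv_unit]

/-- The Hall category of a 2-Segal functor is an op-fibration.  The push-forward along `f : M ⟶ N`
of a family `A` has the left Kan extensions of the `A_[f i, f (i + 1)]` as values on the edges of
`M`. -/
theorem isOpfibration_hall (hV : V.IsLeftDerivator) (hV' : V.IsComponentwiseCocontinuous)
    (hX : IsTwoSegal hS X) : IsOpfibration (hall V X hS).p := by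
  intro R T f a
  obtain ⟨N, rfl⟩ : ∃ N : S.Obj, R = op N := ⟨R.unop, rfl⟩
  obtain ⟨M, rfl⟩ : ∃ M : S.Obj, T = op M := ⟨T.unop, rfl⟩
  obtain ⟨f, rfl⟩ : ∃ f' : M ⟶ N, f = f'.op := ⟨f.unop, rfl⟩
  obtain ⟨Z, Φ, A, rfl⟩ := exists_eq_mk a
  let a : HallObj V X hS := ⟨N, Z, Φ, A⟩
  choose E η hη using fun i : Fin (S.len M) => hV.exists_isLeftKan
    ((sysHom X hS f).F (hS.edge M i)) (a.fam.val (hS.map f (hS.edge M i)))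
  obtain ⟨B, hB⟩ := exists_hallObj_val (V := V) (hS := hS) M E
  let b : HallObj V X hS := ⟨M, X, 𝟙 X, B⟩
  let j : ∀ i, b.fam.val (hS.edge M i) ≅ E i := fun i => (hB i).some
  obtain ⟨φ, hφ⟩ := Fam.HomOver.exists_of_edges (hS := hS) (f := f) (A := a.fam) (B := b.fam)
    (fun i => η i ≫ (V.pull _).map (j i).inv)
  refine ⟨b, (⟨f, φ⟩ : a ⟶ b), ?_⟩
  refine isStronglyCocartesian_of_isLeftKan (a := a) (b := b) (f := f) φ
    (isLeftKan_of_edges hV hV' hX φ fun i => ?_)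
  rw [hφ]
  exact cast (congrArg (V.IsLeftKan _) (Category.id_comp _)) ((hη i).of_iso (Iso.refl _) (j i).symm)

/-- A morphism over an interval inclusion all of whose components on edges are isomorphisms is
co-Cartesian. -/
theorem isStronglyCocartesian_of_isIso (hV : V.IsLeftDerivator)
    (hV' : V.IsComponentwiseCocontinuous) (hX : IsTwoSegal hS X) {a b : HallObj V X hS}
    {j : b.base ⟶ a.base} {x y : S.El a.base} (hj : IsIntervalInclusion j x y)
    (φ : Fam.HomOver hS j a.fam b.fam) (hφ : ∀ i, IsIso (φ.app (hS.edge b.base i))) :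
    (hall V X hS).p.IsStronglyCocartesian j.op (⟨j, φ⟩ : a ⟶ b) :=
  isStronglyCocartesian_of_isLeftKan φ (isLeftKan_of_edges hV hV' hX φ fun i =>
    have := isEquivalence_sysHom_of_isIntervalInclusion (X := X) (hS := hS) hj (hS.edge b.base i)
    have := hφ i
    isLeftKan_of_isIso _ _)

/-- Every object has a co-Cartesian morphism over a given interval inclusion whose components are
isomorphisms. -/
theorem exists_isIso_lift {J : S.Obj} (a : HallObj V X hS)
    {j : J ⟶ a.base} {x y : S.El a.base} (hj : IsIntervalInclusion j x y) :
    ∃ (B : V.Fam (sysOf X J)) (φ : Fam.HomOver hS j a.fam (HallObj.mk (hS := hS) J X (𝟙 X) B).fam),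
      ∀ i, IsIso (φ.app (hS.edge J i)) := by
  have e := fun i => isEquivalence_sysHom_of_isIntervalInclusion (X := X) (hS := hS) hj (hS.edge J i)
  have e' := fun i => V.pull_isEquivalence ((sysHom X hS j).F (hS.edge J i))
  obtain ⟨B, hB⟩ := exists_hallObj_val (V := V) (hS := hS) J fun i =>
    (V.pull ((sysHom X hS j).F (hS.edge J i))).objPreimage (a.fam.val (hS.map j (hS.edge J i)))
  obtain ⟨φ, hφ⟩ := Fam.HomOver.exists_of_edges (hS := hS) (f := j) (A := a.fam)
    (B := (HallObj.mk (hS := hS) J X (𝟙 X) B).fam) (fun i =>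
    (((V.pull ((sysHom X hS j).F (hS.edge J i))).objObjPreimageIso _).symm ≪≫
      (V.pull _).mapIso (hB i).some.symm).hom)
  exact ⟨B, φ, fun i => by rw [hφ]; infer_instance⟩

end MonoidalPrederivator

/-! ### The 1-Segal condition -/

/-- The edge `{i, i + 1}` has exactly one edge. -/
theorem SimplexSubcategory.IsAdmissible.existsUnique_edge (hS : S.IsAdmissible) (N : S.Obj)
    (i : Fin (S.len N)) : ∃ k : Fin (S.len (ivl (hS.edge N i))),
      ((ivlι (hS.edge N i)).1 k.castSucc = i.castSucc ∧ (ivlι (hS.edge N i)).1 k.succ = i.succ) ∧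
        ∀ k', k' = k := by
  have hj := ivlι_spec (hS.edge N i)
  obtain ⟨k, hk⟩ := hj.exists_edge_eq (i := i) le_rfl le_rfl
  refine ⟨k, hk, fun k' => ?_⟩
  have h₁ : (ivlι (hS.edge N i)).1 k'.castSucc < (ivlι (hS.edge N i)).1 k'.succ :=
    hj.1 k'.castSucc_lt_succ
  have h₂ : (ivlι (hS.edge N i)).1 k'.castSucc = i.castSucc := by
    refine le_antisymm ?_ (hj.mem _).1
    exact Fin.le_castSucc_iff.2 (h₁.trans_le (hj.mem _).2)
  exact Fin.castSucc_injective _ (hj.1.injective (h₂.trans hk.1.symm))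

theorem _root_.CategoryTheory.Functor.IsCocartesian.exists_iso {E : Type u'} [Category.{v'} E]
    {B : Type*} [Category* B] {p : E ⥤ B} {R T : B} {f : R ⟶ T} {a b b' : E} (φ : a ⟶ b)
    (φ' : a ⟶ b') (hφ : p.IsCocartesian f φ) (hφ' : p.IsCocartesian f φ') :
    ∃ e : b ≅ b', p.IsHomLift (𝟙 T) e.hom ∧ p.IsHomLift (𝟙 T) e.inv ∧ φ ≫ e.hom = φ' :=
  ⟨Functor.IsCocartesian.codomainUniqueUpToIso p f φ φ',
    Functor.IsCocartesian.map_isHomLift p f φ φ', Functor.IsCocartesian.map_isHomLift p f φ' φ,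
    Functor.IsCocartesian.fac p f φ φ'⟩

namespace MonoidalPrederivator

variable {V : MonoidalPrederivator.{u, v, w}} {X : S.Objᵒᵖ ⥤ Grpd.{u, u}} {hS : S.IsAdmissible}

namespace Fam.HomOver

theorem isIso_of_comp_eq_id {N : S.Obj} {A B : V.Fam (sysOf X N)} {φ : HomOver hS (𝟙 N) A B}
    {ψ : HomOver hS (𝟙 N) B A} (h₁ : φ.comp ψ = id A) (h₂ : ψ.comp φ = id B) {x y : S.El N}
    (h : HasInterval N x y) : IsIso (φ.app h) := by
  have key : ∀ {T : Grpd.{u, u}} {F : T ⥤ T} (e : F = 𝟭 T) (e' : F ⋙ F = F) {Z W : V.obj T}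
      (a : Z ⟶ (V.pull F).obj W) (b : W ⟶ (V.pull F).obj Z),
      (a ≫ (V.pull F).map b) ≫ (V.cmp e' Z).inv = (V.cid e Z).inv →
      (a ≫ (V.cid e W).hom) ≫ b ≫ (V.cid e Z).hom = 𝟙 Z := by
    intro T F e e' Z W a b h
    rw [V.cmp_inv_left e e', Category.assoc, V.cid_nat e b] at h
    rw [Category.assoc, reassoc_of% h, Iso.inv_hom_id]
  have key' : ∀ {T : Grpd.{u, u}} {F : T ⥤ T} (e : F = 𝟭 T) (_ : F ⋙ F = F) {Z W : V.obj T}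
      (a : Z ⟶ (V.pull F).obj W) (b : W ⟶ (V.pull F).obj Z),
      (a ≫ (V.cid e W).hom) ≫ b ≫ (V.cid e Z).hom = 𝟙 Z →
      (b ≫ (V.cid e Z).hom) ≫ a ≫ (V.cid e W).hom = 𝟙 W → IsIso a := by
    intro T F e e' Z W a b h h'
    have : IsIso (a ≫ (V.cid e W).hom) := ⟨_, h, h'⟩
    exact IsIso.of_isIso_comp_right a (V.cid e W).hom
  exact key' (sysHom_id (hS := hS) N h) (sysHomMap_comp (𝟙 N) (𝟙 N) h) (φ.app h) (ψ.app h)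
    (key (sysHom_id (hS := hS) N h) (sysHomMap_comp (𝟙 N) (𝟙 N) h) (φ.app h) (ψ.app h)
      (congrArg (fun t : HomOver hS (𝟙 N) A A => t.app h) h₁))
    (key (sysHom_id (hS := hS) N h) (sysHomMap_comp (𝟙 N) (𝟙 N) h) (ψ.app h) (φ.app h)
      (congrArg (fun t : HomOver hS (𝟙 N) B B => t.app h) h₂))

theorem isIso_comp {L M N : S.Obj} {f : M ⟶ N} {g : L ⟶ M} {A : V.Fam (sysOf X N)}
    {B : V.Fam (sysOf X M)} {C : V.Fam (sysOf X L)} (φ : HomOver hS f A B) (ψ : HomOver hS g B C)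
    {x y : S.El L} (h : HasInterval L x y) (h₁ : IsIso (φ.app (hS.map g h)))
    (h₂ : IsIso (ψ.app h)) : IsIso ((φ.comp ψ).app h) := by
  have key : ∀ {T T' T'' : Grpd.{u, u}} {F : T ⥤ T'} {G : T' ⥤ T''} {K : T ⥤ T''} (e : F ⋙ G = K)
      {Z : V.obj T} {W : V.obj T'} {U : V.obj T''} (a : Z ⟶ (V.pull F).obj W)
      (b : W ⟶ (V.pull G).obj U), IsIso a → IsIso b →
      IsIso ((a ≫ (V.pull F).map b) ≫ (V.cmp e U).inv) := by
    intros
    infer_instance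
  exact key (sysHomMap_comp g f h) _ _ h₁ h₂

/-- Morphisms over the identity are determined by their composites with morphisms over the edge
inclusions whose components are isomorphisms. -/
theorem ext_of_comp {N : S.Obj} {A B : V.Fam (sysOf X N)} {φ ψ : HomOver hS (𝟙 N) A B}
    {C : ∀ i, V.Fam (sysOf X (ivl (hS.edge N i)))} (l : ∀ i, HomOver hS (ivlι (hS.edge N i)) B (C i))
    (hl : ∀ i k, IsIso ((l i).app (hS.edge _ k))) (h : ∀ i, φ.comp (l i) = ψ.comp (l i)) : φ = ψ := by
  apply ext_edges
  intro i
  obtain ⟨k, ⟨hk₁, hk₂⟩, -⟩ := hS.existsUnique_edge N i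
  have key : ∀ {x y : S.El N} (hxy : HasInterval N x y),
      (ivlι (hS.edge N i)).1 k.castSucc = x → (ivlι (hS.edge N i)).1 k.succ = y →
      φ.app hxy = ψ.app hxy := by
    rintro _ _ hxy rfl rfl
    have := @Functor.map_isIso _ _ _ _ _ _
      (V.pull ((sysHomMap X hS (ivlι (hS.edge N i)) (𝟙 N)).F (hS.edge _ k))) _ (hl i k)
    have e := (comp_app_eq_iff φ (l i) (ψ.comp (l i)) (hS.edge _ k)).1 (by rw [h])
    have e' := (comp_app_eq_iff ψ (l i) (ψ.comp (l i)) (hS.edge _ k)).1 rfl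
    exact (@cancel_mono _ _ _ _ _ _ (@IsIso.mono_of_iso _ _ _ _ _ this) _ _).1 (e.trans e'.symm)
  exact key (hS.edge N i) hk₁ hk₂

/-- A family of morphisms over the edge inclusions factors through morphisms `l i` whose components
are isomorphisms. -/
theorem exists_comp_eq {N : S.Obj} {A B : V.Fam (sysOf X N)}
    {C : ∀ i, V.Fam (sysOf X (ivl (hS.edge N i)))} (l : ∀ i, HomOver hS (ivlι (hS.edge N i)) B (C i))
    (hl : ∀ i k, IsIso ((l i).app (hS.edge _ k)))
    (θ : ∀ i, HomOver hS (ivlι (hS.edge N i)) A (C i)) :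
    ∃ φ : HomOver hS (𝟙 N) A B, ∀ i, φ.comp (l i) = θ i := by
  have key : ∀ i, ∃ t, ∀ φ : HomOver hS (𝟙 N) A B, φ.app (hS.edge N i) = t → φ.comp (l i) = θ i := by
    intro i
    obtain ⟨k, ⟨hk₁, hk₂⟩, hk⟩ := hS.existsUnique_edge N i
    have key : ∀ {x y : S.El N} (hxy : HasInterval N x y),
        (ivlι (hS.edge N i)).1 k.castSucc = x → (ivlι (hS.edge N i)).1 k.succ = y →
        ∃ t, ∀ φ : HomOver hS (𝟙 N) A B, φ.app hxy = t → φ.comp (l i) = θ i := by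
      rintro _ _ hxy rfl rfl
      let c := (V.pull ((sysHomMap X hS (ivlι (hS.edge N i)) (𝟙 N)).F (hS.edge _ k))).map
        ((l i).app (hS.edge _ k))
      obtain ⟨d, -, hd⟩ := (@Functor.map_isIso _ _ _ _ _ _ (V.pull _) _ (hl i k) : IsIso c).out
      refine ⟨((θ i).app (hS.edge _ k) ≫ (V.cmp (sysHomMap_comp (ivlι (hS.edge N i)) (𝟙 N)
        (hS.edge _ k)) ((C i).val (hS.edge _ k))).hom) ≫ d, fun φ hφ => ext_edges fun k' => ?_⟩
      obtain rfl := hk k'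
      refine (comp_app_eq_iff φ (l i) (θ i) (hS.edge _ k')).2 ?_
      rw [hφ]
      exact (Category.assoc _ _ _).trans ((congrArg _ hd).trans (Category.comp_id _))
    exact key (hS.edge N i) hk₁ hk₂
  choose t ht using key
  obtain ⟨φ, hφ⟩ := exists_of_edges t
  exact ⟨φ, fun i => ht i φ (hφ i)⟩

/-- Families on the edges of `N` are the restrictions of a family on `N`. -/
theorem exists_of_restrictions {N : S.Obj} (C : ∀ i, V.Fam (sysOf X (ivl (hS.edge N i)))) :
    ∃ A : V.Fam (sysOf X N), ∀ i, ∃ θ : HomOver hS (ivlι (hS.edge N i))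
      (HallObj.mk (hS := hS) N X (𝟙 X) A).fam (C i), ∀ k, IsIso (θ.app (hS.edge _ k)) := by
  have key : ∀ i, ∃ E : V.obj (X.obj (op (ivl (hS.edge N i)))), ∀ A : V.Fam (sysOf X N),
      Nonempty (A.val (hS.edge N i) ≅ E) →
      ∃ θ : HomOver hS (ivlι (hS.edge N i)) A (C i), ∀ k, IsIso (θ.app (hS.edge _ k)) := by
    intro i
    obtain ⟨k, ⟨hk₁, hk₂⟩, hk⟩ := hS.existsUnique_edge N i
    have key : ∀ {x y : S.El N} (hxy : HasInterval N x y),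
        (ivlι (hS.edge N i)).1 k.castSucc = x → (ivlι (hS.edge N i)).1 k.succ = y →
        ∃ E : V.obj (X.obj (op (ivl hxy))), ∀ A : V.Fam (sysOf X N),
        Nonempty (A.val hxy ≅ E) →
        ∃ θ : HomOver hS (ivlι (hS.edge N i)) A (C i), ∀ k, IsIso (θ.app (hS.edge _ k)) := by
      rintro _ _ hxy rfl rfl
      refine ⟨(V.pull ((sysHom X hS (ivlι (hS.edge N i))).F (hS.edge _ k))).obj
        ((C i).val (hS.edge _ k)), ?_⟩
      rintro A ⟨j⟩
      obtain ⟨θ, hθ⟩ := exists_of_edges (hS := hS) (f := ivlι (hS.edge N i)) (A := A) (B := C i)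
        (fun k' => by
          obtain rfl := hk k'
          exact j.hom)
      refine ⟨θ, fun k' => ?_⟩
      rw [hθ]
      obtain rfl := hk k'
      exact j.isIso_hom
    exact key (hS.edge N i) hk₁ hk₂
  choose E hE using key
  obtain ⟨A, hA⟩ := exists_hallObj_val (V := V) (hS := hS) N E
  exact ⟨A, fun i => hE i _ (hA i)⟩

end Fam.HomOver

/-- The components on edges of a co-Cartesian morphism over an interval inclusion are
isomorphisms. -/
theorem isIso_of_isStronglyCocartesian (hV : V.IsLeftDerivator)
    (hV' : V.IsComponentwiseCocontinuous) (hX : IsTwoSegal hS X) {a b : HallObj V X hS}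
    {j : b.base ⟶ a.base} {x y : S.El a.base} (hj : IsIntervalInclusion j x y)
    (φ : Fam.HomOver hS j a.fam b.fam)
    (hφ : (hall V X hS).p.IsStronglyCocartesian j.op (⟨j, φ⟩ : a ⟶ b)) (i : Fin (S.len b.base)) :
    IsIso (φ.app (hS.edge b.base i)) := by
  obtain ⟨B, ψ, hψ⟩ := exists_isIso_lift a hj
  let b' : HallObj V X hS := ⟨b.base, X, 𝟙 X, B⟩
  have hψ' : (hall V X hS).p.IsStronglyCocartesian j.op (⟨j, ψ⟩ : a ⟶ b') :=
    isStronglyCocartesian_of_isIso (a := a) (b := b') hV hV' hX hj ψ hψ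
  obtain ⟨e, h₁, h₂, h₃⟩ := Functor.IsCocartesian.exists_iso (b := b') (b' := b) (⟨j, ψ⟩ : a ⟶ b')
    (⟨j, φ⟩ : a ⟶ b) hψ'.isCocartesian_of_isStronglyCocartesian
    hφ.isCocartesian_of_isStronglyCocartesian
  obtain ⟨ν, hν⟩ := exists_eq_of_isHomLift (a := b') (b := b) (f := 𝟙 b.base) _ h₁
  obtain ⟨ν', hν'⟩ := exists_eq_of_isHomLift (a := b) (b := b') (f := 𝟙 b.base) _ h₂
  have e₁ := e.hom_inv_id
  have e₂ := e.inv_hom_id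
  rw [hν, hν'] at e₁ e₂
  rw [hν] at h₃
  injection e₁ with _ e₁
  injection e₂ with _ e₂
  injection h₃ with _ h₃
  obtain rfl : ψ.comp ν = φ := h₃
  exact Fam.HomOver.isIso_comp ψ ν (hS.edge b.base i) (hψ i)
    (Fam.HomOver.isIso_of_comp_eq_id e₁ e₂ (hS.edge b.base i))

/-- A translation from the Hall category to families: given a co-Cartesian morphism `l` and any
morphism `θ` over an interval inclusion with a common target, factoring `θ` through `l` over the
identity amounts to factoring morphisms of families through a morphism whose components on edges
are isomorphisms. -/
theorem exists_homOver_of_isStronglyCocartesian (hV : V.IsLeftDerivator)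
    (hV' : V.IsComponentwiseCocontinuous) (hX : IsTwoSegal hS X) {J N : S.Obj} {j : J ⟶ N}
    {x y : S.El N} (hj : IsIntervalInclusion j x y) {Z Z' : S.Objᵒᵖ ⥤ Grpd.{u, u}} {Φ : X ⟶ Z}
    {Φ' : X ⟶ Z'} {A : V.Fam (sysOf Z N)} {B : V.Fam (sysOf Z' N)} {c : HallObj V X hS}
    (l : HallObj.mk N Z' Φ' B ⟶ c) (hl : (hall V X hS).p.IsStronglyCocartesian j.op l)
    (θ : HallObj.mk N Z Φ A ⟶ c) (hθ : (hall V X hS).p.IsHomLift j.op θ) :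
    ∃ (C : V.Fam (sysOf X J)) (l' : Fam.HomOver hS j (B.pull (sysNat Φ' N)) C)
      (θ' : Fam.HomOver hS j (A.pull (sysNat Φ N)) C), (∀ k, IsIso (l'.app (hS.edge J k))) ∧
      ∀ φ : Fam.HomOver hS (𝟙 N) (A.pull (sysNat Φ N)) (B.pull (sysNat Φ' N)),
        (⟨𝟙 N, φ⟩ : HallObj.mk N Z Φ A ⟶ HallObj.mk N Z' Φ' B) ≫ l = θ ↔ φ.comp l' = θ' := by
  obtain rfl : c.base = J := Opposite.op_injective (IsHomLift.codomain_eq (hall V X hS).p j.op θ)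
  obtain ⟨l, rfl⟩ := exists_eq_of_isHomLift (a := HallObj.mk N Z' Φ' B) l hl.toIsHomLift
  obtain ⟨θ, rfl⟩ := exists_eq_of_isHomLift (a := HallObj.mk N Z Φ A) θ hθ
  refine ⟨c.fam, l, θ, isIso_of_isStronglyCocartesian (a := HallObj.mk N Z' Φ' B) hV hV' hX hj l hl,
    fun φ => ⟨fun h => ?_, fun h => ?_⟩⟩
  · injection h
  · exact congrArg (HallObj.Hom.mk (a := HallObj.mk N Z Φ A) (b := c) j) h

end MonoidalPrederivator

/-- A criterion for the push-forwards along a family of morphisms to give an equivalence of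
fibres: `h₁` gives fullness and faithfulness, `h₂` essential surjectivity. -/
theorem IsOpfibration.isEquivalence_pi_push {E : Type u'} [Category.{v'} E] {B : Type*}
    [Category* B] {p : E ⥤ B} (hp : IsOpfibration p) {R : B} {n : ℕ} {T : Fin n → B}
    (g : ∀ i, R ⟶ T i)
    (h₁ : ∀ (a b : p.Fiber R) (c : Fin n → E) (l : ∀ i, b.1 ⟶ c i) (ψ : ∀ i, a.1 ⟶ c i),
      (∀ i, p.IsStronglyCocartesian (g i) (l i)) → (∀ i, p.IsHomLift (g i) (ψ i)) →
      ∃! φ : a ⟶ b, ∀ i, φ.1 ≫ l i = ψ i)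
    (h₂ : ∀ c : ∀ i, p.Fiber (T i), ∃ a : p.Fiber R, ∀ i, ∃ ψ : a.1 ⟶ (c i).1,
      p.IsStronglyCocartesian (g i) ψ) :
    (Functor.pi' fun i => hp.push (g i)).IsEquivalence := by
  have fac : ∀ {a b : p.Fiber R} (φ : a ⟶ b) (i : Fin n),
      hp.lift (g i) a ≫ ((hp.push (g i)).map φ).1 = φ.1 ≫ hp.lift (g i) b := fun {a b} φ i =>
    have := hp.isHomLift_comp_lift (g i) φ
    Functor.IsCocartesian.fac p (g i) (hp.lift (g i) a) (φ.1 ≫ hp.lift (g i) b)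
  refine { faithful := ⟨fun {a b φ ψ} h => ?_⟩, full := ⟨fun {a b} θ => ?_⟩,
           essSurj := ⟨fun c => ?_⟩ }
  · refine (h₁ a b _ (fun i => hp.lift (g i) b) (fun i => φ.1 ≫ hp.lift (g i) b)
      (fun i => inferInstance) fun i => hp.isHomLift_comp_lift (g i) φ).unique
      (fun i => rfl) fun i => ?_
    rw [← fac, ← fac]
    exact congrArg (fun t => hp.lift (g i) a ≫ t.1) (congrFun h i).symm
  · have hl : ∀ i, p.IsHomLift (g i) (hp.lift (g i) a ≫ (θ i).1) := fun i =>
      @IsHomLift.comp_lift_id_right _ _ _ _ p _ _ _ _ _ (g i) (hp.lift (g i) a) inferInstance _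
        (θ i).2
    obtain ⟨φ, hφ, -⟩ := h₁ a b _ (fun i => hp.lift (g i) b)
      (fun i => hp.lift (g i) a ≫ (θ i).1) (fun i => inferInstance) hl
    refine ⟨φ, funext fun i => Subtype.ext ?_⟩
    exact @Functor.IsCocartesian.ext _ _ _ _ p _ _ _ _ (g i) (hp.lift (g i) a) _ _ _ _
      ((hp.push (g i)).map φ).2 (θ i).2 ((fac φ i).trans (hφ i))
  · obtain ⟨a, ha⟩ := h₂ c
    choose ψ hψ using ha
    refine ⟨a, ⟨Pi.isoMk fun i => ?_⟩⟩
    let e := Functor.IsCocartesian.codomainUniqueUpToIso p (g i) (hp.lift (g i) a) (ψ i)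
    exact ⟨⟨e.hom, Functor.IsCocartesian.map_isHomLift p (g i) (hp.lift (g i) a) (ψ i)⟩,
      ⟨e.inv, Functor.IsCocartesian.map_isHomLift p (g i) (ψ i) (hp.lift (g i) a)⟩,
      Subtype.ext e.hom_inv_id, Subtype.ext e.inv_hom_id⟩

namespace MonoidalPrederivator

/-- The Hall category of a 2-Segal functor, as a pointed 1-Segal op-fibration. -/
noncomputable def hallSegal (V : MonoidalPrederivator.{u, v, w}) (hV : V.IsLeftDerivator)
    (hV' : V.IsComponentwiseCocontinuous) {hS : S.IsAdmissible} (X : TwoSegal.{s, u} hS) :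
    SegalOpfibration.{s, v, max s (u + 1) v w} hS where
  total := hall V X.obj hS
  opfibration := isOpfibration_hall hV hV' X.property
  segal N := by
    apply IsOpfibration.isEquivalence_pi_push
    · intro a b c l ψ hl hψ
      obtain ⟨Z, Φ, A, rfl⟩ := exists_eq_mk a
      obtain ⟨Z', Φ', A', rfl⟩ := exists_eq_mk b
      choose C l' θ hl' hθ using fun i => exists_homOver_of_isStronglyCocartesian hV hV' X.property
        (ivlι_spec (hS.edge N i)) (l i) (hl i) (ψ i) (hψ i)
      obtain ⟨φ, hφ⟩ := Fam.HomOver.exists_comp_eq l' hl' θ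
      refine ⟨⟨⟨𝟙 N, φ⟩, isHomLift_mk (a := HallObj.mk N Z Φ A) (b := HallObj.mk N Z' Φ' A') φ⟩,
         fun i => (hθ i φ).2 (hφ i), ?_⟩
      rintro ⟨φ', h⟩ hφ'
      obtain ⟨φ', rfl⟩ := exists_eq_of_isHomLift (a := HallObj.mk N Z Φ A)
        (b := HallObj.mk N Z' Φ' A') (f := 𝟙 N) φ' h
      obtain rfl : φ' = φ := Fam.HomOver.ext_of_comp l' hl' fun i =>
        ((hθ i φ').1 (hφ' i)).trans (hφ i).symm
      rfl
    · intro c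
      choose Z Φ C hC using fun i => exists_eq_mk (c i)
      obtain rfl : c = _ := funext hC
      obtain ⟨A, hA⟩ := Fam.HomOver.exists_of_restrictions (V := V) (hS := hS) (X := X.obj)
        (N := N) fun i => (C i).pull (sysNat (Φ i) _)
      choose θ hθ using hA
      refine ⟨⟨HallObj.mk N X.obj (𝟙 _) A, rfl⟩, fun i => ⟨⟨ivlι (hS.edge N i), θ i⟩, ?_⟩⟩
      exact isStronglyCocartesian_of_isIso (a := HallObj.mk N X.obj (𝟙 _) A)
        (b := HallObj.mk _ (Z i) (Φ i) (C i)) hV hV' X.property (ivlι_spec (hS.edge N i)) (θ i) (hθ i)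

end MonoidalPrederivator

/-! ### The pull-back functor between Hall categories -/

namespace MonoidalPrederivator

section Coherence

variable (V : MonoidalPrederivator.{u, v, w}) {A₀ A₁ A₂ B₀ B₁ B₂ C₀ C₁ : Grpd.{u, u}}

theorem csq_symm_hom {F : A₀ ⥤ B₀} {G : B₀ ⥤ B₁} {F' : A₀ ⥤ A₁} {G' : A₁ ⥤ B₁}
    (e : F ⋙ G = F' ⋙ G') (Z : V.obj B₁) : (V.csq e.symm Z).hom = (V.csq e Z).inv := by
  rw [← cancel_mono (V.csq e Z).hom, Iso.inv_hom_id, V.csq_eq e rfl e.symm,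
    V.csq_eq e.symm e.symm rfl, Category.assoc, Iso.hom_inv_id_assoc, Iso.inv_hom_id]

/-- The variant of `cmp_map_csq_csq` for squares read in the other direction. -/
theorem map_cmp_csq_csq {T : A₀ ⥤ A₁} {T' : B₀ ⥤ B₁} {T'' : C₀ ⥤ C₁} {F₀ : A₀ ⥤ B₀} {F₁ : A₁ ⥤ B₁}
    {G₀ : B₀ ⥤ C₀} {G₁ : B₁ ⥤ C₁} {H₀ : A₀ ⥤ C₀} {H₁ : A₁ ⥤ C₁} (h₀ : F₀ ⋙ G₀ = H₀)
    (h₁ : F₁ ⋙ G₁ = H₁) (e : T ⋙ F₁ = F₀ ⋙ T') (e' : T' ⋙ G₁ = G₀ ⋙ T'')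
    (e'' : T ⋙ H₁ = H₀ ⋙ T'') (Z : V.obj C₁) :
    (V.pull T).map (V.cmp h₁ Z).hom ≫ (V.csq e ((V.pull G₁).obj Z)).hom ≫
        (V.pull F₀).map (V.csq e' Z).hom =
      (V.csq e'' Z).hom ≫ (V.cmp h₀ ((V.pull T'').obj Z)).hom := by
  have h := V.cmp_map_csq_csq h₀ e'.symm e.symm h₁ e''.symm Z
  rw [V.csq_symm_hom e', V.csq_symm_hom e, V.csq_symm_hom e''] at h
  have h' := congrArg (fun t => (V.csq e'' Z).hom ≫ t ≫ (V.csq e ((V.pull G₁).obj Z)).hom ≫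
    (V.pull F₀).map (V.csq e' Z).hom) h
  simp only [Category.assoc, Iso.hom_inv_id_assoc, Iso.inv_hom_id_assoc, ← Functor.map_comp,
    Iso.inv_hom_id, CategoryTheory.Functor.map_id, Category.comp_id] at h'
  exact h'.symm

/-- Commutative squares of morphisms over functors can be pasted along a common morphism `i₁`. -/
theorem comp_sq {T₁ : B₀ ⥤ B₁} {T₂ : B₁ ⥤ B₂} {T : B₀ ⥤ B₂} {S₁ : A₀ ⥤ A₁} {S₂ : A₁ ⥤ A₂}
    {S : A₀ ⥤ A₂} {F₀ : B₀ ⥤ A₀} {F₁ : B₁ ⥤ A₁} {F₂ : B₂ ⥤ A₂} (t : T₁ ⋙ T₂ = T) (s : S₁ ⋙ S₂ = S)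
    (e₁ : T₁ ⋙ F₁ = F₀ ⋙ S₁) (e₂ : T₂ ⋙ F₂ = F₁ ⋙ S₂) (e : T ⋙ F₂ = F₀ ⋙ S) {Z₀ : V.obj A₀}
    {Z₁ : V.obj A₁} {Z₂ : V.obj A₂} {W₀ : V.obj B₀} {W₁ : V.obj B₁} {W₂ : V.obj B₂}
    {φ : Z₀ ⟶ (V.pull S₁).obj Z₁} {ψ : Z₁ ⟶ (V.pull S₂).obj Z₂} {φ' : W₀ ⟶ (V.pull T₁).obj W₁}
    {ψ' : W₁ ⟶ (V.pull T₂).obj W₂} {i₀ : W₀ ⟶ (V.pull F₀).obj Z₀} {i₁ : W₁ ⟶ (V.pull F₁).obj Z₁}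
    {i₂ : W₂ ⟶ (V.pull F₂).obj Z₂}
    (h : φ' ≫ (V.pull T₁).map i₁ ≫ (V.csq e₁ Z₁).hom = i₀ ≫ (V.pull F₀).map φ)
    (h' : ψ' ≫ (V.pull T₂).map i₂ ≫ (V.csq e₂ Z₂).hom = i₁ ≫ (V.pull F₁).map ψ) :
    ((φ' ≫ (V.pull T₁).map ψ') ≫ (V.cmp t W₂).inv) ≫ (V.pull T).map i₂ ≫ (V.csq e Z₂).hom =
      i₀ ≫ (V.pull F₀).map ((φ ≫ (V.pull S₁).map ψ) ≫ (V.cmp s Z₂).inv) := by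
  have c := V.cmp_map_csq_csq t e₂ e₁ s e Z₂
  have c' : (V.cmp t ((V.pull F₂).obj Z₂)).inv ≫ (V.csq e Z₂).hom =
      (V.pull T₁).map (V.csq e₂ Z₂).hom ≫ (V.csq e₁ ((V.pull S₂).obj Z₂)).hom ≫
        (V.pull F₀).map (V.cmp s Z₂).inv := by
    rw [Iso.inv_comp_eq, reassoc_of% c, ← Functor.map_comp, Iso.hom_inv_id,
      CategoryTheory.Functor.map_id, Category.comp_id]
  simp only [Category.assoc, Functor.map_comp]
  rw [← reassoc_of% V.cmp_inv_nat t, c', ← reassoc_of% h, ← reassoc_of% V.csq_nat e₁,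
    ← Functor.map_comp_assoc, ← Functor.map_comp_assoc, ← Functor.map_comp_assoc, Category.assoc, h']

/-- Commutative squares of morphisms over functors can be pasted along a common morphism `φ'`, the
sides transverse to it being composed. -/
theorem comp_sq' {T : A₀ ⥤ A₁} {T' : B₀ ⥤ B₁} {T'' : C₀ ⥤ C₁} {F₀ : A₀ ⥤ B₀} {F₁ : A₁ ⥤ B₁}
    {G₀ : B₀ ⥤ C₀} {G₁ : B₁ ⥤ C₁} {H₀ : A₀ ⥤ C₀} {H₁ : A₁ ⥤ C₁} (h₀ : F₀ ⋙ G₀ = H₀)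
    (h₁ : F₁ ⋙ G₁ = H₁) (e : T ⋙ F₁ = F₀ ⋙ T') (e' : T' ⋙ G₁ = G₀ ⋙ T'')
    (e'' : T ⋙ H₁ = H₀ ⋙ T'') {Z₀ : V.obj C₀} {Z₁ : V.obj C₁} {W₀ : V.obj B₀} {W₁ : V.obj B₁}
    {R₀ : V.obj A₀} {R₁ : V.obj A₁} {φ : Z₀ ⟶ (V.pull T'').obj Z₁} {φ' : W₀ ⟶ (V.pull T').obj W₁}
    {φ'' : R₀ ⟶ (V.pull T).obj R₁} {i₀ : W₀ ⟶ (V.pull G₀).obj Z₀} {i₁ : W₁ ⟶ (V.pull G₁).obj Z₁}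
    {j₀ : R₀ ⟶ (V.pull F₀).obj W₀} {j₁ : R₁ ⟶ (V.pull F₁).obj W₁} {k₀ : R₀ ⟶ (V.pull H₀).obj Z₀}
    {k₁ : R₁ ⟶ (V.pull H₁).obj Z₁}
    (hk₀ : k₀ ≫ (V.cmp h₀ Z₀).hom = j₀ ≫ (V.pull F₀).map i₀)
    (hk₁ : k₁ ≫ (V.cmp h₁ Z₁).hom = j₁ ≫ (V.pull F₁).map i₁)
    (h : φ' ≫ (V.pull T').map i₁ ≫ (V.csq e' Z₁).hom = i₀ ≫ (V.pull G₀).map φ)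
    (h' : φ'' ≫ (V.pull T).map j₁ ≫ (V.csq e W₁).hom = j₀ ≫ (V.pull F₀).map φ') :
    φ'' ≫ (V.pull T).map k₁ ≫ (V.csq e'' Z₁).hom = k₀ ≫ (V.pull H₀).map φ := by
  rw [← cancel_mono (V.cmp h₀ _).hom, Category.assoc, Category.assoc, Category.assoc,
    ← V.map_cmp_csq_csq h₀ h₁ e e' e'', V.cmp_nat h₀, reassoc_of% hk₀, ← Functor.map_comp, ← h,
    Functor.map_comp, Functor.map_comp, ← reassoc_of% h', ← reassoc_of% V.csq_nat e,
    ← Functor.map_comp_assoc, ← Functor.map_comp_assoc, hk₁]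

end Coherence

variable {V : MonoidalPrederivator.{u, v, w}} {W X Y : S.Objᵒᵖ ⥤ Grpd.{u, u}} {hS : S.IsAdmissible}

/-- The inverse of a morphism of families whose components have inverses. -/
def Fam.Hom.ofInverse {I : Type} [Preorder I] {P : I → I → Prop} {D : IvlSys.{u} P} {A B : V.Fam D}
    (φ : Hom A B) (ψ : ∀ {x y : I} (h : P x y), B.val h ⟶ A.val h)
    (h₁ : ∀ {x y : I} (h : P x y), φ.app h ≫ ψ h = 𝟙 _)
    (h₂ : ∀ {x y : I} (h : P x y), ψ h ≫ φ.app h = 𝟙 _) : Hom B A where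
  app h := ψ h
  mul hxy hyz hxz := by
    have : Mono (φ.app hxz) := SplitMono.mono ⟨_, h₁ hxz⟩
    rw [← cancel_mono (φ.app hxz), Category.assoc, Category.assoc, h₂, φ.mul,
      tensorHom_comp_tensorHom_assoc, ← Functor.map_comp, ← Functor.map_comp, h₂, h₂]
    simp
  one h := by rw [← φ.one, Category.assoc, h₁, Category.comp_id]

/-- The canonical morphism from the pull-back along a transformation with the components of the
composite of `T` and `T'` to the iterated pull-back `T^* T'^* B`. -/
def Fam.pullPullInv {I : Type} [Preorder I] {P : I → I → Prop} {D D' D'' : IvlSys.{u} P}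
    (T : IvlSys.Hom D'' D') (T' : IvlSys.Hom D' D) (T'' : IvlSys.Hom D'' D)
    (e : ∀ {x y : I} (h : P x y), T.F h ⋙ T'.F h = T''.F h) (B : V.Fam D) :
    Hom (B.pull T'') ((B.pull T').pull T) :=
  Hom.ofInverse (pullPull T T' T'' e B) (fun h => (V.cmp (e h) (B.val h)).hom)
    (fun h => (V.cmp (e h) (B.val h)).inv_hom_id) (fun h => (V.cmp (e h) (B.val h)).hom_inv_id)

/-- The morphism of families `[x, y] ↦ A_[f x, f y]` given by a morphism of families. -/
noncomputable def Fam.Hom.reindex {M N : S.Obj} {A B : V.Fam (sysOf X N)} (φ : Hom A B)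
    (f : M ⟶ N) : Hom (A.reindex (hS := hS) f) (B.reindex (hS := hS) f) where
  app h := φ.app (hS.map f h)
  mul hxy hyz hxz := φ.mul (hS.map f hxy) (hS.map f hyz) (hS.map f hxz)
  one h := φ.one (hS.map f h)

/-- The transformation of interval systems `Y_[f x, f y] ⥤ X_[x, y]` given by `f : M ⟶ N` and
`Ψ : Y ⟶ X`. -/
noncomputable abbrev sysDiag (hS : S.IsAdmissible) (Ψ : Y ⟶ X) {M N : S.Obj} (f : M ⟶ N) :
    (sysMap Y hS f).Hom (sysOf X M) where
  F h := (sysHom Y hS f).F h ⋙ (sysNat Ψ M).F h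
  nat h h' hx hy := by
    rw [← Functor.assoc, (sysHom Y hS f).nat, Functor.assoc, (sysNat Ψ M).nat, Functor.assoc]

theorem sysHom_sysNat (Ψ : Y ⟶ X) {M N : S.Obj} (f : M ⟶ N) {x y : S.El M}
    (h : HasInterval M x y) : (sysHom Y hS f).F h ⋙ (sysNat Ψ M).F h =
      (sysNatMap hS Ψ f).F h ⋙ (sysHom X hS f).F h :=
  Ψ.naturality (ivlMap f h (hS.map f h) le_rfl le_rfl).op

/-- The pull-back along `Ψ` of a morphism of families over `f`. -/
noncomputable def Fam.HomOver.pullNat {M N : S.Obj} {f : M ⟶ N} {A : V.Fam (sysOf X N)}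
    {B : V.Fam (sysOf X M)} (φ : HomOver hS f A B) (Ψ : Y ⟶ X) :
    HomOver hS f (A.pull (sysNat Ψ N)) (B.pull (sysNat Ψ M)) :=
  (Fam.Hom.pull φ (sysNatMap hS Ψ f)).comp
    ((pullPull (sysNatMap hS Ψ f) (sysHom X hS f) (sysDiag hS Ψ f)
      (fun h => (sysHom_sysNat Ψ f h).symm) B).comp
      (pullPullInv (sysHom Y hS f) (sysNat Ψ M) (sysDiag hS Ψ f) (fun _ => rfl) B))

namespace HallObj

/-- The formal pull-back of an object of the Hall category along `Ψ : Y ⟶ X`. -/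
def pull (Ψ : Y ⟶ X) (a : HallObj V X hS) : HallObj V Y hS := ⟨a.base, a.Z, Ψ ≫ a.Φ, a.val⟩

/-- The family which the formal pull-back stands for is isomorphic to the pull-back of the
family. -/
noncomputable def toPull (Ψ : Y ⟶ X) (a : HallObj V X hS) :
    Fam.Hom (a.pull Ψ).fam (a.fam.pull (sysNat Ψ a.base)) :=
  Fam.pullPullInv (sysNat Ψ a.base) (sysNat a.Φ a.base) (sysNat (Ψ ≫ a.Φ) a.base)
    (fun _ => rfl) a.val

/-- The inverse of `toPull`. -/
noncomputable def ofPull (Ψ : Y ⟶ X) (a : HallObj V X hS) :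
    Fam.Hom (a.fam.pull (sysNat Ψ a.base)) (a.pull Ψ).fam :=
  Fam.pullPull (sysNat Ψ a.base) (sysNat a.Φ a.base) (sysNat (Ψ ≫ a.Φ) a.base)
    (fun _ => rfl) a.val

variable {a b c : HallObj V X hS}

/-- The pull-back along `Ψ` of a morphism of families over `f`, transported to the families which the
formal pull-backs of `a` and `b` stand for. -/
noncomputable def mapHom (Ψ : Y ⟶ X) {f : b.base ⟶ a.base} (φ : Fam.HomOver hS f a.fam b.fam) :
    Fam.HomOver hS f (a.pull Ψ).fam (b.pull Ψ).fam :=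
  ((a.toPull Ψ).reindex f).comp (Fam.Hom.comp (φ.pullNat Ψ) ((b.ofPull Ψ).pull (sysHom Y hS f)))

theorem toPull_ofPull (Ψ : Y ⟶ X) (a : HallObj V X hS) {x y : S.El a.base}
    (h : HasInterval a.base x y) : (a.toPull Ψ).app h ≫ (a.ofPull Ψ).app h = 𝟙 _ :=
  Iso.hom_inv_id _

theorem ofPull_toPull (Ψ : Y ⟶ X) (a : HallObj V X hS) {x y : S.El a.base}
    (h : HasInterval a.base x y) : (a.ofPull Ψ).app h ≫ (a.toPull Ψ).app h = 𝟙 _ :=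
  Iso.inv_hom_id _

/-- `φ'` corresponds to the pull-back of `φ` along `Ψ` under the canonical isomorphisms. -/
def IsMapHom (Ψ : Y ⟶ X) {f : b.base ⟶ a.base} (φ : Fam.HomOver hS f a.fam b.fam)
    (φ' : Fam.HomOver hS f (a.pull Ψ).fam (b.pull Ψ).fam) : Prop :=
  ∀ {x y : S.El b.base} (h : HasInterval b.base x y),
    φ'.app h ≫ (V.pull ((sysHom Y hS f).F h)).map ((b.toPull Ψ).app h) ≫
        (V.csq (sysHom_sysNat Ψ f h) (b.fam.val h)).hom =
      (a.toPull Ψ).app (hS.map f h) ≫ (V.pull ((sysNatMap hS Ψ f).F h)).map (φ.app h)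

theorem isMapHom_mapHom (Ψ : Y ⟶ X) {f : b.base ⟶ a.base} (φ : Fam.HomOver hS f a.fam b.fam) :
    IsMapHom Ψ φ (mapHom Ψ φ) := by
  intro x y h
  have key : ∀ {A₀ A₁ B₀ B₁ : Grpd.{u, u}} {T : A₀ ⥤ A₁} {T' : B₀ ⥤ B₁} {F₀ : A₀ ⥤ B₀}
      {F₁ : A₁ ⥤ B₁} {K : A₀ ⥤ B₁} (e : T ⋙ F₁ = F₀ ⋙ T') (e₁ : F₀ ⋙ T' = K) (e₂ : T ⋙ F₁ = K)
      {Z : V.obj A₀} {U : V.obj A₁} {W₀ : V.obj B₀} {W₁ : V.obj B₁} (i : Z ⟶ (V.pull F₀).obj W₀)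
      (φ : W₀ ⟶ (V.pull T').obj W₁) (j : (V.pull F₁).obj W₁ ⟶ U) (j' : U ⟶ (V.pull F₁).obj W₁),
      j ≫ j' = 𝟙 _ →
      (i ≫ ((V.pull F₀).map φ ≫ ((V.cmp e₁ W₁).inv ≫ (V.cmp e₂ W₁).hom)) ≫ (V.pull T).map j) ≫
        (V.pull T).map j' ≫ (V.csq e W₁).hom = i ≫ (V.pull F₀).map φ := by
    intro A₀ A₁ B₀ B₁ T T' F₀ F₁ K e e₁ e₂ Z U W₀ W₁ i φ j j' h
    simp only [Category.assoc]
    rw [← Functor.map_comp_assoc, h, V.csq_eq e e₂ e₁]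
    simp
  exact key _ (sysHom_sysNat Ψ f h).symm rfl ((a.toPull Ψ).app (hS.map f h)) (φ.app h)
    ((b.ofPull Ψ).app h) ((b.toPull Ψ).app h) (b.ofPull_toPull Ψ h)

theorem IsMapHom.eq_mapHom {Ψ : Y ⟶ X} {f : b.base ⟶ a.base} {φ : Fam.HomOver hS f a.fam b.fam}
    {φ' : Fam.HomOver hS f (a.pull Ψ).fam (b.pull Ψ).fam} (h : IsMapHom Ψ φ φ') :
    φ' = mapHom Ψ φ := by
  apply Fam.Hom.ext
  funext x y hxy
  have key : ∀ {A₀ A₁ B₀ B₁ : Grpd.{u, u}} {T : A₀ ⥤ A₁} {T' : B₀ ⥤ B₁} {F₀ : A₀ ⥤ B₀}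
      {F₁ : A₁ ⥤ B₁} (e : T ⋙ F₁ = F₀ ⋙ T') {Z : V.obj A₀} {U : V.obj A₁} {W₁ : V.obj B₁}
      (φ φ' : Z ⟶ (V.pull T).obj U) (j : (V.pull F₁).obj W₁ ⟶ U) (j' : U ⟶ (V.pull F₁).obj W₁),
      j' ≫ j = 𝟙 _ → φ ≫ (V.pull T).map j' ≫ (V.csq e W₁).hom =
        φ' ≫ (V.pull T).map j' ≫ (V.csq e W₁).hom → φ = φ' := by
    intro A₀ A₁ B₀ B₁ T T' F₀ F₁ e Z U W₁ φ φ' j j' h h'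
    have : Mono j' := SplitMono.mono ⟨_, h⟩
    have h'' := congrArg (fun t => t ≫ (V.csq e W₁).inv ≫ (V.pull T).map j) h'
    simpa only [Category.assoc, Iso.hom_inv_id_assoc, ← Functor.map_comp, h,
      CategoryTheory.Functor.map_id, Category.comp_id] using h''
  exact key _ _ _ ((b.ofPull Ψ).app hxy) ((b.toPull Ψ).app hxy) (b.toPull_ofPull Ψ hxy)
    ((h hxy).trans (isMapHom_mapHom Ψ φ hxy).symm)

theorem mapHom_id (Ψ : Y ⟶ X) (a : HallObj V X hS) :
    mapHom Ψ (Fam.HomOver.id a.fam) = Fam.HomOver.id (a.pull Ψ).fam := by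
  refine (IsMapHom.eq_mapHom ?_).symm
  intro x y h
  have key : ∀ {A₀ B₀ : Grpd.{u, u}} {T : A₀ ⥤ A₀} {T' : B₀ ⥤ B₀} {F₀ : A₀ ⥤ B₀}
      (e : T ⋙ F₀ = F₀ ⋙ T') (h : T = 𝟭 _) (h' : T' = 𝟭 _) {Z : V.obj A₀} {W : V.obj B₀}
      (i : Z ⟶ (V.pull F₀).obj W),
      (V.cid h Z).inv ≫ (V.pull T).map i ≫ (V.csq e W).hom =
        i ≫ (V.pull F₀).map (V.cid h' W).inv := by
    intro A₀ B₀ T T' F₀ e h h' Z W i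
    have e₁ : T ⋙ F₀ = F₀ := by rw [h]; rfl
    have e₂ : F₀ ⋙ T' = F₀ := by rw [h']; rfl
    rw [← reassoc_of% V.cid_inv_nat h, V.csq_eq e e₁ e₂, V.cmp_inv_left h e₁,
      Iso.inv_hom_id_assoc, ← cancel_mono ((V.pull F₀).map (V.cid h' W).hom), Category.assoc,
      Category.assoc, V.cmp_cid_right h' e₂, ← Functor.map_comp, Iso.inv_hom_id,
      CategoryTheory.Functor.map_id]
  exact key _ (Fam.HomOver.sysHom_id (X := Y) (hS := hS) a.base h)
    (Fam.HomOver.sysHom_id (X := X) (hS := hS) a.base h) ((a.toPull Ψ).app h)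

theorem mapHom_comp (Ψ : Y ⟶ X) {f : b.base ⟶ a.base} {g : c.base ⟶ b.base}
    (φ : Fam.HomOver hS f a.fam b.fam) (ψ : Fam.HomOver hS g b.fam c.fam) :
    mapHom Ψ (φ.comp ψ) = Fam.HomOver.comp (mapHom Ψ φ) (mapHom Ψ ψ) := by
  refine (IsMapHom.eq_mapHom ?_).symm
  intro x y h
  exact V.comp_sq (Fam.HomOver.sysHomMap_comp g f h) (Fam.HomOver.sysHomMap_comp g f h)
    (sysHom_sysNat Ψ f (hS.map g h)) (sysHom_sysNat Ψ g h) (sysHom_sysNat Ψ (g ≫ f) h)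
    (isMapHom_mapHom Ψ φ (hS.map g h)) (isMapHom_mapHom Ψ ψ h)

/-- Pull-back along the identity is the identity, strictly. -/
theorem mapHom_id_nat {f : b.base ⟶ a.base} (φ : Fam.HomOver hS f a.fam b.fam) :
    mapHom (𝟙 X) φ = φ := by
  refine (IsMapHom.eq_mapHom ?_).symm
  intro x y h
  have key : ∀ {A₀ A₁ B₀ B₁ : Grpd.{u, u}} {T : A₀ ⥤ A₁} (e : T ⋙ 𝟭 _ = 𝟭 _ ⋙ T)
      {G₀ : A₀ ⥤ B₀} {G₁ : A₁ ⥤ B₁} (h₀ : 𝟭 _ ⋙ G₀ = G₀) (h₁ : 𝟭 _ ⋙ G₁ = G₁)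
      {Z : V.obj B₀} {W : V.obj B₁} (φ : (V.pull G₀).obj Z ⟶ (V.pull T).obj ((V.pull G₁).obj W)),
      φ ≫ (V.pull T).map (V.cmp h₁ W).hom ≫ (V.csq e ((V.pull G₁).obj W)).hom =
        (V.cmp h₀ Z).hom ≫ (V.pull (𝟭 _)).map φ := by
    intro A₀ A₁ B₀ B₁ T e G₀ G₁ h₀ h₁ Z W φ
    have d : ∀ {A B : Grpd.{u, u}} {G : A ⥤ B} (e : 𝟭 _ ⋙ G = G)
        (Z : V.obj B), (V.cmp e Z).hom = (V.cid rfl ((V.pull G).obj Z)).inv := by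
      intro A B G e Z
      rw [← cancel_mono (V.cid rfl ((V.pull G).obj Z)).hom, V.cmp_cid_left rfl e, Iso.inv_hom_id]
    rw [d h₀, d h₁, ← V.cid_inv_nat, V.cid_inv_csq rfl e rfl, d]
  exact key (G₀ := a.Φ.app (op (ivl (hS.map f h)))) (G₁ := b.Φ.app (op (ivl h)))
    (Z := a.val.val (hS.map f h)) (W := b.val.val h) (sysHom_sysNat (𝟙 X) f h) rfl rfl (φ.app h)

/-- Pull-back is strictly functorial in the morphism of 2-Segal functors. -/
theorem mapHom_comp_nat (Ψ' : W ⟶ Y) (Ψ : Y ⟶ X) {f : b.base ⟶ a.base}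
    (φ : Fam.HomOver hS f a.fam b.fam) :
    mapHom (Ψ' ≫ Ψ) φ = mapHom (a := a.pull Ψ) (b := b.pull Ψ) Ψ' (mapHom Ψ φ) := by
  refine (IsMapHom.eq_mapHom ?_).symm
  intro x y h
  refine V.comp_sq' (F₀ := (sysNatMap hS Ψ' f).F h) (G₀ := (sysNatMap hS Ψ f).F h)
    (F₁ := (sysNat Ψ' _).F h) (G₁ := (sysNat Ψ _).F h) rfl rfl
    (sysHom_sysNat Ψ' f h) (sysHom_sysNat Ψ f h) (sysHom_sysNat (Ψ' ≫ Ψ) f h) ?_ ?_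
    (isMapHom_mapHom Ψ φ h) (isMapHom_mapHom (a := a.pull Ψ) (b := b.pull Ψ) Ψ' (mapHom Ψ φ) h)
  · exact V.cmp_assoc rfl rfl rfl rfl _
  · exact V.cmp_assoc rfl rfl rfl rfl _

end HallObj

/-- The pull-back functor between Hall categories given by `Ψ : Y ⟶ X`. -/
noncomputable def hallMap (Ψ : Y ⟶ X) : BasedFunctor (hall V X hS) (hall V Y hS) where
  obj a := HallObj.pull Ψ a
  map := fun (φ : HallObj.Hom _ _) => ⟨φ.base, HallObj.mapHom Ψ φ.hom⟩
  map_id a := congrArg (HallObj.Hom.mk (a := HallObj.pull Ψ a) (b := HallObj.pull Ψ a) (𝟙 _))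
    (HallObj.mapHom_id Ψ a)
  map_comp {a _ c} := fun (φ : HallObj.Hom _ _) (ψ : HallObj.Hom _ _) =>
    congrArg (HallObj.Hom.mk (a := HallObj.pull Ψ a) (b := HallObj.pull Ψ c) (ψ.base ≫ φ.base))
      (HallObj.mapHom_comp Ψ φ.hom ψ.hom)
  w := rfl

theorem basedFunctor_ext {B : Type*} [Category* B] {E E' : BasedCategory.{v', u'} B}
    {F G : BasedFunctor E E'} (h : F.toFunctor = G.toFunctor) : F = G := by
  cases F
  cases G
  cases h
  rfl

theorem hallMap_id : hallMap (V := V) (hS := hS) (𝟙 X) = BasedFunctor.id _ := by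
  refine basedFunctor_ext (CategoryTheory.Functor.hext (fun _ => rfl) ?_)
  intro a b (φ : HallObj.Hom _ _)
  exact heq_of_eq (congrArg (HallObj.Hom.mk (a := a) (b := b) φ.base)
    (HallObj.mapHom_id_nat φ.hom))

theorem hallMap_comp (Ψ' : W ⟶ Y) (Ψ : Y ⟶ X) :
    hallMap (V := V) (hS := hS) (Ψ' ≫ Ψ) = (hallMap Ψ).comp (hallMap Ψ') := by
  refine basedFunctor_ext (CategoryTheory.Functor.hext (fun _ => rfl) ?_)
  intro a b (φ : HallObj.Hom _ _)
  refine heq_of_eq ?_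
  exact congrArg (HallObj.Hom.mk (a := HallObj.pull (Ψ' ≫ Ψ) a)
        (b := HallObj.pull (Ψ' ≫ Ψ) b) φ.base) (HallObj.mapHom_comp_nat Ψ' Ψ φ.hom)

theorem HallObj.isIso_mapHom (Ψ : Y ⟶ X) {a b : HallObj V X hS} {f : b.base ⟶ a.base}
    (φ : Fam.HomOver hS f a.fam b.fam) {x y : S.El b.base} (h : HasInterval b.base x y)
    (hφ : IsIso (φ.app h)) : IsIso ((mapHom Ψ φ).app h) := by
  have key : ∀ {A₀ A₁ B₀ B₁ : Grpd.{u, u}} {T : A₀ ⥤ A₁} {T' : B₀ ⥤ B₁} {F₀ : A₀ ⥤ B₀}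
      {F₁ : A₁ ⥤ B₁} {K : A₀ ⥤ B₁} (e₁ : F₀ ⋙ T' = K) (e₂ : T ⋙ F₁ = K)
      {Z : V.obj A₀} {U : V.obj A₁} {W₀ : V.obj B₀} {W₁ : V.obj B₁} (i : Z ⟶ (V.pull F₀).obj W₀)
      (φ : W₀ ⟶ (V.pull T').obj W₁) (j : (V.pull F₁).obj W₁ ⟶ U), IsIso i → IsIso φ → IsIso j →
      IsIso (i ≫ ((V.pull F₀).map φ ≫ ((V.cmp e₁ W₁).inv ≫ (V.cmp e₂ W₁).hom)) ≫
        (V.pull T).map j) := by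
    intros
    infer_instance
  exact key (sysHom_sysNat Ψ f h).symm rfl ((a.toPull Ψ).app (hS.map f h)) (φ.app h)
    ((b.ofPull Ψ).app h) ⟨_, a.toPull_ofPull Ψ _, a.ofPull_toPull Ψ _⟩ hφ
    ⟨_, b.ofPull_toPull Ψ _, b.toPull_ofPull Ψ _⟩

/-- The pull-back functor preserves the co-Cartesian morphisms over interval inclusions, as these
are the morphisms whose components on edges are isomorphisms. -/
theorem isStronglyCocartesian_hallMap (hV : V.IsLeftDerivator)
    (hV' : V.IsComponentwiseCocontinuous) (hX : IsTwoSegal hS X) (hY : IsTwoSegal hS Y) (Ψ : Y ⟶ X)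
    {J N : S.Obj} (j : J ⟶ N) {x y : S.El N} (hj : IsIntervalInclusion j x y)
    {a b : HallObj V X hS} (φ : a ⟶ b) (hφ : (hall V X hS).p.IsStronglyCocartesian j.op φ) :
    (hall V Y hS).p.IsStronglyCocartesian j.op ((hallMap Ψ).map φ) := by
  have hφ₀ : (hall V X hS).p.IsHomLift j.op φ := hφ.toIsHomLift
  obtain rfl : a.base = N :=
    Opposite.op_injective (IsHomLift.domain_eq (hall V X hS).p j.op φ)
  obtain rfl : b.base = J :=
    Opposite.op_injective (IsHomLift.codomain_eq (hall V X hS).p j.op φ)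
  obtain ⟨φ, rfl⟩ := exists_eq_of_isHomLift φ hφ.toIsHomLift
  exact isStronglyCocartesian_of_isIso (a := HallObj.pull Ψ a) (b := HallObj.pull Ψ b) hV hV' hY hj
    (HallObj.mapHom Ψ φ) fun i => HallObj.isIso_mapHom Ψ φ _
      (isIso_of_isStronglyCocartesian hV hV' hX hj φ hφ i)

/-- Compatibility with the multiplication for a morphism to a family pulled back along `Ψ`, in terms
of `pullAtSq`. -/
theorem Fam.Hom.mul_pullAtSq {N : S.Obj} {A : V.Fam (sysOf X N)} {A' : V.Fam (sysOf Y N)}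
    {Ψ : Y ⟶ X} (φ : Hom A' (A.pull (sysNat Ψ N))) {x y z : S.El N} (hxy : HasInterval N x y)
    (hyz : HasInterval N y z) (hxz : HasInterval N x z) :
    (A'.mul hxy hyz hxz).hom ≫ φ.app hxz =
      (((V.along Y (ivlInc hxy hxz le_rfl hyz.le)).map (φ.app hxy) ≫
          (V.pullAtSq Ψ (ivlInc hxy hxz le_rfl hyz.le)).hom.app (A.val hxy)) ⊗ₘ
        ((V.along Y (ivlInc hyz hxz hxy.le le_rfl)).map (φ.app hyz) ≫
          (V.pullAtSq Ψ (ivlInc hyz hxz hxy.le le_rfl)).hom.app (A.val hyz))) ≫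
      Functor.LaxMonoidal.μ (V.pullAt Ψ (ivl hxz)) _ _ ≫
      (V.pullAt Ψ (ivl hxz)).map (A.mul hxy hyz hxz).hom := by
  refine (φ.mul hxy hyz hxz).trans ?_
  change _ ≫ (Fam.pullMul (sysNat Ψ N) A hxy hyz hxz).hom = _
  simp only [Fam.pullMul, Iso.trans_hom, tensorIso_hom, Functor.Monoidal.μIso_hom,
    Functor.mapIso_hom, tensorHom_comp_tensorHom_assoc]
  exact congrArg₂ (fun s t => ((V.pull _).map (φ.app hxy) ≫ s ⊗ₘ (V.pull _).map (φ.app hyz) ≫ t) ≫ _)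
    (V.pullAtSq_hom_app Ψ _ _ _).symm (V.pullAtSq_hom_app Ψ _ _ _).symm

/-- The pull-back functor is given on families by pull-back along `Ψ`. -/
noncomputable def hallFunctor (Ψ : Y ⟶ X) :
    HallFunctor (hallCategory V X hS) (hallCategory V Y hS) Ψ (hallMap Ψ) where
  iso {N} a x y h := by
    obtain ⟨a, ha⟩ := a
    obtain rfl : a.base = N := Opposite.op_injective ha
    exact V.cmp (F := (sysNat Ψ a.base).F h) (G := (sysNat a.Φ a.base).F h) rfl (a.val.val h)
  mul := by
    rintro N a x y z hxy hyz hxz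
    obtain ⟨Z, Φ, A, rfl⟩ := exists_eq_mk a
    let a : HallObj V X hS := ⟨N, Z, Φ, A⟩
    exact (a.toPull Ψ).mul_pullAtSq hxy hyz hxz
  one := by
    rintro N a x h
    obtain ⟨Z, Φ, A, rfl⟩ := exists_eq_mk a
    let a : HallObj V X hS := ⟨N, Z, Φ, A⟩
    exact (a.toPull Ψ).one h
  hom := by
    rintro M N f a b φ hφ hφ' x y h
    obtain ⟨Z, Φ, A, rfl⟩ := exists_eq_mk a
    obtain ⟨Z', Φ', B, rfl⟩ := exists_eq_mk b
    obtain ⟨φ, rfl⟩ := exists_eq_of_isHomLift (a := ⟨N, Z, Φ, A⟩) (b := ⟨M, Z', Φ', B⟩) φ hφ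
    let a : HallObj V X hS := ⟨N, Z, Φ, A⟩
    let b : HallObj V X hS := ⟨M, Z', Φ', B⟩
    refine Eq.trans ?_ (HallObj.isMapHom_mapHom (a := a) (b := b) Ψ φ h)
    exact congrArg (fun t => (HallObj.mapHom (a := a) (b := b) Ψ φ).app h ≫
      (V.pull ((sysHom Y hS f).F h)).map ((b.toPull Ψ).app h) ≫ t) (V.pullAtSq_hom_app Ψ _ _ _)

end MonoidalPrederivator

end Hall

open Hall

theorem mainTheorem2 (S : SimplexSubcategory.{s}) (hS : S.IsAdmissible)
    (V : MonoidalPrederivator.{u, v, w}) (hV : V.IsLeftDerivator)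
    (hV' : V.IsComponentwiseCocontinuous) :
    ∃ (H : (TwoSegal.{s, u} hS)ᵒᵖ ⥤ SegalOpfibration.{s, v, max s (u + 1) v w} hS)
      (K : ∀ X : TwoSegal.{s, u} hS, V.HallCategory X.obj hS (H.obj (op X)).total),
      ∀ {X Y : TwoSegal.{s, u} hS} (Φ : Y ⟶ X),
        Nonempty (MonoidalPrederivator.HallFunctor (K X) (K Y) Φ.hom (H.map Φ.op).1) := by
  let H : (TwoSegal.{s, u} hS)ᵒᵖ ⥤ SegalOpfibration.{s, v, max s (u + 1) v w} hS :=
    { obj := fun X => V.hallSegal hV hV' X.unop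
      map := fun {X Y} Ψ => ⟨MonoidalPrederivator.hallMap Ψ.unop.hom,
        fun j _ _ hj _ _ φ hφ => MonoidalPrederivator.isStronglyCocartesian_hallMap hV hV'
          X.unop.property Y.unop.property Ψ.unop.hom j hj φ hφ⟩
      map_id := fun _ => Subtype.ext MonoidalPrederivator.hallMap_id
      map_comp := fun Ψ Ψ' => Subtype.ext
        (MonoidalPrederivator.hallMap_comp Ψ'.unop.hom Ψ.unop.hom) }
  exact ⟨H, fun X => V.hallCategory X.obj hS, fun Φ =>
    ⟨MonoidalPrederivator.hallFunctor Φ.hom⟩⟩
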